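/- **Setting.** Let $V:\mathbb R\to\mathbb R$ satisfy: $V=0$ on $(0,\infty)$; $V$ is left-continuous at $0$ with $V(0)=V(0^-)=\lambda>0$; $V$ is Lipschitz continuous on $(-\infty,0]$. Let $v:\mathbb R\to\mathbb R$ be Lipschitz continuous, and let $b>0$ be such that $v(r_2)-v(r_1)\le -b(r_2-r_1)$ for all real $r_2\ge r_1\ge \inf_{\mathbb R} V$ (that is, for all $r_2\ge r_1\ge 0$ if $V\ge 0$, and for all $r_2\ge r_1$ if $V$ is unbounded below). Put $U(x)=V(x)$ for $x\le 0$ and $U(x)=\lambda$ for $x>0$. Let $[f]_{\mathrm{Lip}(S)}$ be the least Lipschitz constant of $f$ on $S$, with $[f]_{\mathrm{Lip}}=[f]_{\mathrm{Lip}(\mathbb R)}$, and set $K=[v]_{\mathrm{Lip}}[U]_{\mathrm{Lip}}$. Let $p\in[1,\infty]$. $\mathcal P_p(\mathbb R)$ is the set of probability measures on $\mathbb R$ with finite $p$-th moment (bounded support if $p=\infty$). The quantile function of $\mu$ is $X_\mu(z)=\inf\{x:\mu((-\infty,x])\ge z\}$, and the $p$-Wasserstein distance on $\mathcal P_p(\mathbb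 R)$ is $\mathcal W_p(\mu,\nu)=\|X_\mu-X_\nu\|_{L^p([0,1])}$. A *dissipative measure solution* of $\partial_t\rho+\partial_x(\rho\, v(V*\rho))=0$ with initial datum $\rho_0\in\mathcal P_p(\mathbb R)$ is a curve $\rho:[0,\infty)\to\mathcal P_p(\mathbb R)$, continuous for $\mathcal W_p$, with $\rho(0)=\rho_0$, such that $\rho(t)$ is absolutely continuous with density in $L^\infty(\mathbb R)$ for every $t>0$, and, for every $\varphi\in C^1_c(\mathbb R\times(0,\infty))$, $$\int_0^\infty\!\!\int_{\mathbb R}\partial_t\varphi(x,t)\,d\rho(t)(x)\,dt+\int_0^\infty\!\!\int_{\mathbb R} v\Big(\int_{\mathbb R} V(x-y)\,d\rho(t)(y)\Big)\,\partial_x\varphi(x,t)\,d\rho(t)(x)\,dt=0 .$$ **Theorem.** For every $p\in[1,\infty]$ and every $\rho_0\in\mathcal P_p(\mathbb R)$ there is exactly one dissipative measure solution $\rho$ with initial datum $\rho_0$. Moreover: (i) The quantile functions $X(\cdot,t)=X_{\rho(t)}$ satisfy $X(\cdot,0)=X_{\rho_0}$; for almost every $z\in[0,1]$ the function $t\mapsto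 X(z,t)$ is locally Lipschitz on $[0,\infty)$; and for almost every $(z,t)\in[0,1]\times(0,\infty)$ $$\partial_tX(z,t)=v\Big(\int_0^1U(X(z,t)-X(\zeta,t))\,d\zeta-\lambda z\Big).$$ (ii) $\rho\in L^\infty_{\mathrm{loc}}((0,\infty);L^\infty(\mathbb R))$, in the sense that $\rho$ has a density that is jointly measurable in $(x,t)$ and is bounded in $L^\infty(\mathbb R)$ uniformly for $t$ in compact subsets of $(0,\infty)$; and for all $t>0$ $$\|\rho(t)\|_{L^\infty(\mathbb R)}\le\frac{K}{b\lambda}\big(1-e^{-Kt}\big)^{-1},$$ where for $K=0$ the right-hand side is understood as its limit $\frac1{b\lambda t}$. (iii) If $\rho_1,\rho_2$ are dissipative measure solutions with initial data $\rho_{1,0},\rho_{2,0}\in\mathcal P_p(\mathbb R)$, then for all $t\ge0$ $$\mathcal W_p(\rho_1(t),\rho_2(t))\le e^{Ct}\,\mathcal W_p(\rho_{1,0},\rho_{2,0}),$$ with $C=2^{\frac{p+1}{p}}[v]_{\mathrm{Lip}}[V]_{\mathrm{Lip}((-\infty,0])}$ if $p<\infty$ and $C=2[v]_{\mathrm{Lip}}[V]_{\mathrm{Lip}((-\infty,0])}$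 if $p=\infty$. -/

import Mathlib

open MeasureTheory Set Filter Topology
open scoped NNReal ENNReal

noncomputable section

/-- The Lipschitz seminorm `[f]_{Lip(s)}`, i.e. the least Lipschitz constant of `f` on `s`
(only used for functions that are Lipschitz on `s`). -/
def lipSeminorm (f : ℝ → ℝ) (s : Set ℝ) : ℝ≥0 :=
  sInf {K : ℝ≥0 | LipschitzOnWith K f s}

/-- The standing assumptions on the interaction kernel `V` and on the velocity map `v`.
The infimum of `V` is taken in the extended reals, so that for nonnegative `V` (recall `V = 0` on
the positive half-line) the condition in `velocity_decreasing` reads `0 ≤ r₁ ≤ r₂`, and for `V`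
unbounded below it reads `r₁ ≤ r₂`. -/
structure StandingAssumptions (V v : ℝ → ℝ) (lam b : ℝ) : Prop where
  kernel_support : ∀ x, 0 < x → V x = 0
  kernel_leftCont : ContinuousWithinAt V (Iic 0) 0
  kernel_zero : V 0 = lam
  lam_pos : 0 < lam
  kernel_lipschitz : ∃ K : ℝ≥0, LipschitzOnWith K V (Iic 0)
  velocity_lipschitz : ∃ K : ℝ≥0, LipschitzWith K v
  b_pos : 0 < b
  velocity_decreasing : ∀ r₁ r₂ : ℝ, (⨅ x, (V x : EReal)) ≤ (r₁ : EReal) → r₁ ≤ r₂ →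
    v r₂ - v r₁ ≤ -b * (r₂ - r₁)

/-- The Lipschitz extension `U` of `V` restricted to the nonpositive half-line. -/
def kernelU (V : ℝ → ℝ) (lam : ℝ) (x : ℝ) : ℝ :=
  if x ≤ 0 then V x else lam

/-- The quantile function (pseudo-inverse of the cumulative distribution function) of `μ`.
The infimum is the genuine one for `0 < z < 1`; the two end points play no role below. -/
def quantile (μ : Measure ℝ) (z : ℝ) : ℝ :=
  sInf {x : ℝ | z ≤ μ.real (Iic x)}

/-- `μ` has finite `p`-moment; for `p = ∞` this says that `μ` has bounded support. -/
def HasFiniteMoment (p : ℝ≥0∞) (μ : Measure ℝ) : Prop :=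
  MemLp (fun x : ℝ => x) p μ

/-- The `p`-Wasserstein distance on the real line, `W_p(μ, ν) = ‖X_μ - X_ν‖_{L^p([0,1])}`. -/
def wasserstein (p : ℝ≥0∞) (μ ν : Measure ℝ) : ℝ≥0∞ :=
  eLpNorm (fun z => quantile μ z - quantile ν z) p (volume.restrict (Icc (0 : ℝ) 1))

/-- The `L^∞(ℝ)` norm of the density of `μ` with respect to Lebesgue measure (meaningful for
absolutely continuous `μ`). -/
def densityNorm (μ : Measure ℝ) : ℝ≥0∞ :=
  essSup (μ.rnDeriv volume) volume

/-- `μ` is absolutely continuous with a density in `L^∞(ℝ)`. -/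
def HasBoundedDensity (μ : Measure ℝ) : Prop :=
  μ ≪ volume ∧ densityNorm μ < ∞

/-- The nonlocal velocity `v((V * μ)(x))`. -/
def nonlocalVelocity (V v : ℝ → ℝ) (μ : Measure ℝ) (x : ℝ) : ℝ :=
  v (∫ y, V (x - y) ∂μ)

/-- Dissipative measure solutions of `∂_t ρ + ∂_x (ρ v(V * ρ)) = 0` with initial datum `ρ₀`, as
curves in the `p`-Wasserstein space parametrised by `t ∈ [0, ∞)`. The test functions `φ (x, t)`
are `C¹` with compact support in `ℝ × (0, ∞)`. -/
structure IsDissipativeSolution (V v : ℝ → ℝ) (p : ℝ≥0∞) (ρ₀ : ProbabilityMeasure ℝ)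
    (ρ : ℝ≥0 → ProbabilityMeasure ℝ) : Prop where
  finiteMoment : ∀ t, HasFiniteMoment p (ρ t : Measure ℝ)
  continuous : ∀ t, Tendsto (fun s => wasserstein p (ρ s : Measure ℝ) (ρ t : Measure ℝ))
    (𝓝 t) (𝓝 0)
  boundedDensity : ∀ t, 0 < t → HasBoundedDensity (ρ t : Measure ℝ)
  weakEquation : ∀ φ : ℝ × ℝ → ℝ, ContDiff ℝ 1 φ → HasCompactSupport φ →
    tsupport φ ⊆ univ ×ˢ Ioi (0 : ℝ) →
    (∫ t in Ioi (0 : ℝ), (∫ x, deriv (fun s => φ (x, s)) t ∂(ρ t.toNNReal : Measure ℝ)))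
      + (∫ t in Ioi (0 : ℝ), (∫ x, nonlocalVelocity V v (ρ t.toNNReal : Measure ℝ) x
          * deriv (fun y => φ (y, t)) x ∂(ρ t.toNNReal : Measure ℝ))) = 0
  initial : ρ 0 = ρ₀

/-- The quantile function `X(z, t)` of a curve of measures, for real `t ≥ 0`. -/
def quantileCurve (ρ : ℝ≥0 → ProbabilityMeasure ℝ) (z t : ℝ) : ℝ :=
  quantile (ρ t.toNNReal : Measure ℝ) z

/-- `X(·, 0) = X_{ρ₀}` and
`∂_t X(z,t) = v(∫_0^1 U(X(z,t) - X(ζ,t)) dζ - λ z)` for almost every `(z,t)` in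
`[0,1] × (0,∞)`. The time derivative is an honest one: for almost every `z` the function
`t ↦ X(z, t)` is locally Lipschitz on `[0, ∞)`, so that it is the integral of its derivative. -/
def SolvesQuantileEquation (V v : ℝ → ℝ) (lam : ℝ) (ρ₀ : ProbabilityMeasure ℝ)
    (ρ : ℝ≥0 → ProbabilityMeasure ℝ) : Prop :=
  (∀ z, quantileCurve ρ z 0 = quantile (ρ₀ : Measure ℝ) z) ∧
  (∀ᵐ z ∂(volume.restrict (Icc (0 : ℝ) 1)),
    LocallyLipschitzOn (Ici (0 : ℝ)) (fun t => quantileCurve ρ z t)) ∧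
  (∀ᵐ q ∂((volume : Measure (ℝ × ℝ)).restrict (Icc (0 : ℝ) 1 ×ˢ Ioi (0 : ℝ))),
    HasDerivAt (fun s => quantileCurve ρ q.1 s)
      (v ((∫ ζ in Icc (0 : ℝ) 1,
        kernelU V lam (quantileCurve ρ q.1 q.2 - quantileCurve ρ ζ q.2)) - lam * q.1)) q.2)

/-- The bound `K / (b λ) * (1 - exp (-K t))⁻¹` with `K = [v]_Lip [U]_Lip`, understood as its limit
`1 / (b λ t)` when `K = 0`. -/
def smoothingBound (V v : ℝ → ℝ) (lam b t : ℝ) : ℝ :=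
  let K : ℝ := (lipSeminorm v univ : ℝ) * (lipSeminorm (kernelU V lam) univ : ℝ)
  if K = 0 then 1 / (b * lam * t) else K / (b * lam) * (1 - Real.exp (-K * t))⁻¹

/-- `ρ ∈ L^∞_loc((0, ∞); L^∞(ℝ))`: there is a jointly measurable density `r (t, x)`, essentially
bounded in `x` uniformly for `t` in compact subintervals of `(0, ∞)`. -/
def LocallyBoundedDensity (ρ : ℝ≥0 → ProbabilityMeasure ℝ) : Prop :=
  ∃ r : ℝ → ℝ → ℝ≥0∞, Measurable (Function.uncurry r) ∧
    (∀ t, 0 < t → (ρ t.toNNReal : Measure ℝ) = volume.withDensity (r t)) ∧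
    ∀ t₁ t₂, 0 < t₁ → ∃ M : ℝ≥0, ∀ t ∈ Icc t₁ t₂, essSup (r t) volume ≤ M

/-- The growth constant in the stability estimate. -/
def stabilityConst (V v : ℝ → ℝ) (p : ℝ≥0∞) : ℝ :=
  (if p = ∞ then 2 else (2 : ℝ) ^ ((p.toReal + 1) / p.toReal))
    * (lipSeminorm v univ : ℝ) * (lipSeminorm V (Iic 0) : ℝ)

end

/-! Write the kernel as `V = U - λ 1_{(0,∞)}` with `U` Lipschitz. The jump contributes `-λ` times
the distribution function to `V * ρ`, and at the quantile `X(z,t)` of an atomless measure the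
distribution function equals `z`. In mass coordinates the equation therefore becomes `∂_t X(z) = v(∫
U(X(z) - X(ζ)) dζ - λ z)`: the singular part has turned into the fixed term `-λ z`, and the rest is
Lipschitz in `X`.

Existence. This is a Lipschitz differential equation in a weighted space of bounded continuous
functions, so it has global solutions (`exists_global_solution`, `exists_quantile_flow`). Since `v`
need only decrease above `inf V`, it is first replaced by a globally decreasing `w`; the two agree
on averages of `V`. For `z₁ < z₂` the gap `D = X(z₂) - X(z₁)` satisfies `D' ≥ bλ(z₂ - z₁) - K|D|`,
because the drop of `-λ z` under a decreasing velocity map acts as a repulsion (`velocity_sub_ge`).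
Hence `D ≥ bλ(z₂ - z₁)(1 - exp(-Kt))/K`, read as `bλ(z₂ - z₁)t` if `K = 0`. This keeps `X(·,t)`
monotone, removes atoms at positive times, and is exactly the density bound (`separation`,
`map_unitMass_le_of_separated`). Pushing the mass coordinate forward by `X(·,t)` gives a dissipative
solution.

Uniqueness and stability. For an arbitrary dissipative solution the weak equation must be shown to
imply the quantile equation. Absence of atoms makes the velocity jointly continuous at positive
times, so averages of test functions are differentiable in time (`hasDerivAt_integral`). Testing
with smoothed half-lines that move at constant speed shows that the mass to the left of a front
faster than the fluid grows, and to the left of a slower one decreases (`front_cdf_mono`). Fronts of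
speed `u ± ε` squeeze each quantile, which therefore moves at speed `u`
(`hasDerivAt_quantileCurve`). For two solutions the terms `-λ z` cancel at equal `z`; Gronwall's
inequality for fixed `z`, followed by an `L^p` norm in `z`, yields stability with rate `2 [v]_Lip
[V]_Lip((-∞,0])` for every `p`, and with it uniqueness. -/

/-! ### Quantile functions -/

/-- Lebesgue measure on the unit interval, the space of mass coordinates. -/
noncomputable abbrev unitMass : Measure ℝ := volume.restrict (Icc (0 : ℝ) 1)

instance isProbabilityMeasure_unitMass : IsProbabilityMeasure unitMass :=
  ⟨by simp [unitMass]⟩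

theorem unitMass_eq_Ioo : unitMass = volume.restrict (Ioo (0 : ℝ) 1) :=
  Measure.restrict_congr_set Ioo_ae_eq_Icc.symm

theorem ae_unitMass_mem_Ioo : ∀ᵐ z ∂unitMass, z ∈ Ioo (0 : ℝ) 1 := by
  rw [unitMass_eq_Ioo]
  exact ae_restrict_mem measurableSet_Ioo

theorem unitMass_real_Iic {a : ℝ} (h0 : 0 ≤ a) (h1 : a ≤ 1) : unitMass.real (Iic a) = a := by
  rw [measureReal_def, Measure.restrict_apply measurableSet_Iic]
  have : Iic a ∩ Icc (0 : ℝ) 1 = Icc 0 a := by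
    ext x; simp only [mem_inter_iff, mem_Iic, mem_Icc]; constructor
    · rintro ⟨h, h', -⟩; exact ⟨h', h⟩
    · rintro ⟨h, h'⟩; exact ⟨h', h, h'.trans h1⟩
  rw [this, Real.volume_Icc, ENNReal.toReal_ofReal] <;> linarith

section

variable (μ : Measure ℝ) [IsProbabilityMeasure μ]

theorem quantile_set_nonempty {z : ℝ} (hz : z < 1) : {x : ℝ | z ≤ μ.real (Iic x)}.Nonempty := by
  have h2 : Tendsto (fun x => μ.real (Iic x)) atTop (𝓝 1) := by
    simpa only [← ProbabilityTheory.cdf_eq_real] using ProbabilityTheory.tendsto_cdf_atTop μ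
  obtain ⟨x, hx⟩ := (h2.eventually_const_lt hz).exists
  exact ⟨x, hx.le⟩

theorem quantile_set_bddBelow {z : ℝ} (hz : 0 < z) : BddBelow {x : ℝ | z ≤ μ.real (Iic x)} := by
  have h2 : Tendsto (fun x => μ.real (Iic x)) atBot (𝓝 0) := by
    simpa only [← ProbabilityTheory.cdf_eq_real] using ProbabilityTheory.tendsto_cdf_atBot μ
  obtain ⟨x, hx⟩ := (h2.eventually_lt_const hz).exists
  refine ⟨x, fun y hy => ?_⟩
  by_contra! hlt
  have : μ.real (Iic y) ≤ μ.real (Iic x) := measureReal_mono (Iic_subset_Iic.2 hlt.le)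
  have hy' : z ≤ μ.real (Iic y) := hy
  linarith

theorem tendsto_measureReal_Iic_right (x : ℝ) :
    Tendsto (fun y => μ.real (Iic y)) (𝓝[>] x) (𝓝 (μ.real (Iic x))) := by
  have h : Tendsto (fun y => μ.real (Iic y)) (𝓝[≥] x) (𝓝 (μ.real (Iic x))) := by
    simp only [← ProbabilityTheory.cdf_eq_real]
    exact (ProbabilityTheory.cdf μ).right_continuous x
  exact h.mono_left (nhdsWithin_mono _ Ioi_subset_Ici_self)

/-- The Galois connection between the quantile function and the distribution function. -/
theorem quantile_le_iff {z : ℝ} (hz : z ∈ Ioo (0 : ℝ) 1) (x : ℝ) :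
    quantile μ z ≤ x ↔ z ≤ μ.real (Iic x) := by
  constructor
  · intro h
    refine ge_of_tendsto (tendsto_measureReal_Iic_right μ x) ?_
    filter_upwards [self_mem_nhdsWithin] with y hy
    obtain ⟨w, hw, hwy⟩ := exists_lt_of_csInf_lt (quantile_set_nonempty μ hz.2)
      (lt_of_le_of_lt h hy)
    exact le_trans hw (measureReal_mono (Iic_subset_Iic.2 hwy.le))
  · intro h
    exact csInf_le (quantile_set_bddBelow μ hz.1) h

theorem lt_quantile_iff {z : ℝ} (hz : z ∈ Ioo (0 : ℝ) 1) (x : ℝ) :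
    x < quantile μ z ↔ μ.real (Iic x) < z := by
  rw [← not_le, quantile_le_iff μ hz, not_le]

theorem quantile_monotoneOn : MonotoneOn (quantile μ) (Ioo (0 : ℝ) 1) := by
  intro a ha b hb hab
  rw [quantile_le_iff μ ha]
  exact hab.trans ((quantile_le_iff μ hb _).1 le_rfl)

theorem aemeasurable_quantile : AEMeasurable (quantile μ) unitMass := by
  rw [unitMass_eq_Ioo]
  exact aemeasurable_restrict_of_monotoneOn measurableSet_Ioo (quantile_monotoneOn μ)

/-- By the Galois connection the preimage of `Iic x` is, up to a null set, an interval of length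
equal to the distribution function at `x`. This moves every integral against `μ` to the mass
coordinate. -/
theorem map_quantile : unitMass.map (quantile μ) = μ := by
  have : IsProbabilityMeasure (unitMass.map (quantile μ)) :=
    Measure.isProbabilityMeasure_map (aemeasurable_quantile μ)
  refine Measure.ext_of_Iic _ _ fun x => ?_
  rw [← measureReal_eq_measureReal_iff,
    map_measureReal_apply_of_aemeasurable (aemeasurable_quantile μ) measurableSet_Iic]
  rw [← unitMass_real_Iic (a := μ.real (Iic x)) measureReal_nonneg measureReal_le_one]
  refine measureReal_congr ?_
  filter_upwards [ae_unitMass_mem_Ioo] with z hz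
  exact propext (quantile_le_iff μ hz x)

theorem integral_eq_integral_quantile {f : ℝ → ℝ} (hf : AEStronglyMeasurable f μ) :
    ∫ x, f x ∂μ = ∫ z, f (quantile μ z) ∂unitMass := by
  have h := integral_map (μ := unitMass) (φ := quantile μ) (f := f) (aemeasurable_quantile μ)
  rw [map_quantile] at h
  exact h hf

theorem integrable_iff_integrable_quantile {f : ℝ → ℝ} (hf : AEStronglyMeasurable f μ) :
    Integrable f μ ↔ Integrable (fun z => f (quantile μ z)) unitMass := by
  have h := integrable_map_measure (μ := unitMass) (f := quantile μ) (g := f)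
  rw [map_quantile] at h
  exact h hf (aemeasurable_quantile μ)

theorem hasFiniteMoment_iff (p : ℝ≥0∞) :
    HasFiniteMoment p μ ↔ MemLp (quantile μ) p unitMass := by
  have h := memLp_map_measure_iff (μ := unitMass) (f := quantile μ) (g := fun x : ℝ => x) (p := p)
    (mβ := inferInstance)
  rw [map_quantile] at h
  exact h aestronglyMeasurable_id (aemeasurable_quantile μ)

theorem eq_of_quantile_ae_eq (ν : Measure ℝ) [IsProbabilityMeasure ν]
    (h : quantile μ =ᵐ[unitMass] quantile ν) : μ = ν := by
  rw [← map_quantile μ, ← map_quantile ν]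
  exact Measure.map_congr h

/-- Left continuity is what singles out the quantile function among the monotone functions with the
same law, so it has to be propagated by the flow. -/
theorem quantile_leftContinuous {z : ℝ} (hz : z ∈ Ioo (0 : ℝ) 1) :
    Tendsto (quantile μ) (𝓝[<] z) (𝓝 (quantile μ z)) := by
  rw [tendsto_order]
  constructor
  · intro x hx
    rw [lt_quantile_iff μ hz] at hx
    have h1 : Ioo (max 0 (μ.real (Iic x))) z ∈ 𝓝[<] z :=
      Ioo_mem_nhdsLT (max_lt hz.1 hx)
    filter_upwards [h1] with w hw
    have hw0 : 0 < w := (le_max_left _ _).trans_lt hw.1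
    rw [lt_quantile_iff μ ⟨hw0, hw.2.trans hz.2⟩]
    exact (le_max_right _ _).trans_lt hw.1
  · intro x hx
    filter_upwards [Ioo_mem_nhdsLT hz.1] with w hw
    exact (quantile_monotoneOn μ ⟨hw.1, hw.2.trans hz.2⟩ hz hw.2.le).trans_lt hx

end

theorem aemeasurable_of_monotoneOn_unit {X : ℝ → ℝ} (hX : MonotoneOn X (Ioo 0 1)) :
    AEMeasurable X unitMass := by
  rw [unitMass_eq_Ioo]
  exact aemeasurable_restrict_of_monotoneOn measurableSet_Ioo hX

/-- A nondecreasing left-continuous function is the quantile function of the law it induces. -/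
theorem quantile_map_of_monotoneOn {X : ℝ → ℝ} (hX : MonotoneOn X (Ioo 0 1))
    (hl : ∀ z ∈ Ioo (0 : ℝ) 1, Tendsto X (𝓝[<] z) (𝓝 (X z))) {z : ℝ} (hz : z ∈ Ioo (0 : ℝ) 1) :
    quantile (unitMass.map X) z = X z := by
  have hm := aemeasurable_of_monotoneOn_unit hX
  have : IsProbabilityMeasure (unitMass.map X) := Measure.isProbabilityMeasure_map hm
  apply le_antisymm
  · rw [quantile_le_iff _ hz, map_measureReal_apply_of_aemeasurable hm measurableSet_Iic]
    calc z = unitMass.real (Iic z) := (unitMass_real_Iic hz.1.le hz.2.le).symm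
      _ ≤ unitMass.real (X ⁻¹' Iic (X z)) := by
        refine ENNReal.toReal_mono (measure_ne_top _ _) (measure_mono_ae ?_)
        filter_upwards [ae_unitMass_mem_Ioo] with w hw hwz
        exact hX hw hz hwz
  -- By left continuity it suffices to bound `X w` for `w < z`. Were `X w` larger than the quantile,
  -- monotonicity would confine the sublevel set to `Iic w`, of mass `w < z`.
  · refine le_of_tendsto (hl z hz) ?_
    filter_upwards [Ioo_mem_nhdsLT hz.1] with w hw
    by_contra! hlt
    have hw' : w ∈ Ioo (0 : ℝ) 1 := ⟨hw.1, hw.2.trans hz.2⟩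
    have h1 := (quantile_le_iff (unitMass.map X) hz _).1 le_rfl
    rw [map_measureReal_apply_of_aemeasurable hm measurableSet_Iic] at h1
    have h2 : unitMass.real (X ⁻¹' Iic (quantile (unitMass.map X) z)) ≤ unitMass.real (Iic w) := by
      refine ENNReal.toReal_mono (measure_ne_top _ _) (measure_mono_ae ?_)
      filter_upwards [ae_unitMass_mem_Ioo] with y hy hyz
      by_contra hcon
      have h3 : w < y := not_le.1 hcon
      have h4 := hX hw' hy h3.le
      have h5 : X y ≤ quantile (unitMass.map X) z := hyz
      linarith
    rw [unitMass_real_Iic hw'.1.le hw'.2.le] at h2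
    linarith [hw.2]

/-! ### The interaction kernel and the velocity map -/

/-- The infimum is attained: the Lipschitz inequality holds for every larger constant and passes to
the limit. -/
theorem lipschitzOnWith_lipSeminorm {f : ℝ → ℝ} {s : Set ℝ}
    (h : ∃ K : ℝ≥0, LipschitzOnWith K f s) : LipschitzOnWith (lipSeminorm f s) f s := by
  refine LipschitzOnWith.of_dist_le_mul fun x hx y hy => ?_
  have hne : {K : ℝ≥0 | LipschitzOnWith K f s}.Nonempty := h
  have key : ∀ K : ℝ≥0, lipSeminorm f s < K → dist (f x) (f y) ≤ K * dist x y := by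
    intro K hK
    obtain ⟨K', hK', hlt⟩ := exists_lt_of_csInf_lt hne hK
    exact (hK'.dist_le_mul x hx y hy).trans (by gcongr)
  have hc : Tendsto (fun K : ℝ≥0 => (K : ℝ) * dist x y) (𝓝[>] (lipSeminorm f s))
      (𝓝 ((lipSeminorm f s : ℝ) * dist x y)) := by
    refine Tendsto.mono_left ?_ nhdsWithin_le_nhds
    exact ((NNReal.continuous_coe.tendsto _).mul_const _)
  refine ge_of_tendsto hc ?_
  filter_upwards [self_mem_nhdsWithin] with K hK using key K hK

namespace StandingAssumptions

variable {V v : ℝ → ℝ} {lam b : ℝ}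

theorem lipschitzWith_velocity (h : StandingAssumptions V v lam b) :
    LipschitzWith (lipSeminorm v univ) v := by
  obtain ⟨K, hK⟩ := h.velocity_lipschitz
  exact lipschitzOnWith_univ.1 (lipschitzOnWith_lipSeminorm ⟨K, hK.lipschitzOnWith⟩)

theorem kernelU_eq (h : StandingAssumptions V v lam b) (x : ℝ) :
    kernelU V lam x = V (min x 0) := by
  rcases le_or_gt x 0 with hx | hx
  · simp [kernelU, hx]
  · simp [kernelU, hx.not_ge, hx.le, h.kernel_zero]

theorem lipschitzWith_kernelU (h : StandingAssumptions V v lam b) :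
    LipschitzWith (lipSeminorm V (Iic 0)) (kernelU V lam) := by
  refine LipschitzWith.of_dist_le_mul fun x y => ?_
  rw [h.kernelU_eq, h.kernelU_eq]
  refine ((lipschitzOnWith_lipSeminorm h.kernel_lipschitz).dist_le_mul _ (min_le_right x 0) _
    (min_le_right y 0)).trans ?_
  gcongr
  rw [Real.dist_eq, Real.dist_eq]
  exact abs_min_sub_min_le_max x 0 y 0 |>.trans (by simp)

theorem lipschitzWith_kernelU' (h : StandingAssumptions V v lam b) :
    LipschitzWith (lipSeminorm (kernelU V lam) univ) (kernelU V lam) :=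
  lipschitzOnWith_univ.1 (lipschitzOnWith_lipSeminorm ⟨_, h.lipschitzWith_kernelU.lipschitzOnWith⟩)

theorem kernelU_zero (h : StandingAssumptions V v lam b) : kernelU V lam 0 = lam := by
  simp [kernelU, h.kernel_zero]

/-- Separates the jump from the Lipschitz part. Convolved with a measure, the jump gives `lam` times
the mass strictly to the left of the point. -/
theorem kernel_eq (h : StandingAssumptions V v lam b) (x : ℝ) :
    V x = kernelU V lam x - lam * (Ioi (0 : ℝ)).indicator 1 x := by
  rcases le_or_gt x 0 with hx | hx
  · simp [kernelU, hx]
  · simp [kernelU, hx.not_ge, hx, h.kernel_support x hx]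

theorem iInf_kernel_le (V : ℝ → ℝ) (x : ℝ) : (⨅ x, (V x : EReal)) ≤ V x :=
  iInf_le (fun x => (V x : EReal)) x

theorem iInf_kernel_le_zero (h : StandingAssumptions V v lam b) : (⨅ x, (V x : EReal)) ≤ 0 :=
  (iInf_kernel_le V 1).trans (by simp [h.kernel_support 1 one_pos])

/-- Both properties of `v` are compared on `[0, 1]`, which lies above `inf V` because `V` vanishes
on the positive half-line. -/
theorem rate_le (h : StandingAssumptions V v lam b) : b ≤ lipSeminorm v univ := by
  have h1 := h.velocity_decreasing 0 1 (by simpa using h.iInf_kernel_le_zero) zero_le_one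
  have h2 := h.lipschitzWith_velocity.dist_le_mul 1 0
  rw [Real.dist_eq, Real.dist_eq] at h2
  have h3 := neg_abs_le (v 1 - v 0)
  norm_num at h2
  linarith

/-- Replacing `v` below `inf V` by an affine function makes it decrease at rate `b` everywhere. -/
theorem exists_decreasing_extension (h : StandingAssumptions V v lam b) :
    ∃ w : ℝ → ℝ, LipschitzWith (lipSeminorm v univ) w ∧
      (∀ r₁ r₂, r₁ ≤ r₂ → w r₂ - w r₁ ≤ -b * (r₂ - r₁)) ∧
      ∀ r : ℝ, (⨅ x, (V x : EReal)) ≤ r → w r = v r := by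
  induction hm : (⨅ x, (V x : EReal)) with
  | bot =>
    refine ⟨v, h.lipschitzWith_velocity, fun r₁ r₂ hr => h.velocity_decreasing r₁ r₂ ?_ hr,
      fun _ _ => rfl⟩
    rw [hm]; exact bot_le
  | top =>
    have := h.iInf_kernel_le_zero
    rw [hm] at this
    simp at this
  | coe m =>
    -- The extension has slope `-b` below `m = inf V`. Increments of `r` split into those of `max r
    -- m` and `min r m`, and `b ≤ [v]_Lip` ensures that the Lipschitz constant does not grow.
    refine ⟨fun r => v (max r m) - b * (min r m - m), ?_, ?_, ?_⟩
    · have hL := h.lipschitzWith_velocity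
      have hb := h.rate_le
      have hb0 := h.b_pos
      set L := lipSeminorm v univ
      have key : ∀ r s : ℝ, r ≤ s → |(v (max r m) - b * (min r m - m)) -
          (v (max s m) - b * (min s m - m))| ≤ L * (s - r) := by
        intro r s hrs
        have h1 := hL.dist_le_mul (max r m) (max s m)
        rw [Real.dist_eq, Real.dist_eq] at h1
        have h2 : |max r m - max s m| = max s m - max r m := by
          rw [abs_sub_comm, abs_of_nonneg]
          exact sub_nonneg.2 (max_le_max_right m hrs)
        have h3 : 0 ≤ min s m - min r m := sub_nonneg.2 (min_le_min_right m hrs)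
        have h4 := max_add_min r m
        have h5 := max_add_min s m
        rw [h2] at h1
        have h6 : b * (min s m - min r m) ≤ L * (min s m - min r m) :=
          mul_le_mul_of_nonneg_right hb h3
        have h7 := mul_nonneg hb0.le h3
        have h8 : (L : ℝ) * (s - r) = L * (max s m - max r m) + L * (min s m - min r m) := by
          rw [← mul_add]; congr 1; linarith
        rw [abs_le] at h1 ⊢
        constructor <;> nlinarith
      refine LipschitzWith.of_dist_le_mul fun r s => ?_
      rw [Real.dist_eq, Real.dist_eq]
      rcases le_total r s with hrs | hrs
      · rw [abs_sub_comm r s, abs_of_nonneg (sub_nonneg.2 hrs)]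
        exact key r s hrs
      · rw [abs_of_nonneg (sub_nonneg.2 hrs), abs_sub_comm]
        exact key s r hrs
    · intro r₁ r₂ hr
      have h1 := h.velocity_decreasing (max r₁ m) (max r₂ m)
        (by rw [hm]; exact_mod_cast le_max_right r₁ m) (max_le_max_right m hr)
      have h4 := max_add_min r₁ m
      have h5 := max_add_min r₂ m
      have : -b * (r₂ - r₁) = -b * (max r₂ m - max r₁ m) - b * (min r₂ m - min r₁ m) := by
        have : r₂ - r₁ = (max r₂ m - max r₁ m) + (min r₂ m - min r₁ m) := by linarith
        rw [this]; ring
      simp only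
      linarith
    · intro r hr
      have : m ≤ r := by exact_mod_cast hr
      simp [this]

theorem integrable_kernelU_sub (h : StandingAssumptions V v lam b) {α : Type*} [MeasurableSpace α]
    {μ : Measure α} [IsFiniteMeasure μ] {f : α → ℝ} (hf : Integrable f μ) (x : ℝ) :
    Integrable (fun y => kernelU V lam (x - f y)) μ := by
  have hU := h.lipschitzWith_kernelU
  have hb : Integrable (fun y => |kernelU V lam 0| + (lipSeminorm V (Iic 0) : ℝ) *
      (|x| + ‖f y‖)) μ :=
    (integrable_const _).add (((integrable_const _).add hf.norm).const_mul _)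
  refine hb.mono' ?_ (ae_of_all _ fun y => ?_)
  · exact hU.continuous.comp_aestronglyMeasurable
      (aestronglyMeasurable_const.sub hf.aestronglyMeasurable)
  · have h1 := hU.dist_le_mul (x - f y) 0
    rw [Real.dist_eq, Real.dist_eq, sub_zero] at h1
    have h2 := abs_sub_abs_le_abs_sub (kernelU V lam (x - f y)) (kernelU V lam 0)
    have h3 : |x - f y| ≤ |x| + |f y| := abs_sub x (f y)
    have h4 := mul_le_mul_of_nonneg_left h3 (lipSeminorm V (Iic 0)).coe_nonneg
    rw [Real.norm_eq_abs, Real.norm_eq_abs]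
    linarith

theorem integrable_kernel_sub (h : StandingAssumptions V v lam b) {μ : Measure ℝ}
    [IsFiniteMeasure μ] (hf : Integrable (fun y => y) μ) (x : ℝ) :
    Integrable (fun y => V (x - y)) μ := by
  simp_rw [h.kernel_eq]
  refine (h.integrable_kernelU_sub hf x).sub (Integrable.const_mul ?_ _)
  refine (integrable_const (1 : ℝ)).mono' ?_ (ae_of_all _ fun y => ?_)
  · exact ((measurable_one.indicator measurableSet_Ioi).comp
      (measurable_const.sub measurable_id)).aestronglyMeasurable
  · by_cases hy : x - y ∈ Ioi (0 : ℝ) <;> simp [hy, indicator]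

theorem integral_kernel_sub (h : StandingAssumptions V v lam b) {μ : Measure ℝ}
    [IsFiniteMeasure μ] (hf : Integrable (fun y => y) μ) (x : ℝ) :
    ∫ y, V (x - y) ∂μ = ∫ y, kernelU V lam (x - y) ∂μ - lam * μ.real (Iio x) := by
  have e : ∀ y, (Ioi (0 : ℝ)).indicator (1 : ℝ → ℝ) (x - y) = (Iio x).indicator 1 y := by
    intro y
    by_cases hy : y < x <;> simp [indicator, hy]
  simp_rw [h.kernel_eq, e]
  rw [integral_sub (h.integrable_kernelU_sub hf x)
    (Integrable.const_mul (f := (Iio x).indicator (1 : ℝ → ℝ))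
      ((integrable_const (1 : ℝ)).indicator measurableSet_Iio) lam),
    integral_const_mul, integral_indicator_one measurableSet_Iio]

/-- An average of `V` cannot fall below `inf V`. Hence only values of `v` above `inf V` matter along
solutions, and `v` may be traded for its decreasing extension. -/
theorem iInf_kernel_le_integral (h : StandingAssumptions V v lam b) {μ : Measure ℝ}
    [IsProbabilityMeasure μ] (hf : Integrable (fun y => y) μ) (x : ℝ) :
    (⨅ x, (V x : EReal)) ≤ ((∫ y, V (x - y) ∂μ : ℝ) : EReal) := by
  induction hm : (⨅ x, (V x : EReal)) with
  | bot => exact bot_le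
  | top =>
    have := h.iInf_kernel_le_zero
    rw [hm] at this
    simp at this
  | coe m =>
    have hV : ∀ y, m ≤ V y := fun y => by
      have := iInf_kernel_le V y
      rw [hm] at this
      exact_mod_cast this
    have := integral_mono (integrable_const m) (h.integrable_kernel_sub hf x)
      (fun y => hV (x - y))
    simp only [integral_const, probReal_univ, smul_eq_mul, one_mul] at this
    exact_mod_cast this

end StandingAssumptions

/-! ### Continuity of the nonlocal velocity along a Wasserstein-continuous curve -/

theorem integrable_quantile {μ : Measure ℝ} [IsProbabilityMeasure μ]
    (h : Integrable (fun y => y) μ) : Integrable (quantile μ) unitMass :=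
  (integrable_iff_integrable_quantile μ (f := fun y => y) aestronglyMeasurable_id).1 h

/-- The `L¹` distance between quantile functions. -/
noncomputable def quantileDist (μ ν : Measure ℝ) : ℝ :=
  ∫ z, |quantile μ z - quantile ν z| ∂unitMass

theorem quantileDist_nonneg (μ ν : Measure ℝ) : 0 ≤ quantileDist μ ν :=
  integral_nonneg fun _ => abs_nonneg _

theorem quantileDist_comm (μ ν : Measure ℝ) : quantileDist μ ν = quantileDist ν μ := by
  simp only [quantileDist, abs_sub_comm]

/-- A quantile of `μ` below `y` forces the one of `ν` below `y + δ`, except where the two differ by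
at least `δ`; Chebyshev's inequality bounds the mass of that exceptional set. -/
theorem cdf_le_cdf_add_quantileDist {μ ν : Measure ℝ} [IsProbabilityMeasure μ]
    [IsProbabilityMeasure ν] (hμ : Integrable (fun y => y) μ) (hν : Integrable (fun y => y) ν)
    (y : ℝ) {δ : ℝ} (hδ : 0 < δ) :
    μ.real (Iic y) ≤ ν.real (Iic (y + δ)) + quantileDist μ ν / δ := by
  have hint := ((integrable_quantile hμ).sub (integrable_quantile hν)).abs
  have hch := mul_meas_ge_le_integral_of_nonneg (ae_of_all _ fun _ => abs_nonneg _) hint δ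
  have e : ∀ (κ : Measure ℝ) [IsProbabilityMeasure κ] (x : ℝ),
      κ.real (Iic x) = unitMass.real (quantile κ ⁻¹' Iic x) := fun κ _ x => by
    conv_lhs => rw [← map_quantile κ]
    exact map_measureReal_apply_of_aemeasurable (aemeasurable_quantile κ) measurableSet_Iic
  have hle : unitMass.real {z | δ ≤ |(quantile μ - quantile ν) z|} ≤ quantileDist μ ν / δ := by
    rw [le_div_iff₀ hδ, mul_comm]
    exact hch
  rw [e μ, e ν]
  calc unitMass.real (quantile μ ⁻¹' Iic y)
      ≤ unitMass.real (quantile ν ⁻¹' Iic (y + δ) ∪ {z | δ ≤ |(quantile μ - quantile ν) z|}) := by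
        refine measureReal_mono fun z hz => ?_
        by_cases hd : δ ≤ |(quantile μ - quantile ν) z|
        · exact Or.inr hd
        · left
          have h1 := (abs_lt.1 (not_le.1 hd)).1
          simp only [mem_preimage, mem_Iic, Pi.sub_apply] at *
          linarith
    _ ≤ _ := (measureReal_union_le _ _).trans (by gcongr)

theorem continuous_cdf {μ : Measure ℝ} [IsProbabilityMeasure μ] (h : ∀ x, μ {x} = 0) :
    Continuous fun x => μ.real (Iic x) := by
  have e : ∀ x, μ.real (Iic x) = ProbabilityTheory.cdf μ x := fun x =>
    (ProbabilityTheory.cdf_eq_real μ x).symm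
  refine continuous_iff_continuousAt.2 fun x => continuousAt_iff_continuous_left'_right'.2 ⟨?_, ?_⟩
  · have h0 : (ProbabilityTheory.cdf μ).measure {x} = 0 := by
      rw [ProbabilityTheory.measure_cdf, h]
    rw [StieltjesFunction.measure_singleton, ENNReal.ofReal_eq_zero] at h0
    have hm := (ProbabilityTheory.cdf μ).mono
    have h1 := hm.leftLim_le (le_refl x)
    have h2 : Function.leftLim (ProbabilityTheory.cdf μ) x = ProbabilityTheory.cdf μ x := by
      linarith
    have h3 := hm.tendsto_leftLim x
    rw [h2] at h3
    simpa only [ContinuousWithinAt, e] using h3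
  · exact tendsto_measureReal_Iic_right μ x

/-- Left of the quantile the distribution function is below `z`, and continuity carries this to the
quantile itself. This identity turns the jump part of `V * μ` into `lam * z`. -/
theorem cdf_quantile {μ : Measure ℝ} [IsProbabilityMeasure μ] (h : ∀ x, μ {x} = 0) {z : ℝ}
    (hz : z ∈ Ioo (0 : ℝ) 1) : μ.real (Iic (quantile μ z)) = z := by
  refine le_antisymm ?_ ((quantile_le_iff μ hz _).1 le_rfl)
  refine le_of_tendsto ((continuous_cdf h).continuousAt.tendsto.mono_left
    (nhdsWithin_le_nhds (s := Iio (quantile μ z)))) ?_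
  filter_upwards [self_mem_nhdsWithin] with x hx
  exact ((lt_quantile_iff μ hz x).1 hx).le

/-- The distribution function of an atomless measure is jointly continuous in the point and the
measure. -/
theorem tendsto_cdf_of_quantileDist {ι : Type*} {l : Filter ι} {μ : ι → Measure ℝ} {ν : Measure ℝ}
    [∀ i, IsProbabilityMeasure (μ i)] [IsProbabilityMeasure ν] (hμ : ∀ i, Integrable (fun y => y) (μ i))
    (hν : Integrable (fun y => y) ν) (hat : ∀ x, ν {x} = 0)
    (hd : Tendsto (fun i => quantileDist (μ i) ν) l (𝓝 0)) {x : ι → ℝ} {x₀ : ℝ}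
    (hx : Tendsto x l (𝓝 x₀)) :
    Tendsto (fun i => (μ i).real (Iic (x i))) l (𝓝 (ν.real (Iic x₀))) := by
  rw [Metric.tendsto_nhds]
  intro ε hε
  obtain ⟨δ, hδ, hcont⟩ := Metric.continuousAt_iff.1
    ((continuous_cdf hat).continuousAt (x := x₀)) (ε / 2) (half_pos hε)
  have hd' := (hd.div_const (δ / 4)).eventually_lt_const (u := ε / 2) (by simpa using hε)
  filter_upwards [hd', Metric.tendsto_nhds.1 hx (δ / 4) (by linarith)] with i h1 h2
  have h3 := cdf_le_cdf_add_quantileDist (hμ i) hν (x i) (δ := δ / 4) (by linarith)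
  have h4 := cdf_le_cdf_add_quantileDist hν (hμ i) (x i - δ / 4) (δ := δ / 4) (by linarith)
  rw [quantileDist_comm, sub_add_cancel] at h4
  rw [Real.dist_eq, abs_lt] at h2
  have h5 := hcont (x := x i + δ / 4) (by rw [Real.dist_eq, abs_lt]; constructor <;> linarith)
  have h6 := hcont (x := x i - δ / 4) (by rw [Real.dist_eq, abs_lt]; constructor <;> linarith)
  rw [Real.dist_eq, abs_lt] at h5 h6 ⊢
  constructor <;> linarith

namespace StandingAssumptions

variable {V v : ℝ → ℝ} {lam b : ℝ}

/-- The basic estimate behind all the Lipschitz bounds: moving the point costs `|x - y|`, changing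
the measure costs the `L¹` distance of quantiles. The constant `A` is left free because the
smoothing bound uses the seminorm of `U` while stability uses that of `V` on the half-line. -/
theorem abs_integral_kernelU_sub_le (h : StandingAssumptions V v lam b) {A : ℝ≥0}
    (hA : LipschitzWith A (kernelU V lam)) {X Y : ℝ → ℝ} (hX : Integrable X unitMass)
    (hY : Integrable Y unitMass) (x y : ℝ) :
    |∫ z, kernelU V lam (x - X z) ∂unitMass - ∫ z, kernelU V lam (y - Y z) ∂unitMass| ≤
      A * (|x - y| + ∫ z, |X z - Y z| ∂unitMass) := by
  rw [← integral_sub (h.integrable_kernelU_sub hX x) (h.integrable_kernelU_sub hY y)]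
  refine abs_integral_le_integral_abs.trans ?_
  have hi : Integrable (fun z => |X z - Y z|) unitMass := (hX.sub hY).abs
  calc ∫ z, |kernelU V lam (x - X z) - kernelU V lam (y - Y z)| ∂unitMass
      ≤ ∫ z, (A : ℝ) * (|x - y| + |X z - Y z|) ∂unitMass := by
        refine integral_mono ?_ (((integrable_const _).add hi).const_mul _) fun z => ?_
        · exact ((h.integrable_kernelU_sub hX x).sub (h.integrable_kernelU_sub hY y)).abs
        · have h1 := hA.dist_le_mul (x - X z) (y - Y z)
          rw [Real.dist_eq, Real.dist_eq] at h1
          refine h1.trans ?_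
          gcongr
          calc |x - X z - (y - Y z)| = |(x - y) - (X z - Y z)| := by ring_nf
            _ ≤ _ := abs_sub _ _
    _ = _ := by
        rw [integral_const_mul, integral_add (integrable_const _) hi]
        simp

theorem integral_kernelU_eq_quantile (h : StandingAssumptions V v lam b) (μ : Measure ℝ)
    [IsProbabilityMeasure μ] (x : ℝ) :
    ∫ y, kernelU V lam (x - y) ∂μ = ∫ z, kernelU V lam (x - quantile μ z) ∂unitMass :=
  integral_eq_integral_quantile μ (f := fun y => kernelU V lam (x - y))
    (h.lipschitzWith_kernelU.continuous.comp (continuous_const.sub continuous_id)).aestronglyMeasurable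

theorem integral_abs_eq_quantile (μ : Measure ℝ) [IsProbabilityMeasure μ] :
    ∫ y, |y| ∂μ = ∫ z, |quantile μ z| ∂unitMass :=
  integral_eq_integral_quantile μ (f := fun y => |y|) continuous_abs.aestronglyMeasurable

theorem abs_nonlocalVelocity_le (h : StandingAssumptions V v lam b) {μ : Measure ℝ}
    [IsProbabilityMeasure μ] (hμ : Integrable (fun y => y) μ) (x : ℝ) :
    |nonlocalVelocity V v μ x| ≤ |v 0| + lipSeminorm v univ * (2 * lam +
      lipSeminorm V (Iic 0) * (|x| + ∫ z, |quantile μ z| ∂unitMass)) := by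
  have h1 := h.lipschitzWith_velocity.dist_le_mul (∫ y, V (x - y) ∂μ) 0
  rw [Real.dist_eq, Real.dist_eq, sub_zero] at h1
  have h2 := abs_sub_abs_le_abs_sub (v (∫ y, V (x - y) ∂μ)) (v 0)
  -- The reference configuration is a unit mass at `0` seen from `0`, where the integral is `U(0) =
  -- lam`. The second `lam` in the bound comes from the jump.
  have h3 := h.abs_integral_kernelU_sub_le h.lipschitzWith_kernelU (integrable_quantile hμ)
    (Y := fun _ => 0) (integrable_zero ℝ ℝ unitMass) x 0
  simp only [sub_zero, h.kernelU_zero, integral_const, probReal_univ, one_smul] at h3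
  have h4 := h.integral_kernel_sub hμ x
  rw [h.integral_kernelU_eq_quantile] at h4
  have h5 : μ.real (Iio x) ≤ 1 := measureReal_le_one
  have h6 : 0 ≤ μ.real (Iio x) := measureReal_nonneg
  have h7 : |∫ y, V (x - y) ∂μ| ≤ 2 * lam + lipSeminorm V (Iic 0) *
      (|x| + ∫ z, |quantile μ z| ∂unitMass) := by
    rw [h4]
    have := h.lam_pos
    rw [abs_le] at h3 ⊢
    have h8 : 0 ≤ lam * μ.real (Iio x) := by positivity
    have h9 : lam * μ.real (Iio x) ≤ lam := by nlinarith
    constructor <;> linarith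
  have h8 := mul_le_mul_of_nonneg_left h7 (lipSeminorm v univ).coe_nonneg
  unfold nonlocalVelocity
  linarith

/-- The `U` part is continuous in the quantile distance. The jump part is a distribution function,
continuous jointly in point and measure because the limit has no atoms; this is where the
discontinuity of `V` becomes harmless. -/
theorem tendsto_nonlocalVelocity (h : StandingAssumptions V v lam b) {ι : Type*} {l : Filter ι}
    {μ : ι → Measure ℝ} {ν : Measure ℝ} [∀ i, IsProbabilityMeasure (μ i)] [IsProbabilityMeasure ν]
    (hμ : ∀ i, Integrable (fun y => y) (μ i)) (hν : Integrable (fun y => y) ν)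
    (hat : ∀ x, ν {x} = 0) (hat' : ∀ᶠ i in l, ∀ x, μ i {x} = 0)
    (hd : Tendsto (fun i => quantileDist (μ i) ν) l (𝓝 0)) {x : ι → ℝ} {x₀ : ℝ}
    (hx : Tendsto x l (𝓝 x₀)) :
    Tendsto (fun i => nonlocalVelocity V v (μ i) (x i)) l (𝓝 (nonlocalVelocity V v ν x₀)) := by
  refine (h.lipschitzWith_velocity.continuous.tendsto _).comp ?_
  have hcdf := tendsto_cdf_of_quantileDist hμ hν hat hd hx
  have hU : Tendsto (fun i => ∫ y, kernelU V lam (x i - y) ∂(μ i)) l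
      (𝓝 (∫ y, kernelU V lam (x₀ - y) ∂ν)) := by
    rw [tendsto_iff_dist_tendsto_zero]
    refine squeeze_zero (fun _ => dist_nonneg) (fun i => ?_)
      (g := fun i => (lipSeminorm V (Iic 0) : ℝ) * (|x i - x₀| + quantileDist (μ i) ν)) ?_
    · rw [Real.dist_eq, h.integral_kernelU_eq_quantile, h.integral_kernelU_eq_quantile]
      exact h.abs_integral_kernelU_sub_le h.lipschitzWith_kernelU (integrable_quantile (hμ i))
        (integrable_quantile hν) _ _
    · have h1 : Tendsto (fun i => |x i - x₀|) l (𝓝 0) := by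
        simpa [Real.dist_eq] using tendsto_iff_dist_tendsto_zero.1 hx
      simpa using (h1.add hd).const_mul (lipSeminorm V (Iic 0) : ℝ)
  have hIio : ∀ (κ : Measure ℝ) (y : ℝ), (∀ x, κ {x} = 0) → κ.real (Iio y) = κ.real (Iic y) :=
    fun κ y hκ => measureReal_congr (Iio_ae_eq_Iic' (hκ y))
  have := hU.sub (hcdf.const_mul lam)
  rw [← hIio ν x₀ hat, ← h.integral_kernel_sub hν] at this
  refine this.congr' ?_
  filter_upwards [hat'] with i hi
  rw [h.integral_kernel_sub (hμ i), hIio _ _ hi]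

end StandingAssumptions

/-- Bounded jointly continuous integrands have continuous integrals along a curve of measures. -/
theorem tendsto_integral_of_quantileDist {μ : ℝ → Measure ℝ} [∀ t, IsProbabilityMeasure (μ t)]
    (hμ : ∀ t, Integrable (fun y => y) (μ t)) {t : ℝ}
    (hd : Tendsto (fun s => quantileDist (μ s) (μ t)) (𝓝 t) (𝓝 0)) {h : ℝ → ℝ → ℝ}
    (hcont : ∀ x, ContinuousAt (Function.uncurry h) (x, t))
    (hm : ∀ᶠ s in 𝓝 t, Measurable fun x => h x s)
    {C : ℝ} (hC : ∀ᶠ s in 𝓝 t, ∀ x, |h x s| ≤ C) :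
    Tendsto (fun s => ∫ x, h x s ∂(μ s)) (𝓝 t) (𝓝 (∫ x, h x t ∂(μ t))) := by
  have hI : ∀ s, (Measurable fun x => h x s) →
      ∫ x, h x s ∂(μ s) = ∫ z, h (quantile (μ s) z) s ∂unitMass := fun s hs =>
    integral_eq_integral_quantile (μ s) (f := fun x => h x s) hs.aestronglyMeasurable
  rw [hI t hm.self_of_nhds]
  suffices hs : Tendsto (fun s => ∫ z, h (quantile (μ s) z) s ∂unitMass) (𝓝 t)
      (𝓝 (∫ z, h (quantile (μ t) z) t ∂unitMass)) by
    refine hs.congr' ?_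
    filter_upwards [hm] with s hs
    exact (hI s hs).symm
  -- Convergence of quantiles in `L¹` gives almost everywhere convergence only along subsequences,
  -- which is enough for dominated convergence to determine the limit.
  refine Filter.tendsto_of_subseq_tendsto fun ns hns => ?_
  have hmeas : TendstoInMeasure unitMass (fun n => quantile (μ (ns n))) atTop (quantile (μ t)) := by
    refine tendstoInMeasure_of_tendsto_eLpNorm (p := 1) one_ne_zero
      (fun n => (aemeasurable_quantile _).aestronglyMeasurable)
      (aemeasurable_quantile _).aestronglyMeasurable ?_
    have h1 := ENNReal.tendsto_ofReal (hd.comp hns)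
    rw [ENNReal.ofReal_zero] at h1
    refine h1.congr fun n => ?_
    rw [eLpNorm_one_eq_lintegral_enorm]
    simp only [Function.comp_apply, quantileDist]
    have := ofReal_integral_norm_eq_lintegral_enorm (μ := unitMass)
      ((integrable_quantile (hμ (ns n))).sub (integrable_quantile (hμ t)))
    simpa [Real.norm_eq_abs] using this
  obtain ⟨ms, hms, hae⟩ := hmeas.exists_seq_tendsto_ae
  have hsub := hns.comp hms.tendsto_atTop
  refine ⟨ms, tendsto_integral_filter_of_dominated_convergence (fun _ => C) ?_ ?_
    (integrable_const _) ?_⟩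
  · filter_upwards [hsub.eventually hm] with n hn
    exact (hn.comp_aemeasurable (aemeasurable_quantile _)).aestronglyMeasurable
  · filter_upwards [hsub.eventually hC] with n hn
    exact ae_of_all _ fun z => hn _
  · filter_upwards [hae] with z hz
    exact (hcont _).tendsto.comp (hz.prodMk_nhds hsub)

/-! ### Weak time derivatives of continuous functions -/

/-- The primitive started just left of the support vanishes to the right of it exactly because the
mean is zero. It serves as an admissible test function in the du Bois-Reymond argument. -/
theorem exists_primitive_of_integral_eq_zero {α β : ℝ} {g : ℝ → ℝ} (hg : Continuous g)
    (hc : HasCompactSupport g) (hs : tsupport g ⊆ Ioo α β) (h0 : ∫ s, g s = 0) :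
    ∃ θ : ℝ → ℝ, ContDiff ℝ 1 θ ∧ HasCompactSupport θ ∧ tsupport θ ⊆ Ioo α β ∧
      ∀ s, HasDerivAt θ (g s) s := by
  rcases (tsupport g).eq_empty_or_nonempty with he | hne
  · refine ⟨0, contDiff_const, HasCompactSupport.zero, by simp [tsupport], fun s => ?_⟩
    have : g = 0 := tsupport_eq_empty_iff.1 he
    rw [this]
    exact hasDerivAt_const s 0
  have hK : IsCompact (tsupport g) := hc
  have h1 := hs (hK.sInf_mem hne)
  have h2 := hs (hK.sSup_mem hne)
  have hsub : ∀ s ∈ tsupport g, s ∈ Icc (sInf (tsupport g)) (sSup (tsupport g)) := fun s hs' =>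
    ⟨csInf_le hK.bddBelow hs', le_csSup hK.bddAbove hs'⟩
  obtain ⟨a, ha1, ha2⟩ := exists_between h1.1
  set c := sSup (tsupport g)
  have hz : ∀ s, s ∉ Ioc a c → g s = 0 := fun s hs' => by
    by_contra hcon
    have := hsub s (subset_tsupport g hcon)
    exact hs' ⟨ha2.trans_le this.1, this.2⟩
  have hd : ∀ s, HasDerivAt (fun s => ∫ x in a..s, g x) (g s) s := fun s =>
    intervalIntegral.integral_hasDerivAt_right (hg.intervalIntegrable _ _)
      hg.aestronglyMeasurable.stronglyMeasurableAtFilter hg.continuousAt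
  have hsupp : Function.support (fun s => ∫ x in a..s, g x) ⊆ Icc a c := by
    intro s hs'
    by_contra hcon
    apply hs'
    rcases not_and_or.1 hcon with h | h
    · have : ∫ x in a..s, g x = ∫ x in a..s, (0 : ℝ) := by
        refine intervalIntegral.integral_congr fun x hx => hz x fun hx' => ?_
        rw [uIcc_of_ge (not_le.1 h).le] at hx
        exact absurd hx.2 (not_le.2 hx'.1)
      simpa using this
    · have : Function.support g ⊆ Ioc a s := fun x hx => by
        by_contra hcon
        exact hx (hz x fun hx' => hcon ⟨hx'.1, hx'.2.trans (not_le.1 h).le⟩)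
      simp only [intervalIntegral.integral_eq_integral_of_support_subset this, h0]
  have hts : tsupport (fun s => ∫ x in a..s, g x) ⊆ Icc a c :=
    closure_minimal hsupp isClosed_Icc
  refine ⟨_, ?_, HasCompactSupport.of_support_subset_isCompact isCompact_Icc hsupp,
    hts.trans (Icc_subset_Ioo ha1 h2.2), hd⟩
  refine contDiff_one_iff_deriv.2 ⟨fun s => (hd s).differentiableAt, ?_⟩
  have : deriv (fun s => ∫ x in a..s, g x) = g := funext fun s => (hd s).deriv
  rwa [this]

/-- The du Bois-Reymond lemma: a continuous weak derivative is a classical one. -/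
theorem hasDerivAt_of_weak_deriv {m n : ℝ → ℝ} (hm : Continuous m) (hn : Continuous n) {α β : ℝ}
    (h : ∀ θ : ℝ → ℝ, ContDiff ℝ 1 θ → HasCompactSupport θ → tsupport θ ⊆ Ioo α β →
      (∫ s, deriv θ s * m s) + ∫ s, θ s * n s = 0) {t : ℝ} (ht : t ∈ Ioo α β) :
    HasDerivAt m (n t) t := by
  have hN : ∀ s, HasDerivAt (fun s => ∫ x in t..s, n x) (n s) s := fun s =>
    intervalIntegral.integral_hasDerivAt_right (hn.intervalIntegrable _ _)
      hn.aestronglyMeasurable.stronglyMeasurableAtFilter hn.continuousAt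
  set N : ℝ → ℝ := fun s => ∫ x in t..s, n x with hNdef
  have hNc : Continuous N := continuous_iff_continuousAt.2 fun s => (hN s).continuousAt
  -- Subtracting a primitive of `n` reduces the claim to showing that a function with zero weak
  -- derivative is constant on the interval.
  set k : ℝ → ℝ := fun s => m s - N s with hk
  have hkc : Continuous k := hm.sub hNc
  have hθ : ∀ θ : ℝ → ℝ, ContDiff ℝ 1 θ → HasCompactSupport θ → tsupport θ ⊆ Ioo α β →
      ∫ s, deriv θ s * k s = 0 := by
    intro θ h1 h2 h3
    have hd1 : Continuous (deriv θ) := h1.continuous_deriv le_rfl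
    have i1 : Integrable fun s => deriv θ s * m s :=
      (hd1.mul hm).integrable_of_hasCompactSupport h2.deriv.mul_right
    have i2 : Integrable fun s => deriv θ s * N s :=
      (hd1.mul hNc).integrable_of_hasCompactSupport h2.deriv.mul_right
    have i3 : Integrable fun s => θ s * n s :=
      (h1.continuous.mul hn).integrable_of_hasCompactSupport h2.mul_right
    have i4 : Integrable fun s => θ s * N s :=
      (h1.continuous.mul hNc).integrable_of_hasCompactSupport h2.mul_right
    have h4 := integral_eq_zero_of_hasDerivAt_of_integrable (f := fun s => θ s * N s)
      (f' := fun s => deriv θ s * N s + θ s * n s)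
      (fun s => ((h1.differentiable one_ne_zero) s).hasDerivAt.mul (hN s)) (i2.add i3) i4
    rw [integral_add i2 i3] at h4
    have h5 := h θ h1 h2 h3
    simp only [hk, mul_sub]
    rw [integral_sub i1 i2]
    linarith
  obtain ⟨ε, hε, hball⟩ := Metric.isOpen_iff.1 isOpen_Ioo t ht
  let B : ContDiffBump t := ⟨ε / 4, ε / 2, by linarith, by linarith⟩
  -- A fixed bump of integral one: subtracting `(∫ g) * g₀` from any test function `g` leaves zero
  -- mean, hence the derivative of a test function. This forces `k` to equal its `g₀`-average `c`.
  set g₀ : ℝ → ℝ := B.normed volume with hg₀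
  have hg₀c : Continuous g₀ := B.contDiff_normed (n := 0).continuous
  have hg₀s : HasCompactSupport g₀ := B.hasCompactSupport_normed
  have hg₀t : tsupport g₀ ⊆ Ioo α β := by
    rw [hg₀, B.tsupport_normed_eq]
    exact (Metric.closedBall_subset_ball (by simp [B]; linarith)).trans hball
  set c := ∫ s, g₀ s * k s with hc
  have hae : ∀ᵐ s, s ∈ Ioo α β → k s - c = 0 := by
    refine isOpen_Ioo.ae_eq_zero_of_integral_contDiff_smul_eq_zero
      ((hkc.sub continuous_const).locallyIntegrable.locallyIntegrableOn _) ?_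
    intro g hg1 hg2 hg3
    have hgc : Continuous g := hg1.continuous
    have ig : Integrable g := hgc.integrable_of_hasCompactSupport hg2
    have ig₀ : Integrable g₀ := hg₀c.integrable_of_hasCompactSupport hg₀s
    have hGs : HasCompactSupport fun s => g s - (∫ x, g x) * g₀ s :=
      hg2.sub (hg₀s.mul_left (f := fun _ => ∫ x, g x))
    have hts : tsupport (fun s => g s - (∫ x, g x) * g₀ s) ⊆ Ioo α β := by
      refine (tsupport_sub g fun s => (∫ x, g x) * g₀ s).trans (union_subset hg3 ?_)
      exact (closure_mono (Function.support_mul_subset_right _ _)).trans hg₀t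
    obtain ⟨θ, h1, h2, h3, h4⟩ := exists_primitive_of_integral_eq_zero
      (g := fun s => g s - (∫ x, g x) * g₀ s) (hgc.sub (continuous_const.mul hg₀c)) hGs hts (by
        rw [integral_sub ig (ig₀.const_mul _), integral_const_mul, hg₀, B.integral_normed]
        simp)
    have h5 := hθ θ h1 h2 h3
    have h6 : deriv θ = fun s => g s - (∫ x, g x) * g₀ s := funext fun s => (h4 s).deriv
    have j1 : Integrable fun s => g s * k s :=
      (hgc.mul hkc).integrable_of_hasCompactSupport hg2.mul_right
    have j2 : Integrable fun s => g₀ s * k s :=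
      (hg₀c.mul hkc).integrable_of_hasCompactSupport hg₀s.mul_right
    rw [h6] at h5
    simp only [sub_mul, mul_assoc] at h5
    rw [integral_sub j1 (j2.const_mul _), integral_const_mul] at h5
    simp only [smul_eq_mul, mul_sub]
    rw [integral_sub j1 (ig.mul_const _), integral_mul_const]
    linarith
  have hEq : EqOn (fun s => k s - c) (fun _ => 0) (Ioo α β) := by
    refine Measure.eqOn_open_of_ae_eq (μ := volume) ?_ isOpen_Ioo
      (hkc.sub continuous_const).continuousOn continuousOn_const
    exact (ae_restrict_iff' measurableSet_Ioo).2 hae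
  have hev : m =ᶠ[𝓝 t] fun s => N s + c := by
    filter_upwards [isOpen_Ioo.mem_nhds ht] with s hs
    have h1 : k s - c = 0 := hEq hs
    have h2 : k s = m s - N s := rfl
    linarith
  exact ((hN t).add_const c).congr_of_eventuallyEq hev

/-! ### Time derivatives of averages along dissipative solutions -/

theorem memLp_quantile_sub {p : ℝ≥0∞} {μ ν : Measure ℝ} [IsProbabilityMeasure μ]
    [IsProbabilityMeasure ν] (hμ : HasFiniteMoment p μ) (hν : HasFiniteMoment p ν) :
    MemLp (fun z => quantile μ z - quantile ν z) p unitMass :=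
  ((hasFiniteMoment_iff μ p).1 hμ).sub ((hasFiniteMoment_iff ν p).1 hν)

theorem HasFiniteMoment.integrable {p : ℝ≥0∞} (hp : 1 ≤ p) {μ : Measure ℝ} [IsProbabilityMeasure μ]
    (hμ : HasFiniteMoment p μ) : Integrable (fun y => y) μ :=
  MemLp.integrable hp hμ

/-- The mass coordinate lives on a probability space, so the `L¹` norm is at most the `L^p` norm. -/
theorem ofReal_quantileDist_le_wasserstein {p : ℝ≥0∞} (hp : 1 ≤ p) {μ ν : Measure ℝ}
    [IsProbabilityMeasure μ] [IsProbabilityMeasure ν] (hμ : HasFiniteMoment p μ)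
    (hν : HasFiniteMoment p ν) :
    ENNReal.ofReal (quantileDist μ ν) ≤ wasserstein p μ ν := by
  have h := (memLp_quantile_sub hμ hν)
  have h1 := ofReal_integral_norm_eq_lintegral_enorm (h.integrable hp)
  have h2 := eLpNorm_le_eLpNorm_of_exponent_le hp h.aestronglyMeasurable
  rw [eLpNorm_one_eq_lintegral_enorm, ← h1] at h2
  exact h2

theorem HasBoundedDensity.measure_singleton {μ : Measure ℝ} (h : HasBoundedDensity μ) (x : ℝ) :
    μ {x} = 0 :=
  h.1 (by simp)

namespace IsDissipativeSolution

variable {V v : ℝ → ℝ} {lam b : ℝ} {p : ℝ≥0∞} {ρ₀ : ProbabilityMeasure ℝ}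
  {ρ : ℝ≥0 → ProbabilityMeasure ℝ}

theorem integrable_id (hρ : IsDissipativeSolution V v p ρ₀ ρ) (hp : 1 ≤ p) (t : ℝ≥0) :
    Integrable (fun y => y) (ρ t : Measure ℝ) :=
  (hρ.finiteMoment t).integrable hp

theorem tendsto_quantileDist (hρ : IsDissipativeSolution V v p ρ₀ ρ) (hp : 1 ≤ p) (t : ℝ) :
    Tendsto (fun s : ℝ => quantileDist (ρ s.toNNReal : Measure ℝ) (ρ t.toNNReal : Measure ℝ))
      (𝓝 t) (𝓝 0) := by
  have h1 := (hρ.continuous t.toNNReal).comp (continuous_real_toNNReal.tendsto t)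
  have h2 : Tendsto (fun s : ℝ => ENNReal.ofReal
      (quantileDist (ρ s.toNNReal : Measure ℝ) (ρ t.toNNReal : Measure ℝ))) (𝓝 t) (𝓝 0) :=
    tendsto_of_tendsto_of_tendsto_of_le_of_le tendsto_const_nhds h1 (fun _ => zero_le)
      fun s => ofReal_quantileDist_le_wasserstein hp (hρ.finiteMoment _) (hρ.finiteMoment _)
  have h3 := (ENNReal.tendsto_toReal ENNReal.zero_ne_top).comp h2
  simpa only [Function.comp_def, ENNReal.toReal_ofReal (quantileDist_nonneg _ _),
    ENNReal.toReal_zero] using h3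

theorem measure_singleton (hρ : IsDissipativeSolution V v p ρ₀ ρ) {t : ℝ} (ht : 0 < t) (x : ℝ) :
    (ρ t.toNNReal : Measure ℝ) {x} = 0 :=
  (hρ.boundedDensity _ (by simpa using ht)).measure_singleton x

theorem continuousAt_nonlocalVelocity (hρ : IsDissipativeSolution V v p ρ₀ ρ)
    (h : StandingAssumptions V v lam b) (hp : 1 ≤ p) {t : ℝ} (ht : 0 < t) (x : ℝ) :
    ContinuousAt (fun q : ℝ × ℝ => nonlocalVelocity V v (ρ q.2.toNNReal : Measure ℝ) q.1)
      (x, t) := by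
  have h2 : Tendsto (fun q : ℝ × ℝ => q.2) (𝓝 (x, t)) (𝓝 t) := continuous_snd.tendsto (x, t)
  have h1 : Tendsto (fun q : ℝ × ℝ => q.1) (𝓝 (x, t)) (𝓝 x) := continuous_fst.tendsto (x, t)
  refine h.tendsto_nonlocalVelocity (μ := fun q : ℝ × ℝ => (ρ q.2.toNNReal : Measure ℝ))
    (ν := (ρ t.toNNReal : Measure ℝ)) (fun q => hρ.integrable_id hp _) (hρ.integrable_id hp _)
    (hρ.measure_singleton ht) ?_ ((hρ.tendsto_quantileDist hp t).comp h2) h1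
  filter_upwards [h2.eventually (lt_mem_nhds ht)] with q hq
  exact hρ.measure_singleton hq

theorem continuous_nonlocalVelocity (hρ : IsDissipativeSolution V v p ρ₀ ρ)
    (h : StandingAssumptions V v lam b) (hp : 1 ≤ p) {t : ℝ} (ht : 0 < t) :
    Continuous fun x => nonlocalVelocity V v (ρ t.toNNReal : Measure ℝ) x :=
  continuous_iff_continuousAt.2 fun x =>
    (hρ.continuousAt_nonlocalVelocity h hp ht x).comp (f := fun y => (y, t))
      (continuous_id.prodMk continuous_const).continuousAt

theorem eventually_integral_abs_quantile_le (hρ : IsDissipativeSolution V v p ρ₀ ρ) (hp : 1 ≤ p)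
    (t : ℝ) : ∃ M : ℝ, 0 ≤ M ∧
      ∀ᶠ s : ℝ in 𝓝 t, ∫ z, |quantile (ρ s.toNNReal : Measure ℝ) z| ∂unitMass ≤ M := by
  have hi := fun s : ℝ => integrable_quantile (hρ.integrable_id hp s.toNNReal)
  refine ⟨∫ z, |quantile (ρ t.toNNReal : Measure ℝ) z| ∂unitMass + 1,
    add_nonneg (integral_nonneg fun _ => abs_nonneg _) zero_le_one, ?_⟩
  filter_upwards [(hρ.tendsto_quantileDist hp t).eventually_lt_const one_pos] with s hs
  have hi2 : Integrable (fun z => |quantile (ρ s.toNNReal : Measure ℝ) z -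
      quantile (ρ t.toNNReal : Measure ℝ) z|) unitMass := ((hi s).sub (hi t)).abs
  have : ∫ z, |quantile (ρ s.toNNReal : Measure ℝ) z| ∂unitMass ≤
      ∫ z, (|quantile (ρ t.toNNReal : Measure ℝ) z| +
        |quantile (ρ s.toNNReal : Measure ℝ) z - quantile (ρ t.toNNReal : Measure ℝ) z|)
        ∂unitMass := by
    refine integral_mono (hi s).abs ((hi t).abs.add hi2) fun z => ?_
    have := abs_sub_abs_le_abs_sub (quantile (ρ s.toNNReal : Measure ℝ) z)
      (quantile (ρ t.toNNReal : Measure ℝ) z)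
    simp only
    linarith
  rw [integral_add (hi t).abs hi2] at this
  unfold quantileDist at hs
  linarith

/-- Linear growth of the velocity field, locally uniformly in time. -/
theorem eventually_abs_nonlocalVelocity_le (hρ : IsDissipativeSolution V v p ρ₀ ρ)
    (h : StandingAssumptions V v lam b) (hp : 1 ≤ p) (t : ℝ) :
    ∃ C : ℝ, 0 ≤ C ∧ ∀ᶠ s : ℝ in 𝓝 t, ∀ x,
      |nonlocalVelocity V v (ρ s.toNNReal : Measure ℝ) x| ≤ C * (1 + |x|) := by
  obtain ⟨M, hM, hev⟩ := hρ.eventually_integral_abs_quantile_le hp t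
  have hl := h.lam_pos
  set L : ℝ := ((lipSeminorm v univ : ℝ≥0) : ℝ)
  set A : ℝ := ((lipSeminorm V (Iic 0) : ℝ≥0) : ℝ)
  have hL : 0 ≤ L := NNReal.coe_nonneg _
  have hA : 0 ≤ A := NNReal.coe_nonneg _
  refine ⟨|v 0| + L * (2 * lam + A * (1 + M)), by positivity, ?_⟩
  filter_upwards [hev] with s hs x
  refine (h.abs_nonlocalVelocity_le (hρ.integrable_id hp _) x).trans ?_
  calc |v 0| + L * (2 * lam + A * (|x| + ∫ z, |quantile (ρ s.toNNReal : Measure ℝ) z| ∂unitMass))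
      ≤ |v 0| + L * (2 * lam + A * (|x| + M)) := by gcongr
    _ ≤ |v 0| * (1 + |x|) + L * (2 * lam * (1 + |x|) + A * ((1 + M) * (1 + |x|))) := by
        have hx := abs_nonneg x
        have h1 : |v 0| ≤ |v 0| * (1 + |x|) := le_mul_of_one_le_right (abs_nonneg _) (by linarith)
        have h2 : 2 * lam ≤ 2 * lam * (1 + |x|) :=
          le_mul_of_one_le_right (by linarith) (by linarith)
        have h3 : |x| + M ≤ (1 + M) * (1 + |x|) := by nlinarith
        gcongr
    _ = _ := by ring

theorem exists_bound_of_spatial_support {f : ℝ × ℝ → ℝ} (hf : Continuous f) {R : ℝ}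
    (hs : ∀ x t, R < |x| → f (x, t) = 0) (t : ℝ) :
    ∃ C, 0 ≤ C ∧ ∀ᶠ s in 𝓝 t, ∀ x, |f (x, s)| ≤ C := by
  obtain ⟨C, hC⟩ := (isCompact_Icc (a := -R) (b := R)).prod (isCompact_Icc (a := t - 1) (b := t + 1))
    |>.exists_bound_of_continuousOn hf.continuousOn
  refine ⟨max C 0, le_max_right _ _, ?_⟩
  filter_upwards [Icc_mem_nhds (by linarith : t - 1 < t) (by linarith : t < t + 1)] with s hs' x
  by_cases hx : R < |x|
  · simp [hs x s hx]
  · exact (hC (x, s) ⟨abs_le.1 (not_lt.1 hx), hs'⟩).trans (le_max_left _ _)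

section

variable {ψ : ℝ × ℝ → ℝ}

theorem hasDerivAt_snd (hψ : ContDiff ℝ 1 ψ) (x t : ℝ) :
    HasDerivAt (fun s => ψ (x, s)) (fderiv ℝ ψ (x, t) (0, 1)) t :=
  ((hψ.differentiable one_ne_zero (x, t)).hasFDerivAt).comp_hasDerivAt t
    ((hasDerivAt_const t x).prodMk (hasDerivAt_id t))

theorem hasDerivAt_fst (hψ : ContDiff ℝ 1 ψ) (x t : ℝ) :
    HasDerivAt (fun y => ψ (y, t)) (fderiv ℝ ψ (x, t) (1, 0)) x :=
  ((hψ.differentiable one_ne_zero (x, t)).hasFDerivAt).comp_hasDerivAt x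
    ((hasDerivAt_id x).prodMk (hasDerivAt_const x t))

theorem continuous_fderiv_apply' (hψ : ContDiff ℝ 1 ψ) (w : ℝ × ℝ) :
    Continuous fun q => fderiv ℝ ψ q w :=
  (hψ.continuous_fderiv one_ne_zero).clm_apply continuous_const

theorem fderiv_eq_zero_of_spatial_support {R : ℝ} (hs : ∀ x t, R < |x| → ψ (x, t) = 0) (x t : ℝ)
    (hx : R < |x|) : fderiv ℝ ψ (x, t) = 0 := by
  have : ψ =ᶠ[𝓝 (x, t)] fun _ => 0 := by
    have ho : IsOpen {q : ℝ × ℝ | R < |q.1|} :=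
      isOpen_lt continuous_const (continuous_abs.comp continuous_fst)
    filter_upwards [ho.mem_nhds (show (x, t) ∈ {q : ℝ × ℝ | R < |q.1|} from hx)] with q hq
    exact hs q.1 q.2 hq
  rw [this.fderiv_eq]
  simp

/-- Along a dissipative solution the averages of a spatially compactly supported `C¹` function are
differentiable at positive times. -/
theorem hasDerivAt_integral (hρ : IsDissipativeSolution V v p ρ₀ ρ)
    (h : StandingAssumptions V v lam b) (hp : 1 ≤ p) (hψ : ContDiff ℝ 1 ψ) {R : ℝ}
    (hs : ∀ x t, R < |x| → ψ (x, t) = 0) {t : ℝ} (ht : 0 < t) :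
    HasDerivAt (fun s : ℝ => ∫ x, ψ (x, s) ∂(ρ s.toNNReal : Measure ℝ))
      (∫ x, (fderiv ℝ ψ (x, t) (0, 1) + nonlocalVelocity V v (ρ t.toNNReal : Measure ℝ) x *
        fderiv ℝ ψ (x, t) (1, 0)) ∂(ρ t.toNNReal : Measure ℝ)) t := by
  set μ : ℝ → Measure ℝ := fun s => (ρ s.toNNReal : Measure ℝ) with hμ
  have hc0 : ∀ {f : ℝ × ℝ → ℝ}, Continuous f → (∀ x t, R < |x| → f (x, t) = 0) →
      ∀ s, ContinuousAt (fun s => ∫ x, f (x, s) ∂(μ s)) s := by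
    intro f hf hfs s
    obtain ⟨C, -, hC⟩ := exists_bound_of_spatial_support hf hfs s
    exact tendsto_integral_of_quantileDist (fun s => hρ.integrable_id hp _)
      (hρ.tendsto_quantileDist hp s) (h := fun x s => f (x, s)) (fun x => hf.continuousAt)
      (Eventually.of_forall fun s => (hf.comp (continuous_id.prodMk continuous_const)).measurable) hC
  set ψt : ℝ × ℝ → ℝ := fun q => fderiv ℝ ψ q (0, 1) with hψt
  set ψx : ℝ × ℝ → ℝ := fun q => fderiv ℝ ψ q (1, 0) with hψx
  have hψtc : Continuous ψt := continuous_fderiv_apply' hψ _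
  have hψxc : Continuous ψx := continuous_fderiv_apply' hψ _
  have hψts : ∀ x t, R < |x| → ψt (x, t) = 0 := fun x t hx => by
    simp [hψt, fderiv_eq_zero_of_spatial_support hs x t hx]
  have hψxs : ∀ x t, R < |x| → ψx (x, t) = 0 := fun x t hx => by
    simp [hψx, fderiv_eq_zero_of_spatial_support hs x t hx]
  have hub : ∀ s, ∃ C, ∀ᶠ s' in 𝓝 s, ∀ x, |nonlocalVelocity V v (μ s') x * ψx (x, s')| ≤ C := by
    intro s
    obtain ⟨C, hC0, hC⟩ := exists_bound_of_spatial_support hψxc hψxs s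
    obtain ⟨D, hD0, hD⟩ := hρ.eventually_abs_nonlocalVelocity_le h hp s
    refine ⟨D * (1 + |R|) * C, ?_⟩
    filter_upwards [hC, hD] with s' h1 h2 x
    by_cases hx : R < |x|
    · rw [hψxs x s' hx]; simp; positivity
    · rw [abs_mul]
      have := h2 x
      have h3 : |x| ≤ |R| := (not_lt.1 hx).trans (le_abs_self R)
      gcongr
      · exact this.trans (by gcongr)
      · exact h1 x
  have hum : ∀ s, 0 < s → Measurable fun x => nonlocalVelocity V v (μ s) x * ψx (x, s) :=
    fun s hs' => ((hρ.continuous_nonlocalVelocity h hp hs').mul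
      (hψxc.comp (continuous_id.prodMk continuous_const))).measurable
  have hcu : ∀ s, 0 < s → ContinuousAt
      (fun s => ∫ x, nonlocalVelocity V v (μ s) x * ψx (x, s) ∂(μ s)) s := by
    intro s hs'
    obtain ⟨C, hC⟩ := hub s
    refine tendsto_integral_of_quantileDist (fun s => hρ.integrable_id hp _)
      (hρ.tendsto_quantileDist hp s)
      (h := fun x s => nonlocalVelocity V v (μ s) x * ψx (x, s)) (fun x => ?_) ?_ hC
    · exact (hρ.continuousAt_nonlocalVelocity h hp hs' x).mul hψxc.continuousAt
    · filter_upwards [lt_mem_nhds hs'] with s' hs''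
      exact hum s' hs''
  -- Continuity of the flux average is known only at positive times. Clamping time to `[t/2, 2t]`
  -- gives functions continuous on the whole line, unchanged where the time cutoffs `θ` live.
  set cl : ℝ → ℝ := fun s => max (t / 2) (min s (2 * t)) with hcl
  have hclc : Continuous cl := continuous_const.max (continuous_id.min continuous_const)
  have hclpos : ∀ s, 0 < cl s := fun s => lt_of_lt_of_le (by linarith) (le_max_left _ _)
  have hcleq : ∀ s ∈ Ioo (t / 2) (2 * t), cl s = s := fun s hs' => by
    simp [hcl, hs'.1.le, hs'.2.le]
  have htm : t ∈ Ioo (t / 2) (2 * t) := ⟨by linarith, by linarith⟩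
  set M : ℝ → ℝ := fun s => ∫ x, ψ (x, s) ∂(μ s) with hM
  set P : ℝ → ℝ := fun s => ∫ x, ψt (x, s) ∂(μ s) with hP
  set Q : ℝ → ℝ := fun s => ∫ x, nonlocalVelocity V v (μ s) x * ψx (x, s) ∂(μ s) with hQ
  have hMc : Continuous fun s => M (cl s) := continuous_iff_continuousAt.2 fun s =>
    (hc0 hψ.continuous hs (cl s)).comp hclc.continuousAt
  have hPc : Continuous fun s => P (cl s) := continuous_iff_continuousAt.2 fun s =>
    (hc0 hψtc hψts (cl s)).comp hclc.continuousAt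
  have hQc : Continuous fun s => Q (cl s) := continuous_iff_continuousAt.2 fun s =>
    (hcu (cl s) (hclpos s)).comp hclc.continuousAt
  have hint0 : ∀ {f : ℝ × ℝ → ℝ}, Continuous f → (∀ x t, R < |x| → f (x, t) = 0) →
      ∀ s, Integrable (fun x => f (x, s)) (μ s) := by
    intro f hf hfs s
    obtain ⟨C, -, hC⟩ := exists_bound_of_spatial_support hf hfs s
    exact (integrable_const C).mono'
      (hf.comp (continuous_id.prodMk continuous_const)).aestronglyMeasurable
      (ae_of_all _ hC.self_of_nhds)
  have hintu : Integrable (fun x => nonlocalVelocity V v (μ t) x * ψx (x, t)) (μ t) := by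
    obtain ⟨C, hC⟩ := hub t
    exact (integrable_const C).mono' (hum t ht).aestronglyMeasurable
      (ae_of_all _ hC.self_of_nhds)
  have key : HasDerivAt (fun s => M (cl s)) (P (cl t) + Q (cl t)) t := by
    refine hasDerivAt_of_weak_deriv hMc (n := fun s => P (cl s) + Q (cl s))
      (hPc.add hQc) (α := t / 2) (β := 2 * t) ?_ htm
    intro θ hθ1 hθ2 hθ3
    have hθ0 : ∀ s, s ∉ Ioo (t / 2) (2 * t) → θ s = 0 := fun s hs' =>
      image_eq_zero_of_notMem_tsupport fun hcon => hs' (hθ3 hcon)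
    have hθd0 : ∀ s, s ∉ Ioo (t / 2) (2 * t) → deriv θ s = 0 := fun s hs' =>
      image_eq_zero_of_notMem_tsupport fun hcon => hs' (hθ3 (tsupport_deriv_subset hcon))
    have hθd : ∀ s, HasDerivAt θ (deriv θ s) s := fun s =>
      (hθ1.differentiable one_ne_zero s).hasDerivAt
    set φ : ℝ × ℝ → ℝ := fun q => ψ q * θ q.2 with hφ
    have hφ1 : ContDiff ℝ 1 φ := hψ.mul (hθ1.comp contDiff_snd)
    have hφsub : Function.support φ ⊆ Icc (-R) R ×ˢ tsupport θ := by
      rintro ⟨x, s⟩ hq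
      refine ⟨abs_le.1 (not_lt.1 fun hx => hq ?_), by_contra fun hx => hq ?_⟩
      · simp [hφ, hs x s hx]
      · simp [hφ, image_eq_zero_of_notMem_tsupport hx]
    have hφ2 : HasCompactSupport φ :=
      HasCompactSupport.of_support_subset_isCompact (isCompact_Icc.prod hθ2) hφsub
    have hφ3 : tsupport φ ⊆ univ ×ˢ Ioi (0 : ℝ) := by
      refine (closure_minimal hφsub (isClosed_Icc.prod (isClosed_tsupport θ))).trans ?_
      refine prod_mono (subset_univ _) (hθ3.trans fun s hs' => ?_)
      exact lt_trans (by linarith : (0 : ℝ) < t / 2) hs'.1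
    have hw := hρ.weakEquation φ hφ1 hφ2 hφ3
    have e1 : ∀ x s, deriv (fun s => φ (x, s)) s = ψt (x, s) * θ s + ψ (x, s) * deriv θ s :=
      fun x s => ((hasDerivAt_snd hψ x s).mul (hθd s)).deriv
    have e2 : ∀ x s, deriv (fun y => φ (y, s)) x = ψx (x, s) * θ s := fun x s =>
      ((hasDerivAt_fst hψ x s).mul_const (θ s)).deriv
    have f1 : ∀ s, ∫ x, deriv (fun s => φ (x, s)) s ∂(μ s) = θ s * P s + deriv θ s * M s := by
      intro s
      simp only [e1]
      rw [integral_add ((hint0 hψtc hψts s).mul_const _) ((hint0 hψ.continuous hs s).mul_const _),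
        integral_mul_const, integral_mul_const]
      ring
    have f2 : ∀ s, ∫ x, nonlocalVelocity V v (μ s) x * deriv (fun y => φ (y, s)) x ∂(μ s) =
        θ s * Q s := by
      intro s
      simp only [e2, ← mul_assoc]
      rw [integral_mul_const]
      ring
    simp only [hμ] at f1 f2
    simp only [f1, f2] at hw
    have g : ∀ {F : ℝ → ℝ}, (∀ s, s ∉ Ioo (t / 2) (2 * t) → F s = 0) →
        ∫ s in Ioi (0 : ℝ), F s = ∫ s, F s := fun {F} hF =>
      setIntegral_eq_integral_of_forall_compl_eq_zero fun s hs' => hF s fun hs'' =>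
        hs' (lt_trans (by linarith : (0 : ℝ) < t / 2) hs''.1)
    rw [g fun s hs' => by simp [hθ0 s hs', hθd0 s hs'], g fun s hs' => by simp [hθ0 s hs']] at hw
    have c1 : ∀ (F : ℝ → ℝ) s, θ s * F s = θ s * F (cl s) := fun F s => by
      by_cases hs' : s ∈ Ioo (t / 2) (2 * t)
      · rw [hcleq s hs']
      · simp [hθ0 s hs']
    have c2 : ∀ (F : ℝ → ℝ) s, deriv θ s * F s = deriv θ s * F (cl s) := fun F s => by
      by_cases hs' : s ∈ Ioo (t / 2) (2 * t)
      · rw [hcleq s hs']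
      · simp [hθd0 s hs']
    replace hw : (∫ s, (θ s * P (cl s) + deriv θ s * M (cl s))) + ∫ s, θ s * Q (cl s) = 0 := by
      rw [← hw]
      congr 1 <;> refine integral_congr_ae (ae_of_all _ fun s => ?_)
      · simp only [← c1 P, ← c2 M]
      · simp only [← c1 Q]
    have hθdc : Continuous (deriv θ) := hθ1.continuous_deriv le_rfl
    have i1 : Integrable fun s => θ s * P (cl s) :=
      (hθ1.continuous.mul hPc).integrable_of_hasCompactSupport hθ2.mul_right
    have i2 : Integrable fun s => θ s * Q (cl s) :=
      (hθ1.continuous.mul hQc).integrable_of_hasCompactSupport hθ2.mul_right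
    have i3 : Integrable fun s => deriv θ s * M (cl s) :=
      (hθdc.mul hMc).integrable_of_hasCompactSupport hθ2.deriv.mul_right
    rw [integral_add i1 i3] at hw
    simp only [mul_add]
    rw [integral_add i1 i2]
    linarith
  have hsum : ∫ x, (ψt (x, t) + nonlocalVelocity V v (μ t) x * ψx (x, t)) ∂(μ t) =
      P (cl t) + Q (cl t) := by
    rw [hcleq t htm]
    exact integral_add (hint0 hψtc hψts t) hintu
  change HasDerivAt M (∫ x, (ψt (x, t) + nonlocalVelocity V v (μ t) x * ψx (x, t)) ∂(μ t)) t
  rw [hsum]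
  refine key.congr_of_eventuallyEq ?_
  filter_upwards [isOpen_Ioo.mem_nhds htm] with s hs'
  rw [hcleq s hs']

end

end IsDissipativeSolution

/-! ### Comparison with moving fronts -/

namespace IsDissipativeSolution

variable {V v : ℝ → ℝ} {lam b : ℝ} {p : ℝ≥0∞} {ρ₀ : ProbabilityMeasure ℝ}
  {ρ : ℝ≥0 → ProbabilityMeasure ℝ}

/-- The time derivative of the average is the integral of `η' (u - c) χ + η u χ' / R`. After
multiplication by `σ` the first term is nonnegative, since `η' ≤ 0` and `σ (u - c) ≤ 0` in the
transition layer; the second is the cutoff error, which the linear growth of `u` and the first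
moment make of order `1 / R`. -/
theorem front_integral_sub_ge (hρ : IsDissipativeSolution V v p ρ₀ ρ)
    (h : StandingAssumptions V v lam b) (hp : 1 ≤ p) {σ c y₀ a a' δ D M C R : ℝ} {η χ : ℝ → ℝ}
    (ha : 0 < a) (haa : a ≤ a') (hσ1 : |σ| ≤ 1) (hR : 1 ≤ R) (hD0 : 0 ≤ D) (hC0 : 0 ≤ C)
    (hη : ContDiff ℝ 1 η) (hη0 : ∀ y, 0 ≤ η y) (hη1 : ∀ y, η y ≤ 1) (hηa : Antitone η)
    (hηd : ∀ y, y ∉ Icc 0 δ → deriv η y = 0)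
    (hχ : ContDiff ℝ 1 χ) (hχ0 : ∀ y, 0 ≤ χ y) (hχ2 : ∀ y, 2 < |y| → χ y = 0)
    (hχd : ∀ y, |y| < 1 → deriv χ y = 0) (hχC : ∀ y, |deriv χ y| ≤ C)
    (hD : ∀ t ∈ Icc a a', ∀ x, |nonlocalVelocity V v (ρ t.toNNReal : Measure ℝ) x| ≤ D * (1 + |x|))
    (hM : ∀ t ∈ Icc a a', ∫ z, |quantile (ρ t.toNNReal : Measure ℝ) z| ∂unitMass ≤ M)
    (hu : ∀ t ∈ Icc a a', ∀ x ∈ Icc (y₀ + c * t) (y₀ + c * t + δ),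
      σ * (nonlocalVelocity V v (ρ t.toNNReal : Measure ℝ) x - c) ≤ 0) :
    -(3 * D * C * M / R) * (a' - a) ≤
      σ * ∫ x, η (x - (y₀ + c * a')) * χ (x / R) ∂(ρ a'.toNNReal : Measure ℝ) -
      σ * ∫ x, η (x - (y₀ + c * a)) * χ (x / R) ∂(ρ a.toNNReal : Measure ℝ) := by
  have hR0 : 0 < R := by linarith
  set ψ : ℝ × ℝ → ℝ := fun q => η (q.1 - (y₀ + c * q.2)) * χ (q.1 / R) with hψdef
  have hψ : ContDiff ℝ 1 ψ := by
    refine (hη.comp ?_).mul (hχ.comp (contDiff_fst.div_const R))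
    exact contDiff_fst.sub (contDiff_const.add (contDiff_const.mul contDiff_snd))
  have hχR : ∀ x, 2 * R < |x| → 2 < |x / R| := fun x hx => by
    rw [abs_div, abs_of_pos hR0, lt_div_iff₀ hR0]; exact hx
  have hs : ∀ x t, 2 * R < |x| → ψ (x, t) = 0 := fun x t hx => by
    simp [hψdef, hχ2 _ (hχR x hx)]
  have hηD : ∀ y, HasDerivAt η (deriv η y) y := fun y =>
    (hη.differentiable one_ne_zero y).hasDerivAt
  have hχD : ∀ y, HasDerivAt χ (deriv χ y) y := fun y =>
    (hχ.differentiable one_ne_zero y).hasDerivAt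
  have d1 : ∀ x t, fderiv ℝ ψ (x, t) (0, 1) = -c * deriv η (x - (y₀ + c * t)) * χ (x / R) := by
    intro x t
    refine (hasDerivAt_snd hψ x t).unique ?_
    have h1 : HasDerivAt (fun s => x - (y₀ + c * s)) (-c) t := by
      simpa using (((hasDerivAt_id t).const_mul c).const_add y₀).const_sub x
    have := ((hηD (x - (y₀ + c * t))).comp t h1).mul_const (χ (x / R))
    exact this.congr_deriv (by ring)
  have d2 : ∀ x t, fderiv ℝ ψ (x, t) (1, 0) = deriv η (x - (y₀ + c * t)) * χ (x / R) +
      η (x - (y₀ + c * t)) * (deriv χ (x / R) / R) := by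
    intro x t
    refine (hasDerivAt_fst hψ x t).unique ?_
    have h1 : HasDerivAt (fun y => y - (y₀ + c * t)) 1 x := (hasDerivAt_id x).sub_const _
    have h2 : HasDerivAt (fun y => y / R) (1 / R) x := (hasDerivAt_id x).div_const _
    have := ((hηD (x - (y₀ + c * t))).comp x h1).mul ((hχD (x / R)).comp x h2)
    exact this.congr_deriv (by simp only [Function.comp_apply]; ring)
  have hder := fun t (ht : t ∈ Icc a a') =>
    hρ.hasDerivAt_integral h hp hψ hs (t := t) (ha.trans_le ht.1)
  set m : ℝ → ℝ := fun s => ∫ x, ψ (x, s) ∂(ρ s.toNNReal : Measure ℝ) with hm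
  have hlow : ∀ t ∈ Icc a a', -(3 * D * C * M / R) ≤
      σ * ∫ x, (fderiv ℝ ψ (x, t) (0, 1) + nonlocalVelocity V v (ρ t.toNNReal : Measure ℝ) x *
        fderiv ℝ ψ (x, t) (1, 0)) ∂(ρ t.toNNReal : Measure ℝ) := by
    intro t ht
    have ht0 : 0 < t := ha.trans_le ht.1
    have hiabs : Integrable (fun x : ℝ => |x|) (ρ t.toNNReal : Measure ℝ) :=
      (hρ.integrable_id hp _).abs
    have hpt : ∀ x, -(3 * D * C / R) * |x| ≤ σ * (fderiv ℝ ψ (x, t) (0, 1) +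
        nonlocalVelocity V v (ρ t.toNNReal : Measure ℝ) x * fderiv ℝ ψ (x, t) (1, 0)) := by
      intro x
      rw [d1, d2]
      set u := nonlocalVelocity V v (ρ t.toNNReal : Measure ℝ) x with hudef
      set y := x - (y₀ + c * t) with hy
      have e : σ * (-c * deriv η y * χ (x / R) + u * (deriv η y * χ (x / R) +
          η y * (deriv χ (x / R) / R))) = (σ * (u - c)) * deriv η y * χ (x / R) +
          σ * u * η y * (deriv χ (x / R) / R) := by ring
      rw [e]
      have p1 : 0 ≤ (σ * (u - c)) * deriv η y * χ (x / R) := by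
        by_cases hyI : y ∈ Icc 0 δ
        · refine mul_nonneg (mul_nonneg_of_nonpos_of_nonpos
            (hu t ht x ⟨by linarith [hyI.1], by linarith [hyI.2]⟩) hηa.deriv_nonpos) (hχ0 _)
        · rw [hηd y hyI]; simp
      have p2 : |σ * u * η y * (deriv χ (x / R) / R)| ≤ 3 * D * C / R * |x| := by
        by_cases h1 : |x / R| < 1
        · rw [hχd _ h1]; simp; positivity
        by_cases h2 : 2 < |x / R|
        · have : deriv χ (x / R) = 0 := by
            have hev : χ =ᶠ[𝓝 (x / R)] fun _ => 0 := by
              filter_upwards [(isOpen_lt continuous_const continuous_abs).mem_nhds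
                (show x / R ∈ {y : ℝ | 2 < |y|} from h2)] with w hw using hχ2 w hw
            rw [hev.deriv_eq]; simp
          rw [this]; simp; positivity
        rw [abs_div, abs_of_pos hR0, not_lt] at h1 h2
        rw [le_div_iff₀ hR0] at h1
        rw [div_le_iff₀ hR0] at h2
        rw [abs_mul, abs_mul, abs_mul, abs_div, abs_of_pos hR0, abs_of_nonneg (hη0 y)]
        have hux := hD t ht x
        calc |σ| * |u| * η y * (|deriv χ (x / R)| / R)
            ≤ 1 * (D * (1 + |x|)) * 1 * (C / R) := by
              gcongr
              · exact hη0 y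
              · exact hη1 y
              · exact hχC _
          -- Where `χ'` survives one has `1 ≤ R ≤ |x|`, so `1 + |x| ≤ 3 |x|`.
          _ ≤ 1 * (D * (3 * |x|)) * 1 * (C / R) := by
              gcongr
              linarith
          _ = _ := by ring
      linarith [neg_abs_le (σ * u * η y * (deriv χ (x / R) / R))]
    obtain ⟨K1, -, hK1⟩ := exists_bound_of_spatial_support (continuous_fderiv_apply' hψ (0, 1))
      (R := 2 * R) (fun x t hx => by simp [fderiv_eq_zero_of_spatial_support hs x t hx]) t
    obtain ⟨K2, hK20, hK2⟩ := exists_bound_of_spatial_support (continuous_fderiv_apply' hψ (1, 0))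
      (R := 2 * R) (fun x t hx => by simp [fderiv_eq_zero_of_spatial_support hs x t hx]) t
    have hint : Integrable (fun x => fderiv ℝ ψ (x, t) (0, 1) +
        nonlocalVelocity V v (ρ t.toNNReal : Measure ℝ) x * fderiv ℝ ψ (x, t) (1, 0))
        (ρ t.toNNReal : Measure ℝ) := by
      refine (((integrable_const K1).add
        (((integrable_const (1 : ℝ)).add hiabs).const_mul (D * K2)))).mono' ?_ (ae_of_all _ fun x => ?_)
      · refine Continuous.aestronglyMeasurable ?_
        have hx : Continuous fun x : ℝ => (x, t) := continuous_id.prodMk continuous_const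
        exact ((continuous_fderiv_apply' hψ (0, 1)).comp hx).add
          ((hρ.continuous_nonlocalVelocity h hp ht0).mul
            ((continuous_fderiv_apply' hψ (1, 0)).comp hx))
      · have q1 := hK1.self_of_nhds x
        have q2 := hK2.self_of_nhds x
        have q3 := hD t ht x
        rw [Real.norm_eq_abs]
        refine (abs_add_le _ _).trans ?_
        rw [abs_mul]
        have := mul_le_mul q3 q2 (abs_nonneg _) (by positivity)
        simp only [Pi.add_apply]
        nlinarith
    have hmono := integral_mono (hiabs.const_mul (-(3 * D * C / R))) (hint.const_mul σ) hpt
    rw [integral_const_mul, integral_const_mul, StandingAssumptions.integral_abs_eq_quantile] at hmono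
    refine le_trans ?_ hmono
    have := mul_le_mul_of_nonneg_left (hM t ht) (by positivity : 0 ≤ 3 * D * C / R)
    have e : 3 * D * C * M / R = 3 * D * C / R * M := by ring
    rw [e]
    linarith
  have hmv := Convex.mul_sub_le_image_sub_of_le_deriv (convex_Icc a a')
    (f := fun s => σ * m s) (C := -(3 * D * C * M / R))
    (fun t ht => ((hder t ht).const_mul σ).continuousAt.continuousWithinAt)
    (fun t ht => ((hder t (interior_subset ht)).const_mul σ).differentiableAt.differentiableWithinAt)
    (fun t ht => by
      rw [((hder t (interior_subset ht)).const_mul σ).deriv]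
      exact hlow t (interior_subset ht))
    a (left_mem_Icc.2 haa) a' (right_mem_Icc.2 haa) haa
  exact hmv

/-- If the front `y₀ + c t` outruns the fluid (`σ = 1`) or is outrun by it (`σ = -1`), the mass to
its left is monotone in time. -/
theorem front_cdf_mono (hρ : IsDissipativeSolution V v p ρ₀ ρ)
    (h : StandingAssumptions V v lam b) (hp : 1 ≤ p) {σ c y₀ a a' δ D M : ℝ}
    (ha : 0 < a) (haa : a ≤ a') (hσ1 : |σ| ≤ 1) (hδ : 0 < δ) (hD0 : 0 ≤ D)
    (hD : ∀ t ∈ Icc a a', ∀ x, |nonlocalVelocity V v (ρ t.toNNReal : Measure ℝ) x| ≤ D * (1 + |x|))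
    (hM : ∀ t ∈ Icc a a', ∫ z, |quantile (ρ t.toNNReal : Measure ℝ) z| ∂unitMass ≤ M)
    (hu : ∀ t ∈ Icc a a', ∀ x ∈ Icc (y₀ + c * t) (y₀ + c * t + δ),
      σ * (nonlocalVelocity V v (ρ t.toNNReal : Measure ℝ) x - c) ≤ 0) :
    σ * (ρ a.toNNReal : Measure ℝ).real (Iic (y₀ + c * a)) ≤
      σ * (ρ a'.toNNReal : Measure ℝ).real (Iic (y₀ + c * a')) := by
  let χ : ContDiffBump (0 : ℝ) := ⟨1, 2, one_pos, one_lt_two⟩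
  have hχ : ContDiff ℝ 1 χ := χ.contDiff
  obtain ⟨C, hC⟩ := χ.hasCompactSupport.deriv.exists_bound_of_continuous
    (hχ.continuous_deriv le_rfl)
  have hC0 : 0 ≤ C := (norm_nonneg _).trans (hC 0)
  have hχ1 : ∀ y, |y| ≤ 1 → χ y = 1 := fun y hy =>
    χ.one_of_mem_closedBall (by simpa [χ, Metric.mem_closedBall] using hy)
  have hχd : ∀ y, |y| < 1 → deriv χ y = 0 := fun y hy => by
    have hev : (χ : ℝ → ℝ) =ᶠ[𝓝 y] fun _ => 1 := by
      filter_upwards [(isOpen_lt continuous_abs continuous_const).mem_nhds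
        (show y ∈ {y : ℝ | |y| < 1} from hy)] with w hw using hχ1 w (le_of_lt hw)
    rw [hev.deriv_eq]; simp
  have hχ2 : ∀ y, 2 < |y| → χ y = 0 := fun y hy =>
    χ.zero_of_le_dist (by simpa [χ] using hy.le)
  -- Equal to `1` for `y ≤ 0` and to `0` for `y ≥ δ / (n + 1)`: the profiles converge to the
  -- indicator of the closed half-line, while their slopes stay in `[0, δ]`, where the sign of `u -
  -- c` is known.
  set η : ℕ → ℝ → ℝ := fun n y => Real.smoothTransition (1 - y * (n + 1) / δ) with hη
  have hηc : ∀ n, ContDiff ℝ 1 (η n) := fun n =>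
    (Real.smoothTransition.contDiff (n := 1)).comp
      (contDiff_const.sub ((contDiff_id.mul contDiff_const).div_const _))
  have hηa : ∀ n, Antitone (η n) := fun n y y' hy =>
    Real.smoothTransition.monotone (by gcongr)
  have hηone : ∀ n y, y ≤ 0 → η n y = 1 := fun n y hy => by
    refine Real.smoothTransition.one_of_one_le ?_
    have : y * (n + 1) / δ ≤ 0 := div_nonpos_of_nonpos_of_nonneg
      (mul_nonpos_of_nonpos_of_nonneg hy (by positivity)) hδ.le
    linarith
  have hηzero : ∀ (n : ℕ) y, δ ≤ y * (n + 1) → η n y = 0 := fun n y hy => by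
    refine Real.smoothTransition.zero_of_nonpos ?_
    have : 1 ≤ y * (n + 1) / δ := (one_le_div hδ).2 hy
    linarith
  have hηd : ∀ n y, y ∉ Icc 0 δ → deriv (η n) y = 0 := by
    intro n y hy
    rcases not_and_or.1 hy with h1 | h1
    · have hev : η n =ᶠ[𝓝 y] fun _ => 1 := by
        filter_upwards [Iio_mem_nhds (not_le.1 h1)] with w hw using hηone n w (le_of_lt hw)
      rw [hev.deriv_eq]; simp
    · have hev : η n =ᶠ[𝓝 y] fun _ => 0 := by
        filter_upwards [Ioi_mem_nhds (not_le.1 h1)] with w hw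
        refine hηzero n w ?_
        have : δ < w := hw
        have hn : (0 : ℝ) ≤ n := n.cast_nonneg
        nlinarith
      rw [hev.deriv_eq]; simp
  have key := fun n : ℕ => hρ.front_integral_sub_ge h hp (R := n + 1) ha haa hσ1
    (by have : (0 : ℝ) ≤ n := n.cast_nonneg
        linarith) hD0 hC0 (hηc n)
    (fun y => Real.smoothTransition.nonneg _) (fun y => Real.smoothTransition.le_one _) (hηa n)
    (hηd n) hχ (fun y => χ.nonneg) hχ2 hχd hC hD hM hu
  have hlim : ∀ t : ℝ, Tendsto (fun n : ℕ => ∫ x, η n (x - (y₀ + c * t)) * χ (x / (n + 1))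
      ∂(ρ t.toNNReal : Measure ℝ)) atTop
      (𝓝 ((ρ t.toNNReal : Measure ℝ).real (Iic (y₀ + c * t)))) := by
    intro t
    rw [← integral_indicator_one measurableSet_Iic]
    refine tendsto_integral_of_dominated_convergence (fun _ => 1) (fun n => ?_)
      (integrable_const _) (fun n => ae_of_all _ fun x => ?_) (ae_of_all _ fun x => ?_)
    · exact (((hηc n).continuous.comp (continuous_id.sub continuous_const)).mul
        (χ.continuous.comp (continuous_id.div_const _))).aestronglyMeasurable
    · rw [Real.norm_eq_abs, abs_mul, abs_of_nonneg (Real.smoothTransition.nonneg _),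
        abs_of_nonneg χ.nonneg]
      exact mul_le_one₀ (Real.smoothTransition.le_one _) χ.nonneg χ.le_one
    · have hn := tendsto_natCast_atTop_atTop (R := ℝ)
      refine tendsto_const_nhds.congr' ?_
      have e1 : ∀ᶠ n : ℕ in atTop, (χ : ℝ → ℝ) (x / (n + 1)) = 1 := by
        filter_upwards [hn.eventually_ge_atTop |x|] with n hn'
        refine hχ1 _ ?_
        have h0 : (0 : ℝ) < n + 1 := by positivity
        rw [abs_div, abs_of_pos h0, div_le_one h0]
        linarith
      by_cases hx : x ≤ y₀ + c * t
      · filter_upwards [e1] with n h1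
        rw [h1, hηone n _ (by linarith)]
        simp [hx]
      · filter_upwards [e1, hn.eventually_ge_atTop (δ / (x - (y₀ + c * t)))] with n h1 h2
        have hx' : 0 < x - (y₀ + c * t) := by linarith [not_le.1 hx]
        rw [hηzero n _ (by
          rw [div_le_iff₀ hx'] at h2
          nlinarith)]
        simp [hx]
  have hE : Tendsto (fun n : ℕ => -(3 * D * C * M / ((n : ℝ) + 1)) * (a' - a)) atTop (𝓝 0) := by
    have := (tendsto_const_div_atTop_nhds_zero_nat (3 * D * C * M)).comp (tendsto_add_atTop_nat 1)
    simpa [Function.comp_def] using this.neg.mul_const (a' - a)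
  have := le_of_tendsto_of_tendsto' hE (((hlim a').const_mul σ).sub ((hlim a).const_mul σ)) key
  linarith

end IsDissipativeSolution

/-! ### From fronts to the motion of individual quantiles -/

namespace IsDissipativeSolution

variable {V v : ℝ → ℝ} {lam b : ℝ} {p : ℝ≥0∞} {ρ₀ : ProbabilityMeasure ℝ}
  {ρ : ℝ≥0 → ProbabilityMeasure ℝ}

/-- Continuity of the velocity spreads the strict inequality at `(x₀, t₀)` to a neighbourhood, in
which all nearby fronts of speed `c` remain for a short time. -/
theorem exists_front_cdf_mono (hρ : IsDissipativeSolution V v p ρ₀ ρ)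
    (h : StandingAssumptions V v lam b) (hp : 1 ≤ p) {σ c x₀ t₀ : ℝ} (ht₀ : 0 < t₀)
    (hσ : |σ| ≤ 1)
    (hc : σ * (nonlocalVelocity V v (ρ t₀.toNNReal : Measure ℝ) x₀ - c) < 0) :
    ∃ ε > 0, ∃ τ > 0, ∀ y, |y - x₀| < ε → ∀ a a', t₀ - τ < a → a ≤ a' → a' < t₀ + τ →
      σ * (ρ a.toNNReal : Measure ℝ).real (Iic (y + c * (a - t₀))) ≤
        σ * (ρ a'.toNNReal : Measure ℝ).real (Iic (y + c * (a' - t₀))) := by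
  have hcont := hρ.continuousAt_nonlocalVelocity h hp ht₀ x₀
  have hev := ((hcont.sub_const c).const_mul σ).eventually_lt_const hc
  obtain ⟨D, hD0, hD⟩ := hρ.eventually_abs_nonlocalVelocity_le h hp t₀
  obtain ⟨M, hM0, hM⟩ := hρ.eventually_integral_abs_quantile_le hp t₀
  obtain ⟨r₁, hr₁, h₁⟩ := Metric.eventually_nhds_iff.1 hev
  obtain ⟨r₂, hr₂, h₂⟩ := Metric.eventually_nhds_iff.1 (hD.and (hM.and (lt_mem_nhds ht₀)))
  -- The starting offset, the drift `|c| τ` and the transition layer take at most `r₁ / 4` each, so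
  -- the layer stays in the ball of radius `r₁` where the speeds compare.
  set τ := min (min r₁ r₂) (r₁ / 4 / (|c| + 1)) with hτ
  have hc1 : 0 < |c| + 1 := by positivity
  have hτ0 : 0 < τ := lt_min (lt_min hr₁ hr₂) (by positivity)
  have hτ1 : τ ≤ r₁ := (min_le_left _ _).trans (min_le_left _ _)
  have hτ2 : τ ≤ r₂ := (min_le_left _ _).trans (min_le_right _ _)
  have hτ3 : |c| * τ ≤ r₁ / 4 := by
    have h3 : τ ≤ r₁ / 4 / (|c| + 1) := min_le_right _ _
    rw [le_div_iff₀ hc1] at h3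
    nlinarith
  refine ⟨r₁ / 4, by linarith, τ, hτ0, fun y hy a a' ha haa ha' => ?_⟩
  have hdist : ∀ t ∈ Icc a a', |t - t₀| < τ := fun t ht =>
    abs_lt.2 ⟨by linarith [ht.1], by linarith [ht.2]⟩
  have hb := fun t (ht : t ∈ Icc a a') => h₂ (y := t)
    (by rw [Real.dist_eq]; exact (hdist t ht).trans_le hτ2)
  have key := hρ.front_cdf_mono h hp (σ := σ) (c := c) (y₀ := y - c * t₀) (δ := r₁ / 4) (D := D)
    (M := M) (hb a (left_mem_Icc.2 haa)).2.2 haa hσ (by linarith) hD0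
    (fun t ht => (hb t ht).1) (fun t ht => (hb t ht).2.1) (fun t ht x hx => ?_)
  · have e : ∀ s, y - c * t₀ + c * s = y + c * (s - t₀) := fun s => by ring
    rwa [e, e] at key
  · have h3 : |c * (t - t₀)| ≤ r₁ / 4 := by
      rw [abs_mul]
      exact (mul_le_mul_of_nonneg_left (hdist t ht).le (abs_nonneg c)).trans hτ3
    rw [abs_le] at h3
    rw [abs_lt] at hy
    have e : y - c * t₀ + c * t = y + c * (t - t₀) := by ring
    rw [e] at hx
    refine (h₁ (y := (x, t)) ?_).le
    rw [Prod.dist_eq]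
    refine max_lt ?_ ((hdist t ht).trans_le hτ1)
    simp only [Real.dist_eq]
    rw [abs_lt]
    constructor <;> linarith [hx.1, hx.2]

/-- Along a front the distribution function is monotone in time, so its level `z` cannot cross the
front started at the quantile. The sign of `σ * (t - t₀)` covers both kinds of front and both time
directions. -/
theorem eventually_quantileCurve_compare (hρ : IsDissipativeSolution V v p ρ₀ ρ)
    (h : StandingAssumptions V v lam b) (hp : 1 ≤ p) {z t₀ : ℝ} (hz : z ∈ Ioo (0 : ℝ) 1)
    (ht₀ : 0 < t₀) {σ c : ℝ} (hσ : σ = 1 ∨ σ = -1)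
    (hc : σ * (nonlocalVelocity V v (ρ t₀.toNNReal : Measure ℝ) (quantileCurve ρ z t₀) - c) < 0) :
    ∀ᶠ t in 𝓝 t₀,
      (0 ≤ σ * (t - t₀) → quantileCurve ρ z t ≤ quantileCurve ρ z t₀ + c * (t - t₀)) ∧
      (σ * (t - t₀) ≤ 0 → quantileCurve ρ z t₀ + c * (t - t₀) ≤ quantileCurve ρ z t) := by
  obtain ⟨ε, hε, τ, hτ, hmono⟩ := hρ.exists_front_cdf_mono h hp ht₀
    (by rcases hσ with rfl | rfl <;> simp) hc
  set x₀ := quantileCurve ρ z t₀ with hx₀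
  have hF0 : z ≤ (ρ t₀.toNNReal : Measure ℝ).real (Iic x₀) :=
    (quantile_le_iff _ hz _).1 le_rfl
  have hFlt : ∀ y < x₀, (ρ t₀.toNNReal : Measure ℝ).real (Iic y) < z := fun y hy =>
    (lt_quantile_iff _ hz _).1 hy
  have hcmp : ∀ y, |y - x₀| < ε → ∀ t, |t - t₀| < τ →
      (0 ≤ σ * (t - t₀) → (ρ t₀.toNNReal : Measure ℝ).real (Iic y) ≤
        (ρ t.toNNReal : Measure ℝ).real (Iic (y + c * (t - t₀)))) ∧
      (σ * (t - t₀) ≤ 0 → (ρ t.toNNReal : Measure ℝ).real (Iic (y + c * (t - t₀))) ≤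
        (ρ t₀.toNNReal : Measure ℝ).real (Iic y)) := by
    intro y hy t ht
    rw [abs_lt] at ht
    have hA := hmono y hy t₀ t (by linarith)
    have hB := hmono y hy t t₀ (by linarith)
    simp only [sub_self, mul_zero, add_zero] at hA hB
    rcases hσ with rfl | rfl
    · constructor <;> intro hs
      · linarith [hA (by linarith) (by linarith)]
      · linarith [hB (by linarith) (by linarith)]
    · constructor <;> intro hs
      · linarith [hB (by linarith) (by linarith)]
      · linarith [hA (by linarith) (by linarith)]
  filter_upwards [Metric.ball_mem_nhds t₀ hτ] with t ht
  rw [Metric.mem_ball, Real.dist_eq] at ht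
  constructor
  · intro hs
    exact (quantile_le_iff _ hz _).2 (hF0.trans ((hcmp x₀ (by simpa using hε) t ht).1 hs))
  · intro hs
    refine le_of_forall_lt_imp_le_of_dense fun w hw => ?_
    -- At `x₀` itself the distribution function has reached `z`, so the lower bound uses fronts
    -- started strictly to the left. The maximum keeps the start within `ε` of `x₀`, with the front
    -- at or beyond `w` at time `t`.
    set y := max (w - c * (t - t₀)) (x₀ - ε / 2) with hy
    have hyx : y < x₀ := max_lt (by linarith) (by linarith)
    have h1 := (hcmp y (abs_lt.2 ⟨by linarith [le_max_right (w - c * (t - t₀)) (x₀ - ε / 2)],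
      by linarith⟩) t ht).2 hs
    have h2 := (lt_quantile_iff (ρ t.toNNReal : Measure ℝ) hz (y + c * (t - t₀))).2
      (h1.trans_lt (hFlt y hyx))
    have h3 := le_max_left (w - c * (t - t₀)) (x₀ - ε / 2)
    unfold quantileCurve
    linarith

/-- At positive times the quantile functions of a dissipative solution are transported by the
nonlocal velocity. -/
theorem hasDerivAt_quantileCurve (hρ : IsDissipativeSolution V v p ρ₀ ρ)
    (h : StandingAssumptions V v lam b) (hp : 1 ≤ p) {z t₀ : ℝ} (hz : z ∈ Ioo (0 : ℝ) 1)
    (ht₀ : 0 < t₀) :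
    HasDerivAt (fun t => quantileCurve ρ z t)
      (nonlocalVelocity V v (ρ t₀.toNNReal : Measure ℝ) (quantileCurve ρ z t₀)) t₀ := by
  rw [hasDerivAt_iff_isLittleO, Asymptotics.isLittleO_iff]
  intro ε hε
  set u := nonlocalVelocity V v (ρ t₀.toNNReal : Measure ℝ) (quantileCurve ρ z t₀) with hu
  -- The front of speed `u + ε` outruns the fluid and that of speed `u - ε` is outrun; together they
  -- bound the difference quotient on both sides of `t₀`.
  filter_upwards [hρ.eventually_quantileCurve_compare h hp hz ht₀ (σ := 1) (c := u + ε) (Or.inl rfl)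
      (by rw [← hu]; linarith),
    hρ.eventually_quantileCurve_compare h hp hz ht₀ (σ := -1) (c := u - ε) (Or.inr rfl)
      (by rw [← hu]; linarith)] with t h1 h2
  rw [Real.norm_eq_abs, Real.norm_eq_abs, smul_eq_mul]
  rcases le_total 0 (t - t₀) with hs | hs
  · have a1 := h1.1 (by linarith)
    have a2 := h2.2 (by linarith)
    rw [abs_of_nonneg hs, abs_le]
    constructor <;> linarith
  · have a1 := h1.2 (by linarith)
    have a2 := h2.1 (by linarith)
    rw [abs_of_nonpos hs, abs_le]
    constructor <;> linarith

theorem nonlocalVelocity_quantileCurve (hρ : IsDissipativeSolution V v p ρ₀ ρ)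
    (h : StandingAssumptions V v lam b) (hp : 1 ≤ p) {z t : ℝ} (hz : z ∈ Ioo (0 : ℝ) 1)
    (ht : 0 < t) :
    nonlocalVelocity V v (ρ t.toNNReal : Measure ℝ) (quantileCurve ρ z t) =
      v (∫ ζ, kernelU V lam (quantileCurve ρ z t - quantile (ρ t.toNNReal : Measure ℝ) ζ) ∂unitMass
        - lam * z) := by
  unfold nonlocalVelocity
  rw [h.integral_kernel_sub (hρ.integrable_id hp _), h.integral_kernelU_eq_quantile,
    measureReal_congr (Iio_ae_eq_Iic' (hρ.measure_singleton ht _))]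
  unfold quantileCurve
  rw [cdf_quantile (hρ.measure_singleton ht) hz]

/-! ### Stability -/

section

variable {ρ₁₀ ρ₂₀ : ProbabilityMeasure ℝ} {ρ₁ ρ₂ : ℝ≥0 → ProbabilityMeasure ℝ}

/-- The terms `lam * z` cancel at equal `z`, leaving a difference whose derivative is at most `K
(|·| + G)`. The times start at `s > 0` because the quantile equation is available only at positive
times. -/
theorem abs_quantileCurve_sub_le (h₁ : IsDissipativeSolution V v p ρ₁₀ ρ₁)
    (h₂ : IsDissipativeSolution V v p ρ₂₀ ρ₂) (h : StandingAssumptions V v lam b) (hp : 1 ≤ p)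
    {s t G K : ℝ} (hs : 0 < s) (hst : s ≤ t)
    (hK : K = lipSeminorm v univ * lipSeminorm V (Iic 0))
    (hG : ∀ r ∈ Icc s t, quantileDist (ρ₁ r.toNNReal : Measure ℝ) (ρ₂ r.toNNReal : Measure ℝ) ≤ G)
    {z : ℝ} (hz : z ∈ Ioo (0 : ℝ) 1) :
    |quantileCurve ρ₁ z t - quantileCurve ρ₂ z t| ≤
      gronwallBound |quantileCurve ρ₁ z s - quantileCurve ρ₂ z s| K (K * G) (t - s) := by
  have hd := fun r (hr : r ∈ Icc s t) =>
    (h₁.hasDerivAt_quantileCurve h hp hz (hs.trans_le hr.1)).sub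
      (h₂.hasDerivAt_quantileCurve h hp hz (hs.trans_le hr.1))
  refine norm_le_gronwallBound_of_norm_deriv_right_le
    (f := fun r => quantileCurve ρ₁ z r - quantileCurve ρ₂ z r)
    (fun r hr => (hd r hr).continuousAt.continuousWithinAt)
    (fun r hr => (hd r (Ico_subset_Icc_self hr)).hasDerivWithinAt) le_rfl (fun r hr => ?_) t
    (right_mem_Icc.2 hst)
  have hr0 : 0 < r := hs.trans_le hr.1
  rw [h₁.nonlocalVelocity_quantileCurve h hp hz hr0, h₂.nonlocalVelocity_quantileCurve h hp hz hr0]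
  have e1 := h.lipschitzWith_velocity.dist_le_mul
    (∫ ζ, kernelU V lam (quantileCurve ρ₁ z r - quantile (ρ₁ r.toNNReal : Measure ℝ) ζ) ∂unitMass
        - lam * z)
    (∫ ζ, kernelU V lam (quantileCurve ρ₂ z r - quantile (ρ₂ r.toNNReal : Measure ℝ) ζ) ∂unitMass
        - lam * z)
  rw [Real.dist_eq, Real.dist_eq, sub_sub_sub_cancel_right] at e1
  have e2 := h.abs_integral_kernelU_sub_le h.lipschitzWith_kernelU
    (integrable_quantile (h₁.integrable_id hp r.toNNReal))
    (integrable_quantile (h₂.integrable_id hp r.toNNReal))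
    (quantileCurve ρ₁ z r) (quantileCurve ρ₂ z r)
  have e3 := hG r (Ico_subset_Icc_self hr)
  unfold quantileDist at e3
  rw [Real.norm_eq_abs, Real.norm_eq_abs, hK]
  refine e1.trans ((mul_le_mul_of_nonneg_left (e2.trans (mul_le_mul_of_nonneg_left
    (add_le_add_right e3 _) (NNReal.coe_nonneg _))) (NNReal.coe_nonneg _)).trans (le_of_eq ?_))
  ring

end

end IsDissipativeSolution

/-! ### Stability in the Wasserstein distance and uniqueness -/

theorem gronwallBound_mul (δ K G x : ℝ) :
    gronwallBound δ K (K * G) x = Real.exp (K * x) * δ + (Real.exp (K * x) - 1) * G := by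
  by_cases hK : K = 0
  · simp [hK, gronwallBound_K0]
  · rw [gronwallBound_of_K_ne_0 hK]
    field_simp

section wasserstein

variable {p : ℝ≥0∞} {μ ν κ : Measure ℝ} [IsProbabilityMeasure μ] [IsProbabilityMeasure ν]
  [IsProbabilityMeasure κ]

theorem wasserstein_ne_top (hμ : HasFiniteMoment p μ) (hν : HasFiniteMoment p ν) :
    wasserstein p μ ν ≠ ∞ :=
  (memLp_quantile_sub hμ hν).eLpNorm_ne_top

theorem wasserstein_comm (p : ℝ≥0∞) (μ ν : Measure ℝ) : wasserstein p μ ν = wasserstein p ν μ :=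
  eLpNorm_sub_comm (quantile μ) (quantile ν) p _

variable (μ ν κ) in
theorem wasserstein_triangle (hp : 1 ≤ p) :
    wasserstein p μ κ ≤ wasserstein p μ ν + wasserstein p ν κ := by
  have hm := fun (κ : Measure ℝ) [IsProbabilityMeasure κ] =>
    (aemeasurable_quantile κ).aestronglyMeasurable
  have := eLpNorm_add_le ((hm μ).sub (hm ν)) ((hm ν).sub (hm κ)) hp
  simpa [wasserstein, Pi.sub_def, Pi.add_def] using this

end wasserstein

namespace IsDissipativeSolution

variable {V v : ℝ → ℝ} {lam b : ℝ} {p : ℝ≥0∞} {ρ₁₀ ρ₂₀ : ProbabilityMeasure ℝ}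
  {ρ₁ ρ₂ : ℝ≥0 → ProbabilityMeasure ℝ}

theorem continuous_toReal_wasserstein (h₁ : IsDissipativeSolution V v p ρ₁₀ ρ₁)
    (h₂ : IsDissipativeSolution V v p ρ₂₀ ρ₂) (hp : 1 ≤ p) :
    Continuous fun t : ℝ => (wasserstein p (ρ₁ t.toNNReal : Measure ℝ)
      (ρ₂ t.toNNReal : Measure ℝ)).toReal := by
  refine continuous_iff_continuousAt.2 fun t => ?_
  have hc1 := (h₁.continuous t.toNNReal).comp (continuous_real_toNNReal.tendsto t)
  have hc2 := (h₂.continuous t.toNNReal).comp (continuous_real_toNNReal.tendsto t)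
  have hr1 := (ENNReal.tendsto_toReal ENNReal.zero_ne_top).comp hc1
  have hr2 := (ENNReal.tendsto_toReal ENNReal.zero_ne_top).comp hc2
  simp only [ENNReal.toReal_zero] at hr1 hr2
  have hsum := hr1.add hr2
  rw [add_zero] at hsum
  refine tendsto_iff_dist_tendsto_zero.2 (squeeze_zero (fun _ => dist_nonneg) (fun s => ?_) hsum)
  have n1 : ∀ a b : ℝ≥0, wasserstein p (ρ₁ a : Measure ℝ) (ρ₁ b : Measure ℝ) ≠ ∞ :=
    fun a b => wasserstein_ne_top (h₁.finiteMoment a) (h₁.finiteMoment b)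
  have n2 : ∀ a b : ℝ≥0, wasserstein p (ρ₂ a : Measure ℝ) (ρ₂ b : Measure ℝ) ≠ ∞ :=
    fun a b => wasserstein_ne_top (h₂.finiteMoment a) (h₂.finiteMoment b)
  have n12 : ∀ a b : ℝ≥0, wasserstein p (ρ₁ a : Measure ℝ) (ρ₂ b : Measure ℝ) ≠ ∞ :=
    fun a b => wasserstein_ne_top (h₁.finiteMoment a) (h₂.finiteMoment b)
  have key : ∀ a b : ℝ≥0, (wasserstein p (ρ₁ a : Measure ℝ) (ρ₂ a : Measure ℝ)).toReal ≤
      (wasserstein p (ρ₁ a : Measure ℝ) (ρ₁ b : Measure ℝ)).toReal +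
      ((wasserstein p (ρ₁ b : Measure ℝ) (ρ₂ b : Measure ℝ)).toReal +
      (wasserstein p (ρ₂ b : Measure ℝ) (ρ₂ a : Measure ℝ)).toReal) := by
    intro a b
    rw [← ENNReal.toReal_add (n12 b b) (n2 b a),
      ← ENNReal.toReal_add (n1 a b) (ENNReal.add_ne_top.2 ⟨n12 b b, n2 b a⟩)]
    refine ENNReal.toReal_mono (ENNReal.add_ne_top.2 ⟨n1 a b, ENNReal.add_ne_top.2
      ⟨n12 b b, n2 b a⟩⟩) ?_
    refine (wasserstein_triangle _ (ρ₁ b : Measure ℝ) _ hp).trans ?_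
    gcongr
    exact wasserstein_triangle _ (ρ₂ b : Measure ℝ) _ hp
  have k1 := key s.toNNReal t.toNNReal
  have k2 := key t.toNNReal s.toNNReal
  rw [wasserstein_comm p (ρ₂ t.toNNReal : Measure ℝ) (ρ₂ s.toNNReal : Measure ℝ)] at k1
  rw [wasserstein_comm p (ρ₁ t.toNNReal : Measure ℝ) (ρ₁ s.toNNReal : Measure ℝ)] at k2
  simp only [Function.comp_apply, Real.dist_eq]
  rw [abs_le]
  constructor <;> linarith

theorem quantileDist_le_toReal_wasserstein (h₁ : IsDissipativeSolution V v p ρ₁₀ ρ₁)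
    (h₂ : IsDissipativeSolution V v p ρ₂₀ ρ₂) (hp : 1 ≤ p) (t : ℝ≥0) :
    quantileDist (ρ₁ t : Measure ℝ) (ρ₂ t : Measure ℝ) ≤
      (wasserstein p (ρ₁ t : Measure ℝ) (ρ₂ t : Measure ℝ)).toReal := by
  have := ofReal_quantileDist_le_wasserstein hp (h₁.finiteMoment t) (h₂.finiteMoment t)
  rwa [ENNReal.ofReal_le_iff_le_toReal
    (wasserstein_ne_top (h₁.finiteMoment t) (h₂.finiteMoment t))] at this

/-- Minkowski's inequality applied to the bound at fixed `z`; the constant term keeps its size in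
`L^p` because the mass coordinate has total mass one. -/
theorem toReal_wasserstein_le_of_quantileDist_le (h₁ : IsDissipativeSolution V v p ρ₁₀ ρ₁)
    (h₂ : IsDissipativeSolution V v p ρ₂₀ ρ₂) (h : StandingAssumptions V v lam b) (hp : 1 ≤ p)
    {s t G K : ℝ} (hs : 0 < s) (hst : s ≤ t)
    (hK : K = lipSeminorm v univ * lipSeminorm V (Iic 0)) (hG0 : 0 ≤ G)
    (hG : ∀ r ∈ Icc s t, quantileDist (ρ₁ r.toNNReal : Measure ℝ) (ρ₂ r.toNNReal : Measure ℝ) ≤ G) :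
    (wasserstein p (ρ₁ t.toNNReal : Measure ℝ) (ρ₂ t.toNNReal : Measure ℝ)).toReal ≤
      Real.exp (K * (t - s)) *
        (wasserstein p (ρ₁ s.toNNReal : Measure ℝ) (ρ₂ s.toNNReal : Measure ℝ)).toReal +
      (Real.exp (K * (t - s)) - 1) * G := by
  set e := Real.exp (K * (t - s)) with he
  have hK0 : 0 ≤ K := by rw [hK]; positivity
  have he1 : 1 ≤ e := Real.one_le_exp (mul_nonneg hK0 (by linarith))
  have hfs := memLp_quantile_sub (h₁.finiteMoment s.toNNReal) (h₂.finiteMoment s.toNNReal)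
  have hpt : ∀ᵐ z ∂unitMass,
      ‖quantile (ρ₁ t.toNNReal : Measure ℝ) z - quantile (ρ₂ t.toNNReal : Measure ℝ) z‖ ≤
      e * ‖quantile (ρ₁ s.toNNReal : Measure ℝ) z - quantile (ρ₂ s.toNNReal : Measure ℝ) z‖ +
        (e - 1) * G := by
    filter_upwards [ae_unitMass_mem_Ioo] with z hz
    have := h₁.abs_quantileCurve_sub_le h₂ h hp hs hst hK hG hz
    rwa [gronwallBound_mul] at this
  have h3 : wasserstein p (ρ₁ t.toNNReal : Measure ℝ) (ρ₂ t.toNNReal : Measure ℝ) ≤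
      ENNReal.ofReal e * wasserstein p (ρ₁ s.toNNReal : Measure ℝ) (ρ₂ s.toNNReal : Measure ℝ) +
        ENNReal.ofReal ((e - 1) * G) := by
    refine (eLpNorm_mono_ae_real hpt).trans ?_
    refine (eLpNorm_add_le (f := fun z => e * ‖quantile (ρ₁ s.toNNReal : Measure ℝ) z -
      quantile (ρ₂ s.toNNReal : Measure ℝ) z‖) (g := fun _ => (e - 1) * G)
      (hfs.aestronglyMeasurable.norm.const_mul e) aestronglyMeasurable_const hp).trans ?_
    gcongr
    · have := eLpNorm_const_smul e (fun z => ‖quantile (ρ₁ s.toNNReal : Measure ℝ) z -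
        quantile (ρ₂ s.toNNReal : Measure ℝ) z‖) p unitMass
      rw [eLpNorm_norm, Real.enorm_eq_ofReal (by linarith)] at this
      exact this.le
    · rw [eLpNorm_const _ (zero_lt_one.trans_le hp).ne' (NeZero.ne unitMass),
        Real.enorm_eq_ofReal (mul_nonneg (by linarith) hG0)]
      simp
  have hn := wasserstein_ne_top (h₁.finiteMoment s.toNNReal) (h₂.finiteMoment s.toNNReal)
  have hne := ENNReal.mul_ne_top (ENNReal.ofReal_ne_top (r := e)) hn
  have h4 := ENNReal.toReal_mono (ENNReal.add_ne_top.2 ⟨hne, ENNReal.ofReal_ne_top⟩) h3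
  rwa [ENNReal.toReal_add hne ENNReal.ofReal_ne_top, ENNReal.toReal_mul,
    ENNReal.toReal_ofReal (by linarith), ENNReal.toReal_ofReal (mul_nonneg (by linarith) hG0)] at h4

/-- On short time intervals the `L¹` distance is itself dominated by the `W_p` distance `H`, so `H`
satisfies `H' ≤ 2 K H` in the sense of right lower derivatives. One factor `K` comes from the
displacement of the point, the other from the change of the measure. Continuity of `H` then lets the
starting time tend to `0`. -/
theorem toReal_wasserstein_le (h₁ : IsDissipativeSolution V v p ρ₁₀ ρ₁)
    (h₂ : IsDissipativeSolution V v p ρ₂₀ ρ₂) (h : StandingAssumptions V v lam b) (hp : 1 ≤ p)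
    {t : ℝ} (ht : 0 ≤ t) :
    (wasserstein p (ρ₁ t.toNNReal : Measure ℝ) (ρ₂ t.toNNReal : Measure ℝ)).toReal ≤
      Real.exp (2 * (lipSeminorm v univ * lipSeminorm V (Iic 0)) * t) *
      (wasserstein p (ρ₁₀ : Measure ℝ) (ρ₂₀ : Measure ℝ)).toReal := by
  obtain ⟨K, hK⟩ : ∃ K : ℝ, K = lipSeminorm v univ * lipSeminorm V (Iic 0) := ⟨_, rfl⟩
  have hK0 : 0 ≤ K := by rw [hK]; positivity
  rw [← hK]
  set H : ℝ → ℝ := fun t => (wasserstein p (ρ₁ t.toNNReal : Measure ℝ)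
      (ρ₂ t.toNNReal : Measure ℝ)).toReal with hH
  have hHc : Continuous H := h₁.continuous_toReal_wasserstein h₂ hp
  have hH0 : ∀ t, 0 ≤ H t := fun t => ENNReal.toReal_nonneg
  have hpos : ∀ s t : ℝ, 0 < s → s ≤ t → H t ≤ H s * Real.exp (2 * K * (t - s)) := by
    intro s t hs hst
    rw [← gronwallBound_ε0]
    refine le_gronwallBound_of_liminf_deriv_right_le (f' := fun x => 2 * K * H x)
      hHc.continuousOn (fun x hx r hr => ?_) le_rfl (fun x _ => by simp) t (right_mem_Icc.2 hst)
    have hx0 : 0 < x := hs.trans_le hx.1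
    obtain ⟨ε, hε, hεr⟩ : ∃ ε > 0, K * (2 * H x + ε) < r := by
      -- The denominator `2 (K + 1)` makes `K ε` smaller than the available gap and covers `K = 0`.
      refine ⟨(r - 2 * K * H x) / (2 * (K + 1)), div_pos (by linarith) (by positivity), ?_⟩
      have : K * ((r - 2 * K * H x) / (2 * (K + 1))) < r - 2 * K * H x := by
        rw [mul_div_assoc', div_lt_iff₀ (by positivity)]
        nlinarith
      linarith
    obtain ⟨δ, hδ, hball⟩ := Metric.eventually_nhds_iff.1
      (hHc.continuousAt.eventually_lt_const (show H x < H x + ε by linarith))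
    have hder : HasDerivAt (fun z => Real.exp (K * (z - x))) K x := by
      have h1 : HasDerivAt (fun z => K * (z - x)) K x := by
        simpa using ((hasDerivAt_id x).sub_const x).const_mul K
      simpa using h1.exp
    have hsl := (hasDerivAt_iff_tendsto_slope.1 hder).mono_left
      (nhdsWithin_mono x (fun y (hy : x < y) => hy.ne') : 𝓝[>] x ≤ 𝓝[≠] x)
    have hlim := (hsl.mul_const (2 * H x + ε)).eventually_lt_const hεr
    refine Eventually.frequently ?_
    filter_upwards [hlim, Ioo_mem_nhdsGT (show x < x + δ by linarith)] with z hz hz2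
    have hxz : 0 < z - x := by linarith [hz2.1]
    -- With `G = H x + ε` the increment of `H` is at most `(exp(K (z - x)) - 1) (2 H x + ε)`, whose
    -- difference quotient tends to `K (2 H x + ε) < r`.
    have hloc := h₁.toReal_wasserstein_le_of_quantileDist_le h₂ h hp hx0 hz2.1.le hK
      (G := H x + ε) (by linarith [hH0 x]) (fun q hq => by
        refine (h₁.quantileDist_le_toReal_wasserstein h₂ hp _).trans (hball (y := q) ?_).le
        rw [Real.dist_eq, abs_lt]
        constructor <;> linarith [hq.1, hq.2, hz2.2])
    change H z ≤ _ * H x + _ at hloc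
    refine lt_of_le_of_lt ?_ hz
    rw [slope_def_field]
    simp only [sub_self, mul_zero, Real.exp_zero]
    rw [inv_mul_eq_div, div_mul_eq_mul_div]
    gcongr
    nlinarith
  have hlim : Tendsto (fun s => H s * Real.exp (2 * K * (t - s))) (𝓝[>] 0)
      (𝓝 (H 0 * Real.exp (2 * K * (t - 0)))) := by
    have : Continuous fun s => H s * Real.exp (2 * K * (t - s)) := by fun_prop
    exact (this.tendsto 0).mono_left nhdsWithin_le_nhds
  have hzero : H 0 = (wasserstein p (ρ₁₀ : Measure ℝ) (ρ₂₀ : Measure ℝ)).toReal := by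
    simp [hH, h₁.initial, h₂.initial]
  change H t ≤ _
  rw [← hzero]
  rcases ht.eq_or_lt with rfl | ht0
  · simp
  · rw [sub_zero] at hlim
    rw [mul_comm]
    refine ge_of_tendsto hlim ?_
    filter_upwards [Ioo_mem_nhdsGT ht0] with s hs
    exact hpos s t hs.1 hs.2.le

/-- The argument gives the factor `2` for every `p`; since `(p + 1) / p ≥ 1`, the stated constant is
no smaller. -/
theorem two_mul_le_stabilityConst (V v : ℝ → ℝ) (hp : 1 ≤ p) :
    2 * ((lipSeminorm v univ : ℝ) * (lipSeminorm V (Iic 0) : ℝ)) ≤ stabilityConst V v p := by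
  unfold stabilityConst
  rw [mul_assoc]
  gcongr
  split_ifs with hpt
  · exact le_rfl
  · have h1 : 1 ≤ p.toReal := by simpa using ENNReal.toReal_mono hpt hp
    calc (2 : ℝ) = 2 ^ (1 : ℝ) := by simp
      _ ≤ _ := by
        refine Real.rpow_le_rpow_of_exponent_le one_le_two ?_
        rw [one_le_div (by linarith)]
        linarith

theorem wasserstein_le (h₁ : IsDissipativeSolution V v p ρ₁₀ ρ₁)
    (h₂ : IsDissipativeSolution V v p ρ₂₀ ρ₂) (h : StandingAssumptions V v lam b) (hp : 1 ≤ p)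
    (t : ℝ≥0) :
    wasserstein p (ρ₁ t : Measure ℝ) (ρ₂ t : Measure ℝ) ≤
      ENNReal.ofReal (Real.exp (stabilityConst V v p * t)) *
        wasserstein p (ρ₁₀ : Measure ℝ) (ρ₂₀ : Measure ℝ) := by
  have h3 := h₁.toReal_wasserstein_le h₂ h hp t.coe_nonneg
  rw [Real.toNNReal_coe] at h3
  have h4 : Real.exp (2 * (lipSeminorm v univ * lipSeminorm V (Iic 0)) * t) ≤
      Real.exp (stabilityConst V v p * t) := by
    gcongr
    exact two_mul_le_stabilityConst V v hp
  have h5 := h3.trans (mul_le_mul_of_nonneg_right h4 ENNReal.toReal_nonneg)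
  have m1 := h₁.finiteMoment 0
  have m2 := h₂.finiteMoment 0
  rw [h₁.initial] at m1
  rw [h₂.initial] at m2
  rw [← ENNReal.ofReal_toReal (wasserstein_ne_top m1 m2), ← ENNReal.ofReal_mul (Real.exp_nonneg _),
    ← ENNReal.ofReal_toReal (wasserstein_ne_top (h₁.finiteMoment t) (h₂.finiteMoment t))]
  exact ENNReal.ofReal_le_ofReal h5

theorem unique {ρ₀ : ProbabilityMeasure ℝ} (h₁ : IsDissipativeSolution V v p ρ₀ ρ₁)
    (h₂ : IsDissipativeSolution V v p ρ₀ ρ₂) (h : StandingAssumptions V v lam b) (hp : 1 ≤ p) :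
    ρ₁ = ρ₂ := by
  funext t
  have h3 := h₁.wasserstein_le h₂ h hp t
  have h4 : wasserstein p (ρ₀ : Measure ℝ) (ρ₀ : Measure ℝ) = 0 := by simp [wasserstein]
  rw [h4, mul_zero, nonpos_iff_eq_zero, wasserstein, eLpNorm_eq_zero_iff
    (memLp_quantile_sub (h₁.finiteMoment t) (h₂.finiteMoment t)).aestronglyMeasurable
    (zero_lt_one.trans_le hp).ne'] at h3
  have h5 : (ρ₁ t : Measure ℝ) = (ρ₂ t : Measure ℝ) := by
    refine eq_of_quantile_ae_eq _ _ ?_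
    filter_upwards [h3] with z hz
    exact sub_eq_zero.1 hz
  exact Subtype.ext h5

end IsDissipativeSolution

open scoped BoundedContinuousFunction

/-! ### Global solutions of Lipschitz differential equations -/

section GlobalODE

variable {E : Type*} [NormedAddCommGroup E] [NormedSpace ℝ E]

/-- Integration gains a factor `1 / C` in the norm weighted by `exp(-C t)`. With `C` above the
Lipschitz constant the Picard map contracts on the whole half-line at once. -/
theorem norm_integral_le_exp {C M t : ℝ} (hC : 0 < C) (ht : 0 ≤ t) (hM : 0 ≤ M) {f : ℝ → E}
    (hf : ∀ s ∈ Icc 0 t, ‖f s‖ ≤ M * Real.exp (C * s)) :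
    Real.exp (-(C * t)) * ‖∫ s in (0 : ℝ)..t, f s‖ ≤ M / C := by
  have h1 : ‖∫ s in (0 : ℝ)..t, f s‖ ≤ ∫ s in (0 : ℝ)..t, M * Real.exp (C * s) := by
    refine intervalIntegral.norm_integral_le_of_norm_le ht (ae_of_all _ fun s hs => ?_)
      (Continuous.intervalIntegrable (by fun_prop) _ _)
    exact hf s (Ioc_subset_Icc_self hs)
  have h2 : ∫ s in (0 : ℝ)..t, M * Real.exp (C * s) = M / C * (Real.exp (C * t) - 1) := by
    rw [intervalIntegral.integral_const_mul,
      intervalIntegral.integral_comp_mul_left (fun s => Real.exp s) hC.ne', integral_exp]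
    simp
    ring
  calc Real.exp (-(C * t)) * ‖∫ s in (0 : ℝ)..t, f s‖
      ≤ Real.exp (-(C * t)) * (M / C * (Real.exp (C * t) - 1)) := by
        rw [← h2]; gcongr
    _ = M / C * (1 - Real.exp (-(C * t))) := by
        have : Real.exp (-(C * t)) * Real.exp (C * t) = 1 := by rw [← Real.exp_add]; simp
        linear_combination (M / C) * this
    _ ≤ M / C * 1 := by
        have := Real.exp_pos (-(C * t))
        gcongr
        linarith
    _ = M / C := mul_one _

variable [CompleteSpace E]

/-- An autonomous Lipschitz differential equation in a Banach space has global solutions. -/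
theorem exists_global_solution {G : E → E} {K : ℝ≥0} (hG : LipschitzWith K G) (y₀ : E) :
    ∃ y : ℝ → E, y 0 = y₀ ∧ ∀ t, 0 ≤ t → HasDerivAt y (G (y t)) t := by
  set C : ℝ := K + 1 with hC
  have hC0 : 0 < C := by positivity
  have hgc : ∀ w : ℝ →ᵇ E, Continuous fun s : ℝ => G (Real.exp (C * s) • w s) := fun w =>
    hG.continuous.comp ((by fun_prop : Continuous fun s : ℝ => Real.exp (C * s)).smul w.continuous)
  have hgi : ∀ (w : ℝ →ᵇ E) (a b : ℝ),
      IntervalIntegrable (fun s : ℝ => G (Real.exp (C * s) • w s)) volume a b := fun w a b =>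
    (hgc w).intervalIntegrable a b
  have hder : ∀ (w : ℝ →ᵇ E) (t : ℝ), HasDerivAt
      (fun t => ∫ s in (0 : ℝ)..t, G (Real.exp (C * s) • w s)) (G (Real.exp (C * t) • w t)) t :=
    fun w t => intervalIntegral.integral_hasDerivAt_right (hgi w _ _)
      (hgc w).aestronglyMeasurable.stronglyMeasurableAtFilter (hgc w).continuousAt
  have hic : ∀ w : ℝ →ᵇ E, Continuous fun t => ∫ s in (0 : ℝ)..t, G (Real.exp (C * s) • w s) :=
    fun w => continuous_iff_continuousAt.2 fun t => (hder w t).continuousAt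
  -- The Picard map for the bounded unknown `w(t) = exp(-C t) y(t)`, with `max t 0` freezing
  -- negative times so that `w` is a function on all of `ℝ`.
  let Φ : (ℝ →ᵇ E) → (ℝ →ᵇ E) := fun w => BoundedContinuousFunction.ofNormedAddCommGroup
    (fun t => Real.exp (-(C * max t 0)) •
      (y₀ + ∫ s in (0 : ℝ)..(max t 0), G (Real.exp (C * s) • w s)))
    (by
      have h1 : Continuous fun t : ℝ => max t 0 := continuous_id.max continuous_const
      exact (by fun_prop : Continuous fun t : ℝ => Real.exp (-(C * max t 0))).smul
        (continuous_const.add ((hic w).comp h1)))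
    (‖y₀‖ + (‖G 0‖ + K * ‖w‖) / C)
    (by
      intro t
      have ht : 0 ≤ max t 0 := le_max_right _ _
      have he : Real.exp (-(C * max t 0)) ≤ 1 := Real.exp_le_one_iff.2 (by
        have := mul_nonneg hC0.le ht
        linarith)
      rw [norm_smul, Real.norm_of_nonneg (Real.exp_nonneg _)]
      refine (mul_le_mul_of_nonneg_left (norm_add_le _ _) (Real.exp_nonneg _)).trans ?_
      rw [mul_add]
      refine add_le_add (mul_le_of_le_one_left (norm_nonneg _) he)
        (norm_integral_le_exp hC0 ht (by positivity) fun s hs => ?_)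
      have h1 := hG.dist_le_mul (Real.exp (C * s) • w s) 0
      rw [dist_eq_norm, dist_eq_norm, sub_zero, norm_smul,
        Real.norm_of_nonneg (Real.exp_nonneg _)] at h1
      have h2 : ‖G (Real.exp (C * s) • w s)‖ ≤ ‖G 0‖ + ‖G (Real.exp (C * s) • w s) - G 0‖ :=
        norm_le_norm_add_norm_sub' _ _
      have h3 : 1 ≤ Real.exp (C * s) := Real.one_le_exp (mul_nonneg hC0.le hs.1)
      have h4 : Real.exp (C * s) * ‖w s‖ ≤ Real.exp (C * s) * ‖w‖ := by
        gcongr; exact w.norm_coe_le_norm s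
      have h5 := mul_le_mul_of_nonneg_left h4 K.coe_nonneg
      have h6 := mul_le_mul_of_nonneg_left h3 (norm_nonneg (G 0))
      nlinarith)
  have hΦ : ContractingWith (K / (K + 1)) Φ := by
    refine ⟨?_, LipschitzWith.of_dist_le_mul fun w w' => ?_⟩
    · rw [div_lt_one (by positivity)]
      exact lt_add_one K
    · rw [BoundedContinuousFunction.dist_le (by positivity)]
      intro t
      have ht : 0 ≤ max t 0 := le_max_right _ _
      have e : dist (Φ w t) (Φ w' t) = Real.exp (-(C * max t 0)) * ‖∫ s in (0 : ℝ)..(max t 0),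
          (G (Real.exp (C * s) • w s) - G (Real.exp (C * s) • w' s))‖ := by
        rw [intervalIntegral.integral_sub (hgi w _ _) (hgi w' _ _), dist_eq_norm]
        simp only [Φ, BoundedContinuousFunction.coe_ofNormedAddCommGroup]
        rw [← smul_sub, add_sub_add_left_eq_sub, norm_smul,
          Real.norm_of_nonneg (Real.exp_nonneg _)]
      rw [e]
      refine (norm_integral_le_exp hC0 ht (M := K * dist w w') (by positivity)
        fun s hs => ?_).trans (le_of_eq ?_)
      · have h1 := hG.dist_le_mul (Real.exp (C * s) • w s) (Real.exp (C * s) • w' s)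
        rw [dist_smul₀, Real.norm_of_nonneg (Real.exp_nonneg _), dist_eq_norm] at h1
        refine h1.trans ?_
        have := BoundedContinuousFunction.dist_coe_le_dist (f := w) (g := w') s
        calc (K : ℝ) * (Real.exp (C * s) * dist (w s) (w' s))
            ≤ K * (Real.exp (C * s) * dist w w') := by gcongr
          _ = _ := by ring
      · push_cast
        rw [hC]
        ring
  set w := ContractingWith.fixedPoint Φ hΦ with hw
  have hfix : Φ w = w := hΦ.fixedPoint_isFixedPt
  -- Defining the solution by the integral for negative `t` as well makes its derivative at `0`
  -- two-sided.
  refine ⟨fun t => y₀ + ∫ s in (0 : ℝ)..t, G (Real.exp (C * s) • w s), by simp, fun t ht => ?_⟩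
  have h1 : w t = Real.exp (-(C * t)) • (y₀ + ∫ s in (0 : ℝ)..t, G (Real.exp (C * s) • w s)) := by
    conv_lhs => rw [← hfix]
    simp [Φ, ht]
  have h2 : Real.exp (C * t) • w t = y₀ + ∫ s in (0 : ℝ)..t, G (Real.exp (C * s) • w s) := by
    conv_lhs => rw [h1]
    rw [smul_smul, ← Real.exp_add]
    simp
  have h3 := (hder w t).const_add y₀
  rw [h2] at h3
  exact h3

end GlobalODE

/-! ### Construction of the quantile flow -/

/-- `X(z, t)` solves the quantile equation with velocity map `w` and initial datum `X₀`; `d` and `N`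
control its increments in time and its size relative to the weight `1 + |X₀|`. -/
structure IsQuantileFlow (V w : ℝ → ℝ) (lam : ℝ) (X₀ : ℝ → ℝ) (X d : ℝ → ℝ → ℝ) (N : ℝ → ℝ) :
    Prop where
  initial : ∀ z, X z 0 = X₀ z
  aestronglyMeasurable : ∀ t, AEStronglyMeasurable (fun z => X z t) unitMass
  hasDerivAt : ∀ z ∈ Ioo (0 : ℝ) 1, ∀ t, 0 ≤ t → HasDerivAt (X z)
    (w (∫ ζ, kernelU V lam (X z t - X ζ t) ∂unitMass - lam * z)) t
  leftContinuous : ∀ z t, Tendsto X₀ (𝓝[<] z) (𝓝 (X₀ z)) →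
    Tendsto (fun z => X z t) (𝓝[<] z) (𝓝 (X z t))
  growth : ∀ z t, |X z t| ≤ N t * (1 + |X₀ z|)
  increment : ∀ z s t, |X z s - X z t| ≤ d s t * (1 + |X₀ z|)
  tendsto_increment : ∀ t, 0 ≤ t → Tendsto (fun s => d s t) (𝓝 t) (𝓝 0)

namespace StandingAssumptions

variable {V v : ℝ → ℝ} {lam b : ℝ}

/-- The flow of quantile functions. It is found as `X(z, t) = (1 + |X₀ z|) y(t)(X₀ z, z)`, where
`X₀` is the initial quantile function and `y` solves a Lipschitz differential equation in the space
of bounded continuous functions on the plane. -/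
theorem exists_quantile_flow (h : StandingAssumptions V v lam b) {w : ℝ → ℝ} {L : ℝ≥0}
    (hw : LipschitzWith L w) {X₀ : ℝ → ℝ} (hX₀ : Integrable X₀ unitMass) :
    ∃ (X d : ℝ → ℝ → ℝ) (N : ℝ → ℝ), IsQuantileFlow V w lam X₀ X d N := by
  set A := lipSeminorm V (Iic 0) with hA
  have hUA : LipschitzWith A (kernelU V lam) := h.lipschitzWith_kernelU
  have hlam := h.lam_pos
  set m₁ : ℝ := ∫ z, (1 + |X₀ z|) ∂unitMass with hm₁
  have hm₁0 : 0 ≤ m₁ := integral_nonneg fun z => by positivity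
  have hmi : Integrable (fun z => 1 + |X₀ z|) unitMass := (integrable_const _).add hX₀.abs
  -- The initial quantile may be unbounded and discontinuous. Dividing by `1 + |X₀|` cures the
  -- first, and treating `(X₀ z, z)` as an independent point of the plane cures the second.
  let e : (ℝ × ℝ →ᵇ ℝ) → ℝ × ℝ → ℝ := fun y q => (1 + |q.1|) * y q
  let Y : (ℝ × ℝ →ᵇ ℝ) → ℝ → ℝ := fun y ζ => e y (X₀ ζ, ζ)
  have hec : ∀ y, Continuous (e y) := fun y =>
    (continuous_const.add (continuous_abs.comp continuous_fst)).mul y.continuous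
  have hYm : ∀ y, AEStronglyMeasurable (Y y) unitMass := fun y =>
    (hec y).comp_aestronglyMeasurable (hX₀.aestronglyMeasurable.prodMk aestronglyMeasurable_id)
  have hed : ∀ y y' q, |e y q - e y' q| ≤ (1 + |q.1|) * dist y y' := fun y y' q => by
    simp only [e]
    rw [← mul_sub, abs_mul, abs_of_nonneg (by positivity)]
    gcongr
    rw [← Real.dist_eq]
    exact BoundedContinuousFunction.dist_coe_le_dist q
  have he0 : ∀ q, e 0 q = 0 := fun q => by simp [e]
  have heb : ∀ y q, |e y q| ≤ (1 + |q.1|) * ‖y‖ := fun y q => by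
    have := hed y 0 q
    rwa [he0, sub_zero, dist_zero_right] at this
  have hYi : ∀ y, Integrable (Y y) unitMass := fun y =>
    (hmi.mul_const ‖y‖).mono' (hYm y) (ae_of_all _ fun ζ => heb y (X₀ ζ, ζ))
  have hYd : ∀ y y', ∫ ζ, |Y y ζ - Y y' ζ| ∂unitMass ≤ m₁ * dist y y' := fun y y' => by
    rw [hm₁, ← integral_mul_const]
    exact integral_mono ((hYi y).sub (hYi y')).abs (hmi.mul_const _) fun ζ => hed y y' (X₀ ζ, ζ)
  -- Points of the plane have arbitrary second coordinate; clamping it to `[0, 1]` keeps the term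
  -- `lam * z` bounded and changes nothing for true mass coordinates.
  let cl : ℝ → ℝ := fun z => max 0 (min z 1)
  have hclc : Continuous cl := continuous_const.max (continuous_id.min continuous_const)
  have hcl0 : ∀ z, 0 ≤ cl z := fun z => le_max_left _ _
  have hcl1 : ∀ z, cl z ≤ 1 := fun z => max_le zero_le_one (min_le_right _ _)
  let a : (ℝ × ℝ →ᵇ ℝ) → ℝ × ℝ → ℝ := fun y q =>
    ∫ ζ, kernelU V lam (e y q - Y y ζ) ∂unitMass - lam * cl q.2
  have had : ∀ y y' q q', |(∫ ζ, kernelU V lam (e y q - Y y ζ) ∂unitMass) -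
      ∫ ζ, kernelU V lam (e y' q' - Y y' ζ) ∂unitMass| ≤
      A * (|e y q - e y' q'| + m₁ * dist y y') := fun y y' q q' =>
    (h.abs_integral_kernelU_sub_le hUA (hYi y) (hYi y') _ _).trans
      (mul_le_mul_of_nonneg_left (add_le_add_right (hYd y y') _) A.coe_nonneg)
  have hac : ∀ y, Continuous (a y) := fun y => by
    refine Continuous.sub ?_ (continuous_const.mul (hclc.comp continuous_snd))
    have h1 : LipschitzWith A fun x => ∫ ζ, kernelU V lam (x - Y y ζ) ∂unitMass :=
      LipschitzWith.of_dist_le_mul fun x x' => by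
        have := h.abs_integral_kernelU_sub_le hUA (hYi y) (hYi y) x x'
        simpa [Real.dist_eq] using this
    exact h1.continuous.comp (hec y)
  have hab : ∀ y q, |a y q| ≤ 2 * lam + A * ((1 + |q.1|) * ‖y‖ + m₁ * ‖y‖) := fun y q => by
    have h1 := had y 0 q q
    have h2 : ∫ ζ, kernelU V lam (e 0 q - Y 0 ζ) ∂unitMass = lam := by
      have : ∀ ζ, Y 0 ζ = 0 := fun ζ => he0 _
      simp [this, he0, h.kernelU_zero]
    rw [h2, he0, sub_zero, dist_zero_right] at h1
    have h3 := mul_le_mul_of_nonneg_left (add_le_add_left (heb y q) (m₁ * ‖y‖)) A.coe_nonneg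
    have h4 := hcl0 q.2
    have h5 := hcl1 q.2
    have h6 : 0 ≤ lam * cl q.2 := mul_nonneg hlam.le h4
    have h7 : lam * cl q.2 ≤ lam := mul_le_of_le_one_right hlam.le h5
    simp only [a]
    rw [abs_le] at h1 ⊢
    constructor <;> linarith
  have hwt : ∀ q : ℝ × ℝ, 0 < 1 + |q.1| := fun q => by positivity
  -- The vector field in the rescaled unknown. The velocity grows at most linearly in `|q.1|`, so
  -- dividing by the weight returns a bounded function.
  let G : (ℝ × ℝ →ᵇ ℝ) → (ℝ × ℝ →ᵇ ℝ) := fun y =>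
    BoundedContinuousFunction.ofNormedAddCommGroup (fun q => (1 + |q.1|)⁻¹ * w (a y q))
      (((continuous_const.add (continuous_abs.comp continuous_fst)).inv₀ fun q => (hwt q).ne').mul
        (hw.continuous.comp (hac y)))
      (|w 0| + L * (2 * lam + A * (‖y‖ + m₁ * ‖y‖)))
      (by
        intro q
        have h1 := hw.dist_le_mul (a y q) 0
        rw [Real.dist_eq, Real.dist_eq, sub_zero] at h1
        have h2 := abs_sub_abs_le_abs_sub (w (a y q)) (w 0)
        have h3 := mul_le_mul_of_nonneg_left (hab y q) L.coe_nonneg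
        rw [norm_mul, norm_inv, Real.norm_of_nonneg (hwt q).le, Real.norm_eq_abs,
          inv_mul_le_iff₀ (hwt q)]
        have hq := abs_nonneg q.1
        have hw0 := abs_nonneg (w 0)
        calc |w (a y q)| ≤ |w 0| + L * (2 * lam + A * ((1 + |q.1|) * ‖y‖ + m₁ * ‖y‖)) := by
              linarith
          _ ≤ (1 + |q.1|) * |w 0| + L * ((1 + |q.1|) * (2 * lam) +
              A * ((1 + |q.1|) * ‖y‖ + (1 + |q.1|) * (m₁ * ‖y‖))) := by
              have hone : 1 ≤ 1 + |q.1| := by linarith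
              have k1 : |w 0| ≤ (1 + |q.1|) * |w 0| := le_mul_of_one_le_left hw0 hone
              have k2 : 2 * lam ≤ (1 + |q.1|) * (2 * lam) :=
                le_mul_of_one_le_left (by linarith) hone
              have k3 : m₁ * ‖y‖ ≤ (1 + |q.1|) * (m₁ * ‖y‖) :=
                le_mul_of_one_le_left (by positivity) hone
              gcongr
          _ = _ := by ring)
  have hG : LipschitzWith (L * (A * (1 + m₁.toNNReal))) G := by
    refine LipschitzWith.of_dist_le_mul fun y y' => ?_
    rw [BoundedContinuousFunction.dist_le (by positivity)]
    intro q
    have h1 := hw.dist_le_mul (a y q) (a y' q)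
    have h2 := had y y' q q
    have h3 : dist (a y q) (a y' q) = |(∫ ζ, kernelU V lam (e y q - Y y ζ) ∂unitMass) -
        ∫ ζ, kernelU V lam (e y' q - Y y' ζ) ∂unitMass| := by
      rw [Real.dist_eq]; simp only [a]; rw [sub_sub_sub_cancel_right]
    have hq := abs_nonneg q.1
    have e1 : dist (G y q) (G y' q) = (1 + |q.1|)⁻¹ * dist (w (a y q)) (w (a y' q)) := by
      simp only [G, BoundedContinuousFunction.coe_ofNormedAddCommGroup]
      rw [Real.dist_eq, Real.dist_eq, ← mul_sub, abs_mul, abs_of_nonneg (inv_nonneg.2 (hwt q).le)]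
    rw [e1, inv_mul_le_iff₀ (hwt q)]
    push_cast
    rw [Real.coe_toNNReal _ hm₁0]
    calc dist (w (a y q)) (w (a y' q)) ≤ L * dist (a y q) (a y' q) := h1
      _ ≤ L * (A * ((1 + |q.1|) * dist y y' + (1 + |q.1|) * (m₁ * dist y y'))) := by
          rw [h3]
          have k3 : m₁ * dist y y' ≤ (1 + |q.1|) * (m₁ * dist y y') :=
            le_mul_of_one_le_left (by positivity) (by linarith)
          refine mul_le_mul_of_nonneg_left (h2.trans ?_) L.coe_nonneg
          have := hed y y' q
          gcongr
      _ = _ := by ring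
  let y₀ : ℝ × ℝ →ᵇ ℝ := BoundedContinuousFunction.ofNormedAddCommGroup
    (fun q => (1 + |q.1|)⁻¹ * q.1)
    (((continuous_const.add (continuous_abs.comp continuous_fst)).inv₀ fun q => (hwt q).ne').mul
        continuous_fst) 1
    (by
      intro q
      rw [norm_mul, norm_inv, Real.norm_of_nonneg (hwt q).le, Real.norm_eq_abs,
        inv_mul_le_iff₀ (hwt q)]
      linarith)
  obtain ⟨y, hy0, hy⟩ := exists_global_solution hG y₀
  -- Size and increments of `X` are those of `y` in the supremum norm times the weight, whence `N t
  -- = ‖y t‖` and `d s t = dist (y s) (y t)`.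
  refine ⟨fun z t => Y (y t) z, fun s t => dist (y s) (y t), fun t => ‖y t‖, ⟨fun z => ?_,
    fun t => hYm (y t), fun z hz t ht => ?_, fun z t hz => ?_, fun z t => ?_, fun z s t => ?_,
    fun t ht => ?_⟩⟩
  · simp only [Y, e, hy0, y₀, BoundedContinuousFunction.coe_ofNormedAddCommGroup]
    rw [mul_inv_cancel_left₀ (hwt (X₀ z, z)).ne']
  · have h1 := ((BoundedContinuousFunction.evalCLM ℝ (X₀ z, z)).hasFDerivAt.comp_hasDerivAt t
      (hy t ht)).const_mul (1 + |X₀ z|)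
    have hcz : cl z = z := by simp [cl, hz.1.le, hz.2.le]
    have h2 : (1 + |X₀ z|) * (BoundedContinuousFunction.evalCLM ℝ (X₀ z, z)) (G (y t)) =
        w (∫ ζ, kernelU V lam (Y (y t) z - Y (y t) ζ) ∂unitMass - lam * z) := by
      change (1 + |X₀ z|) * ((1 + |X₀ z|)⁻¹ * w (a (y t) (X₀ z, z))) = _
      rw [mul_inv_cancel_left₀ (hwt (X₀ z, z)).ne']
      simp only [a, hcz]
      rfl
    exact h1.congr_deriv h2
  · have h1 : Tendsto (fun z => (X₀ z, z)) (𝓝[<] z) (𝓝 (X₀ z, z)) :=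
      hz.prodMk_nhds (tendsto_id.mono_left nhdsWithin_le_nhds)
    exact ((hec (y t)).tendsto _).comp h1
  · rw [mul_comm]; exact heb (y t) (X₀ z, z)
  · rw [mul_comm]; exact hed (y s) (y t) (X₀ z, z)
  · exact tendsto_iff_dist_tendsto_zero.1 (hy t ht).continuousAt

end StandingAssumptions

/-! ### Separation of quantiles and the resulting density bound -/

/-- The solution of `Q' = 1 - K Q`, `Q(0) = 0`. -/
noncomputable def separationProfile (K t : ℝ) : ℝ :=
  if K = 0 then t else (1 - Real.exp (-K * t)) / K

theorem separationProfile_zero (K : ℝ) : separationProfile K 0 = 0 := by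
  simp [separationProfile]

theorem hasDerivAt_separationProfile (K t : ℝ) :
    HasDerivAt (separationProfile K) (1 - K * separationProfile K t) t := by
  unfold separationProfile
  by_cases hK : K = 0
  · simpa [hK] using hasDerivAt_id' t
  · simp only [hK, if_false]
    have h1 : HasDerivAt (fun t => -K * t) (-K) t := by
      simpa using (hasDerivAt_id t).const_mul (-K)
    have h2 := (h1.exp.const_sub 1).div_const K
    refine h2.congr_deriv ?_
    field_simp
    ring

theorem separationProfile_pos {K t : ℝ} (hK : 0 ≤ K) (ht : 0 < t) : 0 < separationProfile K t := by
  unfold separationProfile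
  split_ifs with h
  · exact ht
  · have hK' : 0 < K := lt_of_le_of_ne hK (Ne.symm h)
    refine div_pos (sub_pos.2 (Real.exp_lt_one_iff.2 ?_)) hK'
    have := mul_pos hK' ht
    linarith

theorem separationProfile_mono {K s t : ℝ} (hK : 0 ≤ K) (hst : s ≤ t) :
    separationProfile K s ≤ separationProfile K t := by
  unfold separationProfile
  split_ifs with h
  · exact hst
  · have h1 : -K * t ≤ -K * s := by nlinarith
    have h2 := Real.exp_le_exp.2 h1
    exact div_le_div_of_nonneg_right (by linarith) hK

/-- If the argument of `w` decreases, `hdec` gives the gain `b lam (z₂ - z₁)`. If it increases, the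
`P` term has outweighed `lam (z₂ - z₁)`, and the Lipschitz bound suffices because `b ≤ L`. -/
theorem velocity_sub_ge {w : ℝ → ℝ} {L A : ℝ≥0} {b lam : ℝ} (hw : LipschitzWith L w)
    (hdec : ∀ r₁ r₂, r₁ ≤ r₂ → w r₂ - w r₁ ≤ -b * (r₂ - r₁)) (hb : 0 ≤ b) (hbL : b ≤ L)
    (hlam : 0 ≤ lam) {P₁ P₂ z₁ z₂ D : ℝ} (hP : |P₂ - P₁| ≤ A * D) (hz : z₁ ≤ z₂) :
    b * lam * (z₂ - z₁) - L * A * D ≤ w (P₂ - lam * z₂) - w (P₁ - lam * z₁) := by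
  have hΔ : 0 ≤ lam * (z₂ - z₁) := mul_nonneg hlam (by linarith)
  have h0 : 0 ≤ (A : ℝ) * D := (abs_nonneg _).trans hP
  have hLA : (L : ℝ) * (P₂ - P₁) ≤ L * (A * D) :=
    mul_le_mul_of_nonneg_left ((le_abs_self _).trans hP) L.coe_nonneg
  have hbA : b * (P₂ - P₁) ≤ L * (A * D) :=
    (mul_le_mul_of_nonneg_left ((le_abs_self _).trans hP) hb).trans
      (mul_le_mul_of_nonneg_right hbL h0)
  rcases le_total (P₂ - lam * z₂) (P₁ - lam * z₁) with hle | hle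
  · have := hdec _ _ hle
    nlinarith
  · have h1 := hw.dist_le_mul (P₂ - lam * z₂) (P₁ - lam * z₁)
    rw [Real.dist_eq, Real.dist_eq, abs_of_nonneg (sub_nonneg.2 hle)] at h1
    have h2 := neg_abs_le (w (P₂ - lam * z₂) - w (P₁ - lam * z₁))
    have h3 := mul_le_mul_of_nonneg_right hbL hΔ
    nlinarith

/-- A nonnegatively started difference with `D' ≥ c - K |D|` dominates the separation profile. -/
theorem separationProfile_le_of_deriv_ge {D D' : ℝ → ℝ} {c K : ℝ} (hc : 0 < c)
    (hD : ∀ t, 0 ≤ t → HasDerivAt D (D' t) t) (h0 : 0 ≤ D 0)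
    (hD' : ∀ t, 0 ≤ t → c - K * |D t| ≤ D' t) {t : ℝ} (ht : 0 ≤ t) :
    c * separationProfile K t ≤ D t := by
  have hnn : ∀ s, 0 ≤ s → 0 ≤ D s := by
    intro s hs
    -- Zero is a strict barrier: wherever `D` vanishes, `D' ≥ c > 0`. Positivity then removes the
    -- absolute value.
    have := image_le_of_deriv_right_lt_deriv_boundary (f := fun t => -D t) (f' := fun t => -D' t)
      (a := 0) (b := s) (B := fun _ => 0) (B' := fun _ => 0)
      (fun x hx => (hD x hx.1).neg.continuousAt.continuousWithinAt)
      (fun x hx => (hD x hx.1).neg.hasDerivWithinAt) (by simpa using h0)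
      (fun x => hasDerivAt_const x 0) (fun x hx hx0 => by
        have h1 : D x = 0 := by simpa using hx0
        have h2 := hD' x hx.1
        rw [h1] at h2
        simp only [abs_zero, mul_zero, sub_zero] at h2
        linarith) (right_mem_Icc.2 hs)
    simpa using this
  set R : ℝ → ℝ := fun t => D t - c * separationProfile K t with hR
  have hE : ∀ s, HasDerivAt (fun s => Real.exp (K * s)) (K * Real.exp (K * s)) s := fun s => by
    have h1 : HasDerivAt (fun s => K * s) K s := by
      simpa using (hasDerivAt_id s).const_mul K
    exact h1.exp.congr_deriv (mul_comm _ _)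
  -- With the integrating factor the derivative becomes `exp(K s) (D' - (c - K D))`, which is
  -- nonnegative.
  have hRd : ∀ s, 0 ≤ s → HasDerivAt (fun s => Real.exp (K * s) * R s)
      (K * Real.exp (K * s) * R s + Real.exp (K * s) *
        (D' s - c * (1 - K * separationProfile K s))) s := fun s hs =>
    (hE s).mul ((hD s hs).sub ((hasDerivAt_separationProfile K s).const_mul c))
  have hmv := Convex.mul_sub_le_image_sub_of_le_deriv (convex_Icc 0 t)
    (f := fun s => Real.exp (K * s) * R s) (C := 0)
    (fun s hs => (hRd s hs.1).continuousAt.continuousWithinAt)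
    (fun s hs => (hRd s (interior_subset hs).1).differentiableAt.differentiableWithinAt)
    (fun s hs => by
      have hs0 : 0 ≤ s := (interior_subset hs).1
      rw [(hRd s hs0).deriv]
      have h1 := hD' s hs0
      rw [abs_of_nonneg (hnn s hs0)] at h1
      have h2 : K * Real.exp (K * s) * R s + Real.exp (K * s) *
        (D' s - c * (1 - K * separationProfile K s)) =
        Real.exp (K * s) * (D' s - (c - K * D s)) := by simp only [hR]; ring
      rw [h2]
      exact mul_nonneg (Real.exp_nonneg _) (by linarith))
    0 (left_mem_Icc.2 ht) t (right_mem_Icc.2 ht) ht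
  simp only [zero_mul, hR, separationProfile_zero, mul_zero, Real.exp_zero, sub_zero, one_mul] at hmv
  have h3 : 0 ≤ Real.exp (K * t) * (D t - c * separationProfile K t) := by linarith
  have h4 := nonneg_of_mul_nonneg_right h3 (Real.exp_pos _)
  linarith

/-- The law of an expanding function of the mass coordinate has a bounded density. -/
theorem map_unitMass_le_of_separated {X : ℝ → ℝ} (hXm : AEMeasurable X unitMass) {k : ℝ}
    (hk : 0 < k)
    (hX : ∀ z₁ ∈ Ioo (0 : ℝ) 1, ∀ z₂ ∈ Ioo (0 : ℝ) 1, z₁ < z₂ → k * (z₂ - z₁) ≤ X z₂ - X z₁) :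
    unitMass.map X ≤ ENNReal.ofReal k⁻¹ • volume := by
  rw [Measure.le_iff]
  intro s hs
  rw [Measure.map_apply_of_aemeasurable hXm hs, Measure.smul_apply, smul_eq_mul]
  -- Expansion by `k` makes the inverse `k⁻¹`-Lipschitz, so preimages have at most `k⁻¹` times the
  -- one-dimensional Hausdorff measure, that is, Lebesgue measure.
  have hanti : AntilipschitzWith k⁻¹.toNNReal (fun z : Ioo (0 : ℝ) 1 => X z) := by
    refine AntilipschitzWith.of_le_mul_dist fun z₁ z₂ => ?_
    rw [Real.coe_toNNReal _ (inv_nonneg.2 hk.le), ← div_eq_inv_mul, le_div_iff₀ hk, Subtype.dist_eq,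
      Real.dist_eq, Real.dist_eq]
    rcases lt_trichotomy (z₁ : ℝ) z₂ with hlt | heq | hlt
    · have := hX z₁ z₁.2 z₂ z₂.2 hlt
      rw [abs_sub_comm, abs_of_pos (sub_pos.2 hlt), abs_sub_comm (X z₁)]
      linarith [le_abs_self (X z₂ - X z₁)]
    · simp [heq]
    · have := hX z₂ z₂.2 z₁ z₁.2 hlt
      rw [abs_of_pos (sub_pos.2 hlt)]
      linarith [le_abs_self (X z₁ - X z₂)]
  have h1 := hanti.hausdorffMeasure_preimage_le zero_le_one s
  rw [← (isometry_subtype_coe (s := Ioo (0 : ℝ) 1)).hausdorffMeasure_image (Or.inl zero_le_one)] at h1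
  have h2 : Subtype.val '' ((fun z : Ioo (0 : ℝ) 1 => X z) ⁻¹' s) = X ⁻¹' s ∩ Ioo 0 1 := by
    ext z; simp [and_comm]
  rw [h2, hausdorffMeasure_real, ENNReal.rpow_one] at h1
  rw [unitMass_eq_Ioo, Measure.restrict_apply' measurableSet_Ioo]
  exact h1

theorem densityNorm_le_of_le_smul {μ : Measure ℝ} [IsFiniteMeasure μ] {c : ℝ≥0∞}
    (h : μ ≤ c • volume) : densityNorm μ ≤ c := by
  refine essSup_le_of_ae_le c ?_
  refine ae_le_of_forall_setLIntegral_le_of_sigmaFinite (Measure.measurable_rnDeriv μ volume)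
    fun s hs _ => ?_
  calc ∫⁻ x in s, μ.rnDeriv volume x ≤ μ s := Measure.setLIntegral_rnDeriv_le s
    _ ≤ (c • volume) s := h s
    _ = ∫⁻ _ in s, c := by simp

theorem hasBoundedDensity_of_le_smul {μ : Measure ℝ} [IsFiniteMeasure μ] {c : ℝ≥0∞} (hc : c ≠ ∞)
    (h : μ ≤ c • volume) : HasBoundedDensity μ :=
  ⟨(Measure.absolutelyContinuous_of_le h).trans (Measure.smul_absolutelyContinuous),
    (densityNorm_le_of_le_smul h).trans_lt hc.lt_top⟩

/-! ### The measure-valued curve generated by a quantile flow -/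

namespace IsQuantileFlow

variable {V v w : ℝ → ℝ} {lam b : ℝ} {X₀ : ℝ → ℝ} {X d : ℝ → ℝ → ℝ} {N : ℝ → ℝ}

theorem weight_integrable (hX₀ : Integrable X₀ unitMass) :
    Integrable (fun z => 1 + |X₀ z|) unitMass :=
  (integrable_const _).add hX₀.abs

theorem integrable (F : IsQuantileFlow V w lam X₀ X d N) (hX₀ : Integrable X₀ unitMass) (t : ℝ) :
    Integrable (fun z => X z t) unitMass :=
  ((weight_integrable hX₀).const_mul (N t)).mono' (F.aestronglyMeasurable t)
    (ae_of_all _ fun z => F.growth z t)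

/-- The regularising mechanism: the term `-lam * z` pushes different labels apart at rate `b lam (z₂
- z₁)`, and the Lipschitz part resists with at most `L A` times their distance. -/
theorem separation (F : IsQuantileFlow V w lam X₀ X d N) (h : StandingAssumptions V v lam b)
    (hX₀ : Integrable X₀ unitMass) (hmono : MonotoneOn X₀ (Ioo 0 1)) {L A : ℝ≥0}
    (hw : LipschitzWith L w) (hbL : b ≤ L)
    (hdec : ∀ r₁ r₂, r₁ ≤ r₂ → w r₂ - w r₁ ≤ -b * (r₂ - r₁))
    (hA : LipschitzWith A (kernelU V lam)) {z₁ z₂ t : ℝ} (hz₁ : z₁ ∈ Ioo (0 : ℝ) 1)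
    (hz₂ : z₂ ∈ Ioo (0 : ℝ) 1) (hz : z₁ < z₂) (ht : 0 ≤ t) :
    b * lam * (z₂ - z₁) * separationProfile (L * A) t ≤ X z₂ t - X z₁ t := by
  have hc : 0 < b * lam * (z₂ - z₁) := mul_pos (mul_pos h.b_pos h.lam_pos) (sub_pos.2 hz)
  refine separationProfile_le_of_deriv_ge (D := fun t => X z₂ t - X z₁ t) hc
    (fun s hs => (F.hasDerivAt z₂ hz₂ s hs).sub (F.hasDerivAt z₁ hz₁ s hs)) ?_ (fun s hs => ?_) ht
  · simp only [F.initial]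
    exact sub_nonneg.2 (hmono hz₁ hz₂ hz.le)
  · have hi := F.integrable hX₀ s
    have h1 := h.abs_integral_kernelU_sub_le hA hi hi (X z₂ s) (X z₁ s)
    simp only [sub_self, abs_zero, integral_zero, add_zero] at h1
    exact velocity_sub_ge hw hdec h.b_pos.le hbL h.lam_pos.le h1 hz.le

theorem aestronglyMeasurable_velocity (F : IsQuantileFlow V w lam X₀ X d N)
    (h : StandingAssumptions V v lam b) (hX₀ : Integrable X₀ unitMass) {L : ℝ≥0}
    (hw : LipschitzWith L w) (t : ℝ) : AEStronglyMeasurable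
    (fun z => w (∫ ζ, kernelU V lam (X z t - X ζ t) ∂unitMass - lam * z)) unitMass := by
  have hi := F.integrable hX₀ t
  have h1 : LipschitzWith (lipSeminorm V (Iic 0))
      fun x => ∫ ζ, kernelU V lam (x - X ζ t) ∂unitMass := LipschitzWith.of_dist_le_mul fun x x' => by
    have := h.abs_integral_kernelU_sub_le h.lipschitzWith_kernelU hi hi x x'
    simpa [Real.dist_eq] using this
  exact hw.continuous.comp_aestronglyMeasurable
    ((h1.continuous.comp_aestronglyMeasurable (F.aestronglyMeasurable t)).sub
      (aestronglyMeasurable_id.const_mul lam))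

theorem integral_abs_sub_le (F : IsQuantileFlow V w lam X₀ X d N)
    (hX₀ : Integrable X₀ unitMass) (s t : ℝ) :
    ∫ ζ, |X ζ s - X ζ t| ∂unitMass ≤ d s t * ∫ ζ, (1 + |X₀ ζ|) ∂unitMass := by
  rw [← integral_const_mul]
  exact integral_mono ((F.integrable hX₀ s).sub (F.integrable hX₀ t)).abs
    ((weight_integrable hX₀).const_mul _) fun ζ => F.increment ζ s t

theorem tendsto_velocity (F : IsQuantileFlow V w lam X₀ X d N)
    (h : StandingAssumptions V v lam b) (hX₀ : Integrable X₀ unitMass) {L : ℝ≥0}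
    (hw : LipschitzWith L w) (z : ℝ) {t : ℝ} (ht : 0 ≤ t) :
    Tendsto (fun s => w (∫ ζ, kernelU V lam (X z s - X ζ s) ∂unitMass - lam * z)) (𝓝 t)
      (𝓝 (w (∫ ζ, kernelU V lam (X z t - X ζ t) ∂unitMass - lam * z))) := by
  refine (hw.continuous.tendsto _).comp (Tendsto.sub_const ?_ _)
  refine tendsto_iff_dist_tendsto_zero.2 (squeeze_zero (fun _ => dist_nonneg) (fun s => ?_)
    (g := fun s => (lipSeminorm V (Iic 0) : ℝ) *
      (d s t * (1 + |X₀ z|) + d s t * ∫ ζ, (1 + |X₀ ζ|) ∂unitMass)) ?_)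
  · rw [Real.dist_eq]
    refine (h.abs_integral_kernelU_sub_le h.lipschitzWith_kernelU (F.integrable hX₀ s)
      (F.integrable hX₀ t) _ _).trans (mul_le_mul_of_nonneg_left (add_le_add (F.increment z s t)
        (F.integral_abs_sub_le hX₀ s t)) (NNReal.coe_nonneg _))
  · have hd := F.tendsto_increment t ht
    simpa using ((hd.mul_const (1 + |X₀ z|)).add
      (hd.mul_const (∫ ζ, (1 + |X₀ ζ|) ∂unitMass))).const_mul (lipSeminorm V (Iic 0) : ℝ)

theorem exists_velocity_bound (F : IsQuantileFlow V w lam X₀ X d N)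
    (h : StandingAssumptions V v lam b) (hX₀ : Integrable X₀ unitMass) {L : ℝ≥0}
    (hw : LipschitzWith L w) {t : ℝ} (ht : 0 ≤ t) :
    ∃ g : ℝ → ℝ, Integrable g unitMass ∧ ∀ᶠ s in 𝓝 t, ∀ z ∈ Ioo (0 : ℝ) 1,
      |w (∫ ζ, kernelU V lam (X z s - X ζ s) ∂unitMass - lam * z)| ≤ g z := by
  set A := lipSeminorm V (Iic 0) with hA
  set m := ∫ ζ, (1 + |X₀ ζ|) ∂unitMass with hm
  refine ⟨fun z => |w 0| + L * (2 * lam + A * ((N t + 1) * (1 + |X₀ z|) + (N t + 1) * m)),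
    ?_, ?_⟩
  · exact (integrable_const _).add (((integrable_const _).add
      ((((weight_integrable hX₀).const_mul _).add (integrable_const _)).const_mul _)).const_mul _)
  · filter_upwards [(F.tendsto_increment t ht).eventually_lt_const one_pos] with s hs z hz
    -- The extra `1` absorbs the increment between nearby times, where `d s t < 1`.
    have hX : ∀ z, |X z s| ≤ (N t + 1) * (1 + |X₀ z|) := fun z => by
      have h1 := F.increment z s t
      have h2 := F.growth z t
      have h3 := abs_sub_abs_le_abs_sub (X z s) (X z t)
      have h4 : d s t * (1 + |X₀ z|) ≤ 1 * (1 + |X₀ z|) := by gcongr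
      linarith
    have hI : ∫ ζ, |X ζ s| ∂unitMass ≤ (N t + 1) * m := by
      rw [hm, ← integral_const_mul]
      exact integral_mono (F.integrable hX₀ s).abs ((weight_integrable hX₀).const_mul _) hX
    have h1 := h.abs_integral_kernelU_sub_le h.lipschitzWith_kernelU (F.integrable hX₀ s)
      (Y := fun _ => 0) (integrable_zero ℝ ℝ unitMass) (X z s) 0
    simp only [sub_zero, h.kernelU_zero, integral_const, probReal_univ, one_smul] at h1
    have h2 := hw.dist_le_mul (∫ ζ, kernelU V lam (X z s - X ζ s) ∂unitMass - lam * z) 0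
    rw [Real.dist_eq, Real.dist_eq, sub_zero] at h2
    have h3 := abs_sub_abs_le_abs_sub
      (w (∫ ζ, kernelU V lam (X z s - X ζ s) ∂unitMass - lam * z)) (w 0)
    have h4 : |∫ ζ, kernelU V lam (X z s - X ζ s) ∂unitMass - lam * z| ≤
        2 * lam + A * ((N t + 1) * (1 + |X₀ z|) + (N t + 1) * m) := by
      have h5 := mul_le_mul_of_nonneg_left (add_le_add (hX z) hI) A.coe_nonneg
      have h6 : 0 ≤ lam * z := mul_nonneg h.lam_pos.le hz.1.le
      have h7 : lam * z ≤ lam := mul_le_of_le_one_right h.lam_pos.le hz.2.le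
      rw [abs_le] at h1 ⊢
      have := h.lam_pos
      constructor <;> linarith
    have h5 := mul_le_mul_of_nonneg_left h4 L.coe_nonneg
    linarith

/-- The weak formulation in mass coordinates. -/
theorem weak_equation (F : IsQuantileFlow V w lam X₀ X d N)
    (h : StandingAssumptions V v lam b) (hX₀ : Integrable X₀ unitMass) {L : ℝ≥0}
    (hw : LipschitzWith L w) {φ : ℝ × ℝ → ℝ} (hφ : ContDiff ℝ 1 φ) (hφc : HasCompactSupport φ)
    (hφs : tsupport φ ⊆ univ ×ˢ Ioi (0 : ℝ)) :
    (∫ t in Ioi (0 : ℝ), ∫ z, fderiv ℝ φ (X z t, t) (0, 1) ∂unitMass) +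
      (∫ t in Ioi (0 : ℝ), ∫ z, w (∫ ζ, kernelU V lam (X z t - X ζ t) ∂unitMass - lam * z) *
        fderiv ℝ φ (X z t, t) (1, 0) ∂unitMass) = 0 := by
  have hct : Continuous fun q => fderiv ℝ φ q (0, 1) :=
    IsDissipativeSolution.continuous_fderiv_apply' hφ _
  have hcx : Continuous fun q => fderiv ℝ φ q (1, 0) :=
    IsDissipativeSolution.continuous_fderiv_apply' hφ _
  have hz : ∀ (u : ℝ × ℝ) q, q ∉ tsupport φ → fderiv ℝ φ q u = 0 := fun u q hq => by
    rw [image_eq_zero_of_notMem_tsupport fun hcon => hq (tsupport_fderiv_subset ℝ hcon)]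
    simp
  have hcs : ∀ u : ℝ × ℝ, HasCompactSupport fun q => fderiv ℝ φ q u := fun u =>
    HasCompactSupport.of_support_subset_isCompact hφc fun q hq => by
      by_contra hcon
      exact hq (hz u q hcon)
  obtain ⟨B, hB⟩ := hφc.exists_bound_of_continuous hφ.continuous
  obtain ⟨Bt, hBt⟩ := (hcs (0, 1)).exists_bound_of_continuous hct
  obtain ⟨Bx, hBx⟩ := (hcs (1, 0)).exists_bound_of_continuous hcx
  have hBx0 : 0 ≤ Bx := (norm_nonneg _).trans (hBx 0)
  obtain ⟨T, hT⟩ := hφc.isBounded.subset_closedBall (0 : ℝ × ℝ)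
  have hT' : ∀ x t, T < t → (x, t) ∉ tsupport φ := fun x t ht hcon => by
    have := hT hcon
    rw [Metric.mem_closedBall, Prod.dist_eq] at this
    have h2 := (le_max_right _ _).trans this
    rw [Real.dist_eq] at h2
    have := le_abs_self (t - (0 : ℝ × ℝ).2)
    simp at this h2
    linarith
  set vel : ℝ → ℝ → ℝ := fun z t =>
    w (∫ ζ, kernelU V lam (X z t - X ζ t) ∂unitMass - lam * z) with hvel
  have hpair : ∀ s, AEStronglyMeasurable (fun z => (X z s, s)) unitMass := fun s =>
    (F.aestronglyMeasurable s).prodMk aestronglyMeasurable_const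
  have hXc : ∀ z ∈ Ioo (0 : ℝ) 1, ∀ t, 0 ≤ t → ContinuousAt (fun s => (X z s, s)) t :=
    fun z hz t ht => (F.hasDerivAt z hz t ht).continuousAt.prodMk continuousAt_id
  have hvm := F.aestronglyMeasurable_velocity h hX₀ hw
  have c0 : ∀ t, 0 ≤ t → ContinuousAt (fun s => ∫ z, φ (X z s, s) ∂unitMass) t := fun t ht => by
    refine continuousAt_of_dominated (bound := fun _ => B) (Eventually.of_forall fun s =>
      hφ.continuous.comp_aestronglyMeasurable (hpair s)) (Eventually.of_forall fun s =>
      ae_of_all _ fun z => hB _) (integrable_const _) ?_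
    filter_upwards [ae_unitMass_mem_Ioo] with z hz
    exact hφ.continuous.continuousAt.comp (hXc z hz t ht)
  have c1 : ∀ t, 0 ≤ t →
      ContinuousAt (fun s => ∫ z, fderiv ℝ φ (X z s, s) (0, 1) ∂unitMass) t := fun t ht => by
    refine continuousAt_of_dominated (bound := fun _ => Bt) (Eventually.of_forall fun s =>
      hct.comp_aestronglyMeasurable (hpair s)) (Eventually.of_forall fun s =>
      ae_of_all _ fun z => hBt _) (integrable_const _) ?_
    filter_upwards [ae_unitMass_mem_Ioo] with z hz
    exact hct.continuousAt.comp (f := fun s => (X z s, s)) (hXc z hz t ht)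
  have c2 : ∀ t, 0 ≤ t →
      ContinuousAt (fun s => ∫ z, vel z s * fderiv ℝ φ (X z s, s) (1, 0) ∂unitMass) t := by
    intro t ht
    obtain ⟨g, hg, hgb⟩ := F.exists_velocity_bound h hX₀ hw ht
    refine continuousAt_of_dominated (bound := fun z => g z * Bx) (Eventually.of_forall fun s =>
      (hvm s).mul (hcx.comp_aestronglyMeasurable (hpair s))) ?_ (hg.mul_const _) ?_
    · filter_upwards [hgb] with s hs
      filter_upwards [ae_unitMass_mem_Ioo] with z hz
      rw [norm_mul]
      exact mul_le_mul (hs z hz) (hBx _) (norm_nonneg _) ((abs_nonneg _).trans (hs z hz))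
    · filter_upwards [ae_unitMass_mem_Ioo] with z hz
      exact ContinuousAt.mul (F.tendsto_velocity h hX₀ hw z ht)
        (hcx.continuousAt.comp (f := fun s => (X z s, s)) (hXc z hz t ht))
  have hint : ∀ {I : ℝ → ℝ}, (∀ t, 0 ≤ t → ContinuousAt I t) → (∀ t, T < t → I t = 0) →
      IntegrableOn I (Ioi 0) := fun {I} hI hI0 => by
    have h1 : IntegrableOn I (Icc 0 T) :=
      ContinuousOn.integrableOn_Icc fun t ht => (hI t ht.1).continuousWithinAt
    refine h1.of_forall_sdiff_eq_zero measurableSet_Ioi fun t ht => hI0 t ?_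
    by_contra hcon
    exact ht.2 ⟨(mem_Ioi.1 ht.1).le, not_lt.1 hcon⟩
  have i1 := hint c1 fun t ht => by simp [hz (0, 1) _ (hT' _ t ht)]
  have i2 := hint c2 fun t ht => by simp [hz (1, 0) _ (hT' _ t ht)]
  have hder : ∀ t ∈ Ioi (0 : ℝ), HasDerivAt (fun s => ∫ z, φ (X z s, s) ∂unitMass)
      (∫ z, fderiv ℝ φ (X z t, t) (0, 1) ∂unitMass +
        ∫ z, vel z t * fderiv ℝ φ (X z t, t) (1, 0) ∂unitMass) t := by
    intro t ht
    obtain ⟨g, hg, hgb⟩ := F.exists_velocity_bound h hX₀ hw (le_of_lt ht)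
    have j1 : Integrable (fun z => fderiv ℝ φ (X z t, t) (0, 1)) unitMass :=
      (integrable_const Bt).mono' (hct.comp_aestronglyMeasurable (hpair t))
        (ae_of_all _ fun z => hBt _)
    have hb : ∀ᶠ s in 𝓝 t, ∀ z ∈ Ioo (0 : ℝ) 1,
        ‖fderiv ℝ φ (X z s, s) (0, 1) + vel z s * fderiv ℝ φ (X z s, s) (1, 0)‖ ≤
          Bt + g z * Bx := by
      filter_upwards [hgb] with s hs z hz
      refine (norm_add_le _ _).trans (add_le_add (hBt _) ?_)
      rw [norm_mul]
      exact mul_le_mul (hs z hz) (hBx _) (norm_nonneg _) ((abs_nonneg _).trans (hs z hz))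
    have j2 : Integrable (fun z => vel z t * fderiv ℝ φ (X z t, t) (1, 0)) unitMass := by
      refine (hg.mul_const Bx).mono' ((hvm t).mul (hcx.comp_aestronglyMeasurable (hpair t))) ?_
      filter_upwards [ae_unitMass_mem_Ioo] with z hz
      have hs := hgb.self_of_nhds
      rw [norm_mul]
      exact mul_le_mul (hs z hz) (hBx _) (norm_nonneg _) ((abs_nonneg _).trans (hs z hz))
    rw [← integral_add j1 j2]
    refine (hasDerivAt_integral_of_dominated_loc_of_deriv_le
      (F := fun s z => φ (X z s, s))
      (F' := fun s z => fderiv ℝ φ (X z s, s) (0, 1) + vel z s * fderiv ℝ φ (X z s, s) (1, 0))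
      (bound := fun z => Bt + g z * Bx) (s := {s | 0 < s ∧ ∀ z ∈ Ioo (0 : ℝ) 1,
        ‖fderiv ℝ φ (X z s, s) (0, 1) + vel z s * fderiv ℝ φ (X z s, s) (1, 0)‖ ≤
          Bt + g z * Bx}) ((lt_mem_nhds ht).and hb)
      (Eventually.of_forall fun s => hφ.continuous.comp_aestronglyMeasurable (hpair s)) ?_
      (j1.add j2).aestronglyMeasurable ?_ ((integrable_const _).add (hg.mul_const _)) ?_).2
    · exact (integrable_const B).mono' (hφ.continuous.comp_aestronglyMeasurable (hpair t))
        (ae_of_all _ fun z => hB _)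
    · filter_upwards [ae_unitMass_mem_Ioo] with z hz s hs
      exact hs.2 z hz
    · filter_upwards [ae_unitMass_mem_Ioo] with z hz s hs
      have h1 := (hφ.differentiable one_ne_zero (X z s, s)).hasFDerivAt.comp_hasDerivAt
        (f := fun s => (X z s, s)) s ((F.hasDerivAt z hz s hs.1.le).prodMk (hasDerivAt_id s))
      refine h1.congr_deriv ?_
      have e : ((vel z s, 1) : ℝ × ℝ) = (0, 1) + vel z s • (1, 0) := by ext <;> simp
      change fderiv ℝ φ (X z s, s) (vel z s, 1) = _
      rw [e, map_add, map_smul, smul_eq_mul]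
  -- The average of `φ` along the flow vanishes at time `0` and for large times, so its time
  -- derivative integrates to zero; this is the weak equation.
  have hFTC := integral_Ioi_of_hasDerivAt_of_tendsto (c0 0 le_rfl).continuousWithinAt hder
    (i1.add i2) (m := 0) (tendsto_const_nhds.congr' (by
      filter_upwards [eventually_gt_atTop T] with t ht
      simp [image_eq_zero_of_notMem_tsupport (hT' _ t ht)]))
  have h0 : ∀ x, φ (x, 0) = 0 := fun x =>
    image_eq_zero_of_notMem_tsupport fun hcon => lt_irrefl (0 : ℝ) (hφs hcon).2
  simp only [h0, integral_zero, sub_zero] at hFTC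
  exact (integral_add i1 i2).symm.trans hFTC

end IsQuantileFlow

/-! ### The explicit smoothing rate and continuity of the velocity field -/

/-- Identifies the bound as the reciprocal of the expansion rate from `separation`, treating `K = 0`
and `K ≠ 0` together. -/
theorem smoothingBound_eq (V v : ℝ → ℝ) (lam b t : ℝ) :
    smoothingBound V v lam b t = (b * lam * separationProfile
      ((lipSeminorm v univ : ℝ) * (lipSeminorm (kernelU V lam) univ : ℝ)) t)⁻¹ := by
  simp only [smoothingBound, separationProfile]
  split_ifs with hK
  · rw [one_div]
  · rw [mul_inv, inv_div]
    ring

theorem smoothingBound_anti {V v : ℝ → ℝ} {lam b s t : ℝ} (hlam : 0 < lam) (hb : 0 < b)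
    (hs : 0 < s) (hst : s ≤ t) : smoothingBound V v lam b t ≤ smoothingBound V v lam b s := by
  rw [smoothingBound_eq, smoothingBound_eq]
  have hK : 0 ≤ (lipSeminorm v univ : ℝ) * (lipSeminorm (kernelU V lam) univ : ℝ) := by positivity
  have h1 := separationProfile_pos hK hs
  have h2 := separationProfile_mono hK hst
  gcongr

theorem StandingAssumptions.continuous_nonlocalVelocity {V v : ℝ → ℝ} {lam b : ℝ}
    (h : StandingAssumptions V v lam b) {μ : Measure ℝ} [IsProbabilityMeasure μ]
    (hμ : Integrable (fun y => y) μ) (hat : ∀ x, μ {x} = 0) :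
    Continuous (nonlocalVelocity V v μ) :=
  continuous_iff_continuousAt.2 fun x =>
    h.tendsto_nonlocalVelocity (μ := fun _ : ℝ => μ) (fun _ => hμ) hμ hat
      (Eventually.of_forall fun _ => hat) (by simp [quantileDist]) tendsto_id

/-! ### From the quantile flow to a dissipative solution -/

namespace IsQuantileFlow

variable {V v w : ℝ → ℝ} {lam b : ℝ} {p : ℝ≥0∞} {ρ₀ : ProbabilityMeasure ℝ}
  {ρ : ℝ≥0 → ProbabilityMeasure ℝ} {X d : ℝ → ℝ → ℝ} {N : ℝ → ℝ}

theorem hasFiniteMoment (F : IsQuantileFlow V w lam (quantile ρ₀) X d N)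
    (hmom : HasFiniteMoment p (ρ₀ : Measure ℝ)) {t : ℝ≥0}
    (hq : ∀ z ∈ Ioo (0 : ℝ) 1, quantile (ρ t : Measure ℝ) z = X z t) :
    HasFiniteMoment p (ρ t : Measure ℝ) := by
  rw [hasFiniteMoment_iff]
  have hW : MemLp (fun z => 1 + ‖quantile (ρ₀ : Measure ℝ) z‖) p unitMass :=
    (memLp_const (1 : ℝ)).add ((hasFiniteMoment_iff _ p).1 hmom).norm
  refine hW.of_le_mul (c := N t) (aemeasurable_quantile _).aestronglyMeasurable ?_
  filter_upwards [ae_unitMass_mem_Ioo] with z hz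
  rw [hq z hz, Real.norm_of_nonneg (by positivity : (0 : ℝ) ≤ 1 + ‖quantile (ρ₀ : Measure ℝ) z‖)]
  exact F.growth z t

theorem tendsto_wasserstein (F : IsQuantileFlow V w lam (quantile ρ₀) X d N)
    (hmom : HasFiniteMoment p (ρ₀ : Measure ℝ))
    (hq : ∀ t : ℝ≥0, ∀ z ∈ Ioo (0 : ℝ) 1, quantile (ρ t : Measure ℝ) z = X z t) (t : ℝ≥0) :
    Tendsto (fun s => wasserstein p (ρ s : Measure ℝ) (ρ t : Measure ℝ)) (𝓝 t) (𝓝 0) := by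
  have hW : MemLp (fun z => 1 + ‖quantile (ρ₀ : Measure ℝ) z‖) p unitMass :=
    (memLp_const (1 : ℝ)).add ((hasFiniteMoment_iff _ p).1 hmom).norm
  have hd : Tendsto (fun s : ℝ≥0 => d s t) (𝓝 t) (𝓝 0) :=
    (F.tendsto_increment t t.coe_nonneg).comp (NNReal.continuous_coe.tendsto t)
  have hlim := ENNReal.Tendsto.mul_const (ENNReal.tendsto_ofReal hd)
    (Or.inr hW.eLpNorm_ne_top)
  rw [ENNReal.ofReal_zero, zero_mul] at hlim
  refine tendsto_of_tendsto_of_tendsto_of_le_of_le tendsto_const_nhds hlim (fun _ => zero_le)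
    fun s => eLpNorm_le_mul_eLpNorm_of_ae_le_mul ?_ p
  filter_upwards [ae_unitMass_mem_Ioo] with z hz
  rw [hq s z hz, hq t z hz,
    Real.norm_of_nonneg (by positivity : (0 : ℝ) ≤ 1 + ‖quantile (ρ₀ : Measure ℝ) z‖)]
  exact F.increment z s t

/-- Without atoms the mass to the left of `X z t` is `z`, so `V * μ` there is the argument of `w`.
Being an average of `V` it lies above `inf V`, where `w` and `v` agree. -/
theorem nonlocalVelocity_eq (h : StandingAssumptions V v lam b)
    (hwv : ∀ r : ℝ, (⨅ x, (V x : EReal)) ≤ r → w r = v r) {t : ℝ}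
    {μ : Measure ℝ} [IsProbabilityMeasure μ] (hμ : Integrable (fun y => y) μ)
    (hat : ∀ x, μ {x} = 0) (hq : ∀ z ∈ Ioo (0 : ℝ) 1, quantile μ z = X z t) {z : ℝ}
    (hz : z ∈ Ioo (0 : ℝ) 1) :
    nonlocalVelocity V v μ (X z t) =
      w (∫ ζ, kernelU V lam (X z t - X ζ t) ∂unitMass - lam * z) := by
  have h1 := h.integral_kernel_sub hμ (X z t)
  have h2 := h.iInf_kernel_le_integral hμ (X z t)
  have h3 : μ.real (Iio (X z t)) = z := by
    rw [measureReal_congr (Iio_ae_eq_Iic' (hat _)), ← hq z hz, cdf_quantile hat hz]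
  have h4 : ∫ ζ, kernelU V lam (X z t - quantile μ ζ) ∂unitMass =
      ∫ ζ, kernelU V lam (X z t - X ζ t) ∂unitMass := by
    refine integral_congr_ae ?_
    filter_upwards [ae_unitMass_mem_Ioo] with ζ hζ
    rw [hq ζ hζ]
  rw [h.integral_kernelU_eq_quantile, h4, h3] at h1
  rw [nonlocalVelocity, ← hwv _ h2, h1]

theorem isDissipativeSolution (F : IsQuantileFlow V w lam (quantile ρ₀) X d N)
    (h : StandingAssumptions V v lam b) (hp : 1 ≤ p) (hmom : HasFiniteMoment p (ρ₀ : Measure ℝ))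
    {L : ℝ≥0} (hw : LipschitzWith L w) (hwv : ∀ r : ℝ, (⨅ x, (V x : EReal)) ≤ r → w r = v r)
    (hρ : ∀ t : ℝ≥0, (ρ t : Measure ℝ) = unitMass.map fun z => X z t)
    (hq : ∀ t : ℝ≥0, ∀ z ∈ Ioo (0 : ℝ) 1, quantile (ρ t : Measure ℝ) z = X z t)
    (hden : ∀ t : ℝ≥0, 0 < t → HasBoundedDensity (ρ t : Measure ℝ)) :
    IsDissipativeSolution V v p ρ₀ ρ := by
  have hmt : ∀ t, HasFiniteMoment p (ρ t : Measure ℝ) := fun t => F.hasFiniteMoment hmom (hq t)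
  have hX₀ : Integrable (quantile (ρ₀ : Measure ℝ)) unitMass :=
    integrable_quantile (hmom.integrable hp)
  refine ⟨hmt, F.tendsto_wasserstein hmom hq, hden, fun φ hφ hφc hφs => ?_, ?_⟩
  · have hρ' : ∀ t ∈ Ioi (0 : ℝ), (ρ t.toNNReal : Measure ℝ) = unitMass.map fun z => X z t := by
      intro t ht
      rw [hρ, Real.coe_toNNReal t (le_of_lt ht)]
    have hXm : ∀ t, AEMeasurable (fun z => X z t) unitMass := fun t =>
      (F.aestronglyMeasurable t).aemeasurable
    have hpair : ∀ t : ℝ, Continuous fun x : ℝ => (x, t) := fun t =>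
      continuous_id.prodMk continuous_const
    have d1 : ∀ x t, deriv (fun s => φ (x, s)) t = fderiv ℝ φ (x, t) (0, 1) := fun x t =>
      (IsDissipativeSolution.hasDerivAt_snd hφ x t).deriv
    have d2 : ∀ x t, deriv (fun y => φ (y, t)) x = fderiv ℝ φ (x, t) (1, 0) := fun x t =>
      (IsDissipativeSolution.hasDerivAt_fst hφ x t).deriv
    simp only [d1, d2]
    refine Eq.trans (congrArg₂ (· + ·) ?_ ?_) (F.weak_equation h hX₀ hw hφ hφc hφs)
    · refine setIntegral_congr_fun measurableSet_Ioi fun t ht => ?_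
      simp only [hρ' t ht]
      exact integral_map (hXm t)
        ((IsDissipativeSolution.continuous_fderiv_apply' hφ _).comp (hpair t)).aestronglyMeasurable
    · refine setIntegral_congr_fun measurableSet_Ioi fun t ht => ?_
      have hat : ∀ x, (ρ t.toNNReal : Measure ℝ) {x} = 0 :=
        (hden t.toNNReal (by simpa using ht)).measure_singleton
      have hint := (hmt t.toNNReal).integrable hp
      have hqt : ∀ z ∈ Ioo (0 : ℝ) 1, quantile (ρ t.toNNReal : Measure ℝ) z = X z t := by
        intro z hz
        rw [hq _ z hz, Real.coe_toNNReal t (le_of_lt ht)]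
      have hc : Continuous fun x => nonlocalVelocity V v (ρ t.toNNReal : Measure ℝ) x *
          fderiv ℝ φ (x, t) (1, 0) :=
        (h.continuous_nonlocalVelocity hint hat).mul
          ((IsDissipativeSolution.continuous_fderiv_apply' hφ _).comp (hpair t))
      have e1 : ∫ x, nonlocalVelocity V v (ρ t.toNNReal : Measure ℝ) x *
          fderiv ℝ φ (x, t) (1, 0) ∂(ρ t.toNNReal : Measure ℝ) =
          ∫ z, nonlocalVelocity V v (ρ t.toNNReal : Measure ℝ) (X z t) *
          fderiv ℝ φ (X z t, t) (1, 0) ∂unitMass := by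
        conv_lhs => rw [hρ' t ht]
        rw [integral_map (hXm t) (Continuous.aestronglyMeasurable (by rw [← hρ' t ht]; exact hc)),
          ← hρ' t ht]
      refine e1.trans (integral_congr_ae ?_)
      filter_upwards [ae_unitMass_mem_Ioo] with z hz
      rw [nonlocalVelocity_eq h hwv hint hat hqt hz]
  · have : (ρ 0 : Measure ℝ) = (ρ₀ : Measure ℝ) := by
      rw [hρ]
      simp only [NNReal.coe_zero, F.initial]
      exact map_quantile _
    exact Subtype.ext this

/-- The identity between `w` and `v` is asked only for `t > 0`, since initial atoms may spoil it at
`t = 0`. Local Lipschitz continuity up to `t = 0` comes from the equation with `w`, which holds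
there too. -/
theorem solvesQuantileEquation (F : IsQuantileFlow V w lam (quantile ρ₀) X d N)
    (h : StandingAssumptions V v lam b) (hX₀ : Integrable (quantile (ρ₀ : Measure ℝ)) unitMass)
    {L : ℝ≥0} (hw : LipschitzWith L w) (hinit : ρ 0 = ρ₀)
    (hq : ∀ t : ℝ≥0, ∀ z ∈ Ioo (0 : ℝ) 1, quantile (ρ t : Measure ℝ) z = X z t)
    (hwv : ∀ t : ℝ, 0 < t → ∀ z ∈ Ioo (0 : ℝ) 1,
      w (∫ ζ, kernelU V lam (X z t - X ζ t) ∂unitMass - lam * z) =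
      v (∫ ζ, kernelU V lam (X z t - X ζ t) ∂unitMass - lam * z)) :
    SolvesQuantileEquation V v lam ρ₀ ρ := by
  have hqc : ∀ t : ℝ, 0 ≤ t → ∀ z ∈ Ioo (0 : ℝ) 1, quantileCurve ρ z t = X z t := by
    intro t ht z hz
    rw [quantileCurve, hq _ z hz, Real.coe_toNNReal t ht]
  refine ⟨fun z => by simp [quantileCurve, hinit], ?_, ?_⟩
  · filter_upwards [ae_unitMass_mem_Ioo] with z hz
    intro t ht
    have ht0 : 0 ≤ t := ht
    set u := fun t => w (∫ ζ, kernelU V lam (X z t - X ζ t) ∂unitMass - lam * z) with hu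
    have hev := (F.tendsto_velocity h hX₀ hw z ht0).norm.eventually_lt_const (lt_add_one _)
    obtain ⟨r, hr, hball⟩ := Metric.eventually_nhds_iff_ball.1 hev
    refine ⟨(‖u t‖ + 1).toNNReal, Metric.ball t r ∩ Ici 0,
      inter_mem (mem_nhdsWithin_of_mem_nhds (Metric.ball_mem_nhds t hr)) self_mem_nhdsWithin, ?_⟩
    have hlip := ((convex_ball t r).inter (convex_Ici (0 : ℝ))).lipschitzOnWith_of_nnnorm_hasDerivWithin_le
      (f := X z) (f' := u) (C := (‖u t‖ + 1).toNNReal)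
      (fun s hs => (F.hasDerivAt z hz s hs.2).hasDerivWithinAt) (fun s hs => by
        rw [← NNReal.coe_le_coe, coe_nnnorm, Real.coe_toNNReal _ (by positivity)]
        exact (hball s hs.1).le)
    refine LipschitzOnWith.of_dist_le_mul fun s hs s' hs' => ?_
    simp only [hqc s hs.2 z hz, hqc s' hs'.2 z hz]
    exact hlip.dist_le_mul s hs s' hs'
  · have hae : ∀ᵐ q ∂((volume : Measure (ℝ × ℝ)).restrict (Icc (0 : ℝ) 1 ×ˢ Ioi (0 : ℝ))),
        q.1 ∈ Ioo (0 : ℝ) 1 := by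
      rw [Measure.volume_eq_prod, ← Measure.prod_restrict]
      exact Measure.quasiMeasurePreserving_fst.ae ae_unitMass_mem_Ioo
    filter_upwards [hae, ae_restrict_mem (measurableSet_Icc.prod measurableSet_Ioi)] with q hq1 hq2
    have ht : 0 < q.2 := hq2.2
    have hI : ∫ ζ in Icc (0 : ℝ) 1,
        kernelU V lam (quantileCurve ρ q.1 q.2 - quantileCurve ρ ζ q.2) =
        ∫ ζ, kernelU V lam (X q.1 q.2 - X ζ q.2) ∂unitMass := by
      refine integral_congr_ae ?_
      filter_upwards [ae_unitMass_mem_Ioo] with ζ hζ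
      rw [hqc _ ht.le _ hq1, hqc _ ht.le _ hζ]
    rw [hI, ← hwv _ ht _ hq1]
    refine (F.hasDerivAt q.1 hq1 q.2 ht.le).congr_of_eventuallyEq ?_
    filter_upwards [lt_mem_nhds ht] with s hs
    exact hqc s (le_of_lt hs) q.1 hq1

end IsQuantileFlow

/-- Existence of dissipative solutions, with the quantile equation and the smoothing estimate. -/
theorem StandingAssumptions.exists_isDissipativeSolution {V v : ℝ → ℝ} {lam b : ℝ}
    (h : StandingAssumptions V v lam b) {p : ℝ≥0∞} (hp : 1 ≤ p) {ρ₀ : ProbabilityMeasure ℝ}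
    (hmom : HasFiniteMoment p (ρ₀ : Measure ℝ)) :
    ∃ ρ : ℝ≥0 → ProbabilityMeasure ℝ, IsDissipativeSolution V v p ρ₀ ρ ∧
      SolvesQuantileEquation V v lam ρ₀ ρ ∧
      ∀ t : ℝ≥0, 0 < t →
        densityNorm (ρ t : Measure ℝ) ≤ ENNReal.ofReal (smoothingBound V v lam b t) := by
  obtain ⟨w, hw, hdec, hwv⟩ := h.exists_decreasing_extension
  have hX₀ : Integrable (quantile (ρ₀ : Measure ℝ)) unitMass :=
    integrable_quantile (hmom.integrable hp)
  have hmono := quantile_monotoneOn (ρ₀ : Measure ℝ)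
  obtain ⟨X, d, N, F⟩ := h.exists_quantile_flow hw hX₀
  set K : ℝ := (lipSeminorm v univ : ℝ) * (lipSeminorm (kernelU V lam) univ : ℝ) with hK
  have hK0 : 0 ≤ K := by positivity
  have hsep : ∀ t : ℝ, 0 ≤ t → ∀ z₁ ∈ Ioo (0 : ℝ) 1, ∀ z₂ ∈ Ioo (0 : ℝ) 1, z₁ < z₂ →
      b * lam * (z₂ - z₁) * separationProfile K t ≤ X z₂ t - X z₁ t := fun t ht z₁ h1 z₂ h2 hlt =>
    F.separation h hX₀ hmono hw h.rate_le hdec h.lipschitzWith_kernelU' h1 h2 hlt ht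
  have hXm : ∀ t, AEMeasurable (fun z => X z t) unitMass := fun t =>
    (F.aestronglyMeasurable t).aemeasurable
  have hprofile : ∀ t : ℝ, 0 ≤ t → 0 ≤ separationProfile K t := fun t ht => by
    rw [← separationProfile_zero K]
    exact separationProfile_mono hK0 ht
  have hXmono : ∀ t : ℝ, 0 ≤ t → MonotoneOn (fun z => X z t) (Ioo 0 1) := by
    intro t ht z₁ h1 z₂ h2 hle
    rcases hle.eq_or_lt with rfl | hlt
    · exact le_rfl
    · have h3 := hsep t ht z₁ h1 z₂ h2 hlt
      have h4 : 0 ≤ b * lam * (z₂ - z₁) * separationProfile K t :=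
        mul_nonneg (mul_nonneg (mul_nonneg h.b_pos.le h.lam_pos.le) (sub_nonneg.2 hle))
          (hprofile t ht)
      exact sub_nonneg.1 (h4.trans h3)
  let ρ : ℝ≥0 → ProbabilityMeasure ℝ := fun t =>
    ⟨unitMass.map fun z => X z t, Measure.isProbabilityMeasure_map (hXm t)⟩
  have hρ : ∀ t : ℝ≥0, (ρ t : Measure ℝ) = unitMass.map fun z => X z t := fun t => rfl
  have hq : ∀ t : ℝ≥0, ∀ z ∈ Ioo (0 : ℝ) 1, quantile (ρ t : Measure ℝ) z = X z t := by
    intro t z hz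
    rw [hρ]
    exact quantile_map_of_monotoneOn (hXmono t t.coe_nonneg)
      (fun z hz => F.leftContinuous z t (quantile_leftContinuous _ hz)) hz
  have hle : ∀ t : ℝ≥0, 0 < t →
      (ρ t : Measure ℝ) ≤ ENNReal.ofReal (smoothingBound V v lam b t) • volume := by
    intro t ht
    rw [hρ, smoothingBound_eq]
    refine map_unitMass_le_of_separated (hXm t)
      (mul_pos (mul_pos h.b_pos h.lam_pos) (separationProfile_pos hK0 (by exact_mod_cast ht)))
      fun z₁ h1 z₂ h2 hlt => ?_
    have := hsep t t.coe_nonneg z₁ h1 z₂ h2 hlt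
    linarith
  have hden : ∀ t : ℝ≥0, 0 < t → HasBoundedDensity (ρ t : Measure ℝ) := fun t ht =>
    hasBoundedDensity_of_le_smul ENNReal.ofReal_ne_top (hle t ht)
  have hsol := F.isDissipativeSolution h hp hmom hw hwv hρ hq hden
  refine ⟨ρ, hsol, F.solvesQuantileEquation h hX₀ hw hsol.initial hq (fun t ht z hz => ?_),
    fun t ht => densityNorm_le_of_le_smul (hle t ht)⟩
  have hqt : ∀ z ∈ Ioo (0 : ℝ) 1, quantile (ρ t.toNNReal : Measure ℝ) z = X z t := by
    intro z hz
    rw [hq _ z hz, Real.coe_toNNReal t ht.le]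
  -- The same velocity is computed twice, once with `w` and once with `v` in its place, which shows
  -- that the two maps agree along the flow.
  have h1 := IsQuantileFlow.nonlocalVelocity_eq h hwv (hsol.integrable_id hp t.toNNReal)
    (hsol.measure_singleton ht) hqt hz
  have h2 := IsQuantileFlow.nonlocalVelocity_eq h (w := v) (fun _ _ => rfl)
    (hsol.integrable_id hp t.toNNReal) (hsol.measure_singleton ht) hqt hz
  rw [← h1, h2]

/-- A uniform bound on the densities yields a jointly measurable locally bounded density. -/
theorem IsDissipativeSolution.locallyBoundedDensity {V v : ℝ → ℝ} {p : ℝ≥0∞}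
    {ρ₀ : ProbabilityMeasure ℝ} {ρ : ℝ≥0 → ProbabilityMeasure ℝ}
    (hρ : IsDissipativeSolution V v p ρ₀ ρ) (hp : 1 ≤ p) {β : ℝ → ℝ}
    (hβ : ∀ s t, 0 < s → s ≤ t → β t ≤ β s)
    (hbd : ∀ t : ℝ≥0, 0 < t → densityNorm (ρ t : Measure ℝ) ≤ ENNReal.ofReal (β t)) :
    LocallyBoundedDensity ρ := by
  -- Mean densities over balls of radius `1 / (n + 1)`. As differences of distribution functions
  -- they are jointly continuous in space and positive time, so their upper limit is jointly
  -- measurable; Besicovitch differentiation identifies it with the density for each `t`.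
  set Q : ℕ → ℝ × ℝ → ℝ≥0∞ := fun n q => if 0 < q.1 then
    ENNReal.ofReal ((ρ q.1.toNNReal : Measure ℝ).real (Iic (q.2 + 1 / ((n : ℝ) + 1))) -
      (ρ q.1.toNNReal : Measure ℝ).real (Iic (q.2 - 1 / ((n : ℝ) + 1)))) /
      volume (Metric.closedBall q.2 (1 / ((n : ℝ) + 1))) else 0 with hQ
  have hset : MeasurableSet {q : ℝ × ℝ | 0 < q.1} := measurableSet_lt measurable_const measurable_fst
  have hcdf : ∀ q : ℝ × ℝ, 0 < q.1 → ∀ c : ℝ, ContinuousAt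
      (fun q : ℝ × ℝ => (ρ q.1.toNNReal : Measure ℝ).real (Iic (q.2 + c))) q := by
    intro q hq c
    refine tendsto_cdf_of_quantileDist (fun q => hρ.integrable_id hp _) (hρ.integrable_id hp _)
      (hρ.measure_singleton hq) ((hρ.tendsto_quantileDist hp q.1).comp (continuous_fst.tendsto q)) ?_
    exact (continuous_snd.add continuous_const).tendsto q
  have hQm : ∀ n, Measurable (Q n) := by
    intro n
    have hc : ContinuousOn (fun q : ℝ × ℝ =>
        (ρ q.1.toNNReal : Measure ℝ).real (Iic (q.2 + 1 / ((n : ℝ) + 1))) -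
        (ρ q.1.toNNReal : Measure ℝ).real (Iic (q.2 - 1 / ((n : ℝ) + 1))))
        {q : ℝ × ℝ | 0 < q.1} := fun q hq => by
      have h2 := hcdf q hq (-(1 / ((n : ℝ) + 1)))
      simp only [← sub_eq_add_neg] at h2
      exact ((hcdf q hq _).sub h2).continuousWithinAt
    have hm := hc.measurable_piecewise (g := fun _ => (0 : ℝ)) continuousOn_const hset
    have e : Q n = fun q => ENNReal.ofReal ({q : ℝ × ℝ | 0 < q.1}.piecewise (fun q : ℝ × ℝ =>
        (ρ q.1.toNNReal : Measure ℝ).real (Iic (q.2 + 1 / ((n : ℝ) + 1))) -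
        (ρ q.1.toNNReal : Measure ℝ).real (Iic (q.2 - 1 / ((n : ℝ) + 1)))) (fun _ => (0 : ℝ)) q) /
        volume (Metric.closedBall q.2 (1 / ((n : ℝ) + 1))) := by
      funext q
      by_cases hq : 0 < q.1 <;> simp [hQ, hq]
    rw [e]
    simp only [Real.volume_closedBall]
    exact hm.ennreal_ofReal.div measurable_const
  set r : ℝ → ℝ → ℝ≥0∞ := fun t x => limsup (fun n => Q n (t, x)) atTop with hr
  have hrm : Measurable (Function.uncurry r) := Measurable.limsup hQm
  have hae : ∀ t, 0 < t → r t =ᵐ[volume] (ρ t.toNNReal : Measure ℝ).rnDeriv volume := by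
    intro t ht
    filter_upwards [Besicovitch.ae_tendsto_rnDeriv (ρ t.toNNReal : Measure ℝ) volume] with x hx
    have hseq : Tendsto (fun n : ℕ => 1 / ((n : ℝ) + 1)) atTop (𝓝[>] 0) :=
      tendsto_nhdsWithin_iff.2 ⟨tendsto_one_div_add_atTop_nhds_zero_nat,
        Eventually.of_forall fun n => by simp only [mem_Ioi]; positivity⟩
    refine ((hx.comp hseq).congr fun n => ?_).limsup_eq
    have hn : (0 : ℝ) < 1 / ((n : ℝ) + 1) := by positivity
    simp only [Function.comp_apply, hQ, ht, if_true]
    congr 1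
    rw [Real.closedBall_eq_Icc, ← measure_congr (Ioc_ae_eq_Icc' (hρ.measure_singleton ht _)),
      ← Iic_sdiff_Iic, ← ofReal_measureReal,
      measureReal_sdiff (Iic_subset_Iic.2 (by linarith)) measurableSet_Iic]
  refine ⟨r, hrm, fun t ht => ?_, fun t₁ t₂ ht₁ => ⟨(β t₁).toNNReal, fun t ht => ?_⟩⟩
  · have ht' : 0 < t.toNNReal := by simpa using ht
    rw [withDensity_congr_ae (hae t ht), Measure.withDensity_rnDeriv_eq _ _
      (hρ.boundedDensity _ ht').1]
  · have ht0 : 0 < t := ht₁.trans_le ht.1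
    rw [essSup_congr_ae (hae t ht0)]
    refine (hbd t.toNNReal (by simpa using ht0)).trans (ENNReal.ofReal_le_ofReal ?_)
    rw [Real.coe_toNNReal t ht0.le]
    exact hβ t₁ t ht₁ ht.1

/-! ### Assembly of existence, uniqueness, smoothing and stability -/

theorem theorem2p3 (V v : ℝ → ℝ) (lam b : ℝ) (h : StandingAssumptions V v lam b)
    (p : ℝ≥0∞) (hp : 1 ≤ p) :
    (∀ ρ₀ : ProbabilityMeasure ℝ, HasFiniteMoment p (ρ₀ : Measure ℝ) →
      (∃! ρ : ℝ≥0 → ProbabilityMeasure ℝ, IsDissipativeSolution V v p ρ₀ ρ) ∧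
      ∀ ρ : ℝ≥0 → ProbabilityMeasure ℝ, IsDissipativeSolution V v p ρ₀ ρ →
        SolvesQuantileEquation V v lam ρ₀ ρ ∧
        LocallyBoundedDensity ρ ∧
        ∀ t : ℝ≥0, 0 < t →
          densityNorm (ρ t : Measure ℝ) ≤ ENNReal.ofReal (smoothingBound V v lam b t)) ∧
    (∀ ρ₁₀ ρ₂₀ : ProbabilityMeasure ℝ,
      HasFiniteMoment p (ρ₁₀ : Measure ℝ) → HasFiniteMoment p (ρ₂₀ : Measure ℝ) →
      ∀ ρ₁ ρ₂ : ℝ≥0 → ProbabilityMeasure ℝ,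
        IsDissipativeSolution V v p ρ₁₀ ρ₁ → IsDissipativeSolution V v p ρ₂₀ ρ₂ →
        ∀ t : ℝ≥0,
          wasserstein p (ρ₁ t : Measure ℝ) (ρ₂ t : Measure ℝ) ≤
            ENNReal.ofReal (Real.exp (stabilityConst V v p * t)) *
              wasserstein p (ρ₁₀ : Measure ℝ) (ρ₂₀ : Measure ℝ)) := by
  refine ⟨fun ρ₀ hρ₀ => ?_, fun ρ₁₀ ρ₂₀ _ _ ρ₁ ρ₂ h₁ h₂ t => h₁.wasserstein_le h₂ h hp t⟩
  obtain ⟨ρ, hρ, hquant, hden⟩ := h.exists_isDissipativeSolution hp hρ₀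
  refine ⟨⟨ρ, hρ, fun ρ' hρ' => hρ'.unique hρ h hp⟩, fun ρ' hρ' => ?_⟩
  rw [hρ'.unique hρ h hp]
  exact ⟨hquant, hρ.locallyBoundedDensity hp
    (fun s t hs hst => smoothingBound_anti h.lam_pos h.b_pos hs hst) hden, hden⟩
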